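/- **Setting.** For $n>0$ and $z\in\mathbb R^d$ let $\Lambda_n(z)=\prod_{i=1}^d[z_i,z_i+n]$ and $\Lambda_n=\Lambda_n(0)$. A point process $\eta$ on $\mathbb R^d$ is a random simple, locally finite counting measure. Throughout, $\eta$ is stationary, has intensity measure equal to Lebesgue measure $\lambda_d$, and is hyperuniform, i.e. $\operatorname{Var}(\eta(\Lambda_n))/n^d\to0$ as $n\to\infty$ ($n$ real). Let $\alpha^k$ be the $k$-th factorial moment measure of $\eta$, $\alpha^k(W)=\mathbb E\sum^{\neq}\mathbf 1\{(X_1,\dots,X_k)\in W\}$, the sum being over $k$-tuples of distinct points of $\eta$, and let $\alpha^2_!$ be the reduced measure, $\int f\,d\alpha^2=\iint f(x+y,y)\,\alpha^2_!(dx)\,dy$ for measurable $f\ge0$. The truncated pair correlation measure $\beta=\alpha^2_!-\lambda_d$ is assumed to be a signed measure of finite total variation, $|\beta|(\mathbb R^d)<\infty$. It is called symmetric if it is invariant under permutations of the coordinates and under reflections of individual coordinates. The process $\eta$ is Brillinger-mixing if all $\alpha^k$ are locally finite and for every $k\ge2$ there is a signed measure $\gamma_!^{(k)}$ on $(\mathbb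 R^d)^{k-1}$ of finite total variation such that the factorial cumulant measure $$\gamma^{(k)}=\sum_{\pi}(-1)^{|\pi|-1}(|\pi|-1)!\prod_{B\in\pi}\alpha^{|B|}(dx_B)$$ (sum over the partitions $\pi$ of $\{1,\dots,k\}$) satisfies $\gamma^{(k)}(W)=\int\gamma^{(k)}_!\{x:(x_1+y,\dots,x_{k-1}+y,y)\in W\}\,dy$ for all bounded Borel sets $W\subset(\mathbb R^d)^k$. **Theorem.** Let $\eta$ be as above and Brillinger-mixing, and suppose that one of the following holds. 1. $d\ge2$, $\beta$ is symmetric and $\int|y|\,|\beta|(dy)<\infty$. 2. $d=1$ and $G(y)=-\int_0^y\beta([x,\infty))\,dx$ is regularly varying with index $a\in(0,1]$: $G(xn)/G(n)\to x^a$ as $n\to\infty$, for all $x>0$. 3. $d=2$, $\beta$ is symmetric, and with $F(x)=\beta([x_1,\infty)\times[x_2,\infty))$ and $G_\pm(y_1,y_2)=\int_0^{y_1}\int_0^{y_2}F(\pm x_1,x_2)\,dx_2\,dx_1$ there are $a_\pm\in\mathbb R$ and functions $g_\pm$, positive on the unit vectors of the open quadrant $(0,\infty)^2$, such that $G_\pm(nx_1,nx_2)/G_\pm(n,n)\to\|x\|^{a_\pm}g_\pm(x/\|x\|)$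 as $n\to\infty$ for all $x\in(0,\infty)^2$; moreover $\lim_{n\to\infty}G_+(n,n)/G_-(n,n)$ exists in $\mathbb R$. Then the limit $$\operatorname{cov}(z)=\lim_{n\to\infty}\frac{\operatorname{Cov}(\eta(\Lambda_n),\eta(\Lambda_n(nz)))}{\operatorname{Var}(\eta(\Lambda_n))}$$ exists for every $z\in\mathbb R^d$, and there is a centred stationary Gaussian field $(\mathcal G(z))_{z\in\mathbb R^d}$ with $\operatorname{Cov}(\mathcal G(z),\mathcal G(w))=\operatorname{cov}(z-w)$ such that, as $n\to\infty$, $$\left(\frac{\eta(\Lambda_n(nz))-n^d}{\sqrt{\operatorname{Var}(\eta(\Lambda_n))}}\right)_{z\in\mathbb R^d}\longrightarrow(\mathcal G(z))_{z\in\mathbb R^d}$$ weakly in the sense of finite-dimensional distributions. In case 2, $\mathcal G$ can be taken as $\mathcal G(z)=B(z+1)-B(z)$, where $B=B_{a/2}$ is a fractional Brownian motion on $\mathbb R$ with Hurst index $a/2$, i.e. a centred Gaussian process with $\mathbb E[B(s)B(t)]=\tfrac12(|s|^a+|t|^a-|t-s|^a)$. -/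

import Mathlib

open MeasureTheory ProbabilityTheory Filter Topology
open scoped ENNReal

noncomputable section

/-- `ℝ^d` with the Euclidean norm. -/
abbrev Space (d : ℕ) := EuclideanSpace ℝ (Fin d)

/-- The box `Λ_n(z) = [z_1, z_1 + n] × ⋯ × [z_d, z_d + n]`. -/
def box {d : ℕ} (z : Space d) (n : ℝ) : Set (Space d) :=
  {x | ∀ i, z i ≤ x i ∧ x i ≤ z i + n}

/-! ### Point processes -/

/-- A simple, locally finite counting measure: the counting measure of a set that has finitely many
points in every bounded region. -/
def IsSimpleCounting {d : ℕ} (μ : Measure (Space d)) : Prop :=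
  ∃ S : Set (Space d), (∀ B : Set (Space d), Bornology.IsBounded B → (S ∩ B).Finite) ∧
    μ = Measure.count.restrict S

/-- A point process: a random simple locally finite counting measure. The measurable structure on
`Measure (Space d)` is the one generated by the evaluations `μ ↦ μ W`, `W` Borel. -/
structure IsPointProcess {Ω : Type*} [MeasurableSpace Ω] {d : ℕ}
    (η : Ω → Measure (Space d)) : Prop where
  measurable : Measurable η
  simple : ∀ ω, IsSimpleCounting (η ω)

/-- Stationarity: the law of `η` is invariant under all shifts `θ_x μ (W) = μ (W + x)`. -/
def IsShiftStationary {Ω : Type*} [MeasurableSpace Ω] {d : ℕ} (P : Measure Ω)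
    (η : Ω → Measure (Space d)) : Prop :=
  ∀ x : Space d, P.map (fun ω => (η ω).map (fun y => y - x)) = P.map η

/-- The intensity measure `W ↦ 𝔼[η(W)]` is Lebesgue measure. -/
def HasUnitIntensity {Ω : Type*} [MeasurableSpace Ω] {d : ℕ} (P : Measure Ω)
    (η : Ω → Measure (Space d)) : Prop :=
  ∀ W : Set (Space d), MeasurableSet W → ∫⁻ ω, η ω W ∂P = volume W

/-- The number of points `η(W)`, as a real random variable. -/
def pointCount {Ω : Type*} {d : ℕ} (η : Ω → Measure (Space d)) (W : Set (Space d)) (ω : Ω) : ℝ :=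
  (η ω W).toReal

/-- Hyperuniformity: `Var(η(Λ_n)) / n^d → 0` as `n → ∞`. -/
def IsHyperuniform {Ω : Type*} [MeasurableSpace Ω] {d : ℕ} (P : Measure Ω)
    (η : Ω → Measure (Space d)) : Prop :=
  Tendsto (fun n : ℝ => Var[pointCount η (box 0 n); P] / n ^ d) atTop (𝓝 0)

/-- A stationary hyperuniform (simple) point process of unit intensity. -/
structure IsStationaryHyperuniform {Ω : Type*} [MeasurableSpace Ω] {d : ℕ} (P : Measure Ω)
    (η : Ω → Measure (Space d)) : Prop where
  pointProcess : IsPointProcess η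
  stationary : IsShiftStationary P η
  unitIntensity : HasUnitIntensity P η
  hyperuniform : IsHyperuniform P η

/-! ### Factorial moment measures, truncated pair correlation, factorial cumulants -/

/-- The factorial moment measure `α^ι (W) = 𝔼[∑^{≠} 1_W((X_i)_{i ∈ ι})]`, the sum running over
the tuples, indexed by `ι`, of distinct points of `η`. As `η` is simple, the sum is the mass that
the power `η^{⊗ι}` gives to the tuples in `W` with pairwise distinct entries. -/
def factorialMoment {Ω : Type*} [MeasurableSpace Ω] {d : ℕ} (P : Measure Ω)
    (η : Ω → Measure (Space d)) (ι : Type) [Fintype ι] : Measure (ι → Space d) :=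
  P.bind fun ω => (Measure.pi fun _ : ι => η ω).restrict {x | Function.Injective x}

/-- The tuple `(x_1 + y, …, x_m + y, y)`. -/
def shiftSnoc {d m : ℕ} (x : Fin m → Space d) (y : Space d) : Fin (m + 1) → Space d :=
  Fin.snoc (α := fun _ => Space d) (fun i => x i + y) y

/-- `ρ` is the reduced `(m + 1)`-st factorial moment measure of `η`. -/
def IsReducedFactorialMoment {Ω : Type*} [MeasurableSpace Ω] {d : ℕ} (P : Measure Ω)
    (η : Ω → Measure (Space d)) (m : ℕ) (ρ : Measure (Fin m → Space d)) : Prop :=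
  ∀ f : (Fin (m + 1) → Space d) → ℝ≥0∞, Measurable f →
    ∫⁻ x, f x ∂(factorialMoment P η (Fin (m + 1))) =
      ∫⁻ y, ∫⁻ x, f (shiftSnoc x y) ∂ρ ∂volume

/-- The signed measure `β`, which is of finite total variation by its type, is the truncated pair
correlation measure `β = α²_! - λ_d` of the point process `η` of unit intensity. Both terms may
have infinite total mass; the identity is the one on bounded Borel sets. -/
def IsTruncatedPairCorrelation {Ω : Type*} [MeasurableSpace Ω] {d : ℕ} (P : Measure Ω)
    (η : Ω → Measure (Space d)) (β : SignedMeasure (Space d)) : Prop :=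
  ∃ ρ : Measure (Fin 1 → Space d), IsReducedFactorialMoment P η 1 ρ ∧
    ∀ B : Set (Space d), MeasurableSet B → Bornology.IsBounded B →
      ρ {x | x 0 ∈ B} < ∞ ∧ β B = (ρ {x | x 0 ∈ B}).toReal - (volume B).toReal

/-- For a partition `π` of `{1, …, k}`, the measure `∏_{B ∈ π} α^{|B|}(dx_B)` on `(ℝ^d)^k`. -/
def partitionMoment {Ω : Type*} [MeasurableSpace Ω] {d k : ℕ} (P : Measure Ω)
    (η : Ω → Measure (Space d)) (π : Finpartition (Finset.univ : Finset (Fin k))) :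
    Measure (Fin k → Space d) :=
  (Measure.pi fun B : {B : Finset (Fin k) // B ∈ π.parts} =>
      factorialMoment P η {i : Fin k // i ∈ B.1}).map
    fun x i => x ⟨π.part i, π.part_mem.2 (Finset.mem_univ i)⟩ ⟨i, π.mem_part (Finset.mem_univ i)⟩

/-- The value `γ^{(k)}(W)`, `W` bounded, of the `k`-th factorial cumulant measure
`∑_π (-1)^{|π| - 1} (|π| - 1)! ∏_{B ∈ π} α^{|B|}(dx_B)`. -/
def factorialCumulant {Ω : Type*} [MeasurableSpace Ω] {d k : ℕ} (P : Measure Ω)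
    (η : Ω → Measure (Space d)) (W : Set (Fin k → Space d)) : ℝ :=
  ∑ π : Finpartition (Finset.univ : Finset (Fin k)),
    (-1) ^ (π.parts.card - 1) * ((π.parts.card - 1).factorial : ℝ) *
      (partitionMoment P η π W).toReal

/-- Brillinger mixing: all factorial moment measures are locally finite, so that the factorial
cumulant measures exist as signed measures on bounded sets, and for every `k = m + 1 ≥ 2` there is
a reduced cumulant measure `γ_!^{(k)}` on `(ℝ^d)^{k-1}` of finite total variation (a
`SignedMeasure`), i.e. `γ^{(k)}(W) = ∫ γ_!^{(k)}{x : (x_1 + y, …, x_{k-1} + y, y) ∈ W} dy`. -/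
structure IsBrillingerMixing {Ω : Type*} [MeasurableSpace Ω] {d : ℕ} (P : Measure Ω)
    (η : Ω → Measure (Space d)) : Prop where
  locallyFinite : ∀ (k : ℕ) (W : Set (Fin k → Space d)), Bornology.IsBounded W →
    factorialMoment P η (Fin k) W < ∞
  reducedCumulant : ∀ m : ℕ, 1 ≤ m → ∃ γ : SignedMeasure (Fin m → Space d),
    ∀ W : Set (Fin (m + 1) → Space d), MeasurableSet W → Bornology.IsBounded W →
      factorialCumulant P η W = ∫ y : Space d, γ {x | shiftSnoc x y ∈ W}

/-- Invariance of a signed measure under permutations of the coordinates and under reflections of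
individual coordinates. -/
structure IsSymmetricMeasure {d : ℕ} (β : SignedMeasure (Space d)) : Prop where
  perm : ∀ (σ : Equiv.Perm (Fin d)) (B : Set (Space d)), MeasurableSet B →
    β {y | WithLp.toLp 2 (fun i => y (σ i)) ∈ B} = β B
  refl : ∀ (j : Fin d) (B : Set (Space d)), MeasurableSet B →
    β {y | WithLp.toLp 2 (fun i => if i = j then -y i else y i) ∈ B} = β B

/-! ### Tails and regular variation -/

/-- The tail `F(x) = β([x_1, ∞) × ⋯ × [x_d, ∞))`. -/
def tail {d : ℕ} (β : SignedMeasure (Space d)) (x : Space d) : ℝ :=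
  β {y | ∀ i, x i ≤ y i}

/-- Dimension one: `G(y) = -∫_0^y β([x, ∞)) dx`. -/
def integratedTail (β : SignedMeasure (Space 1)) (y : ℝ) : ℝ :=
  -∫ x in (0 : ℝ)..y, tail β !₂[x]

/-- `G` is regularly varying with index `a`. -/
def IsRegularlyVarying (G : ℝ → ℝ) (a : ℝ) : Prop :=
  ∀ x : ℝ, 0 < x → Tendsto (fun n : ℝ => G (x * n) / G n) atTop (𝓝 (x ^ a))

/-- Dimension two: `G_±(y_1, y_2) = ∫_0^{y_1} ∫_0^{y_2} F(± x_1, x_2) dx_2 dx_1`, where `s = ±1`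
is the sign. -/
def integratedTail₂ (β : SignedMeasure (Space 2)) (s : ℝ) (y₁ y₂ : ℝ) : ℝ :=
  ∫ x₁ in (0 : ℝ)..y₁, ∫ x₂ in (0 : ℝ)..y₂, tail β !₂[s * x₁, x₂]

/-- `f` is bivariate `(a, g)`-regularly varying on the open positive quadrant, with `g` positive
on the unit vectors of this quadrant. -/
def IsRegularlyVarying₂ (f : ℝ → ℝ → ℝ) (a : ℝ) (g : Space 2 → ℝ) : Prop :=
  (∀ u : Space 2, ‖u‖ = 1 → 0 < u 0 → 0 < u 1 → 0 < g u) ∧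
  ∀ x : Space 2, 0 < x 0 → 0 < x 1 →
    Tendsto (fun n : ℝ => f (n * x 0) (n * x 1) / f n n) atTop
      (𝓝 (‖x‖ ^ a * g (‖x‖⁻¹ • x)))

/-! ### Limit covariance, Gaussian fields, convergence -/

/-- `K = cov`, i.e. `Cov(η(Λ_n), η(Λ_n(nz))) / Var(η(Λ_n)) → K(z)` for every `z`. -/
def IsLimitCovariance {Ω : Type*} [MeasurableSpace Ω] {d : ℕ} (P : Measure Ω)
    (η : Ω → Measure (Space d)) (K : Space d → ℝ) : Prop :=
  ∀ z : Space d, Tendsto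
    (fun n : ℝ => cov[pointCount η (box 0 n), pointCount η (box (n • z) n); P] /
      Var[pointCount η (box 0 n); P]) atTop (𝓝 (K z))

/-- The normalized box count `(η(Λ_n(nz)) - n^d) / √Var(η(Λ_n))`. -/
def normalizedCount {Ω : Type*} [MeasurableSpace Ω] {d : ℕ} (P : Measure Ω)
    (η : Ω → Measure (Space d)) (n : ℝ) (z : Space d) (ω : Ω) : ℝ :=
  (pointCount η (box (n • z) n) ω - n ^ d) / √(Var[pointCount η (box 0 n); P])

/-- Weak convergence of the finite-dimensional distributions of the fields `X n` to those of `G`,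
as `n → ∞`. -/
def TendstoFDD {Ω Ω' T : Type*} [MeasurableSpace Ω] [MeasurableSpace Ω'] (X : ℝ → T → Ω → ℝ)
    (P : Measure Ω) [IsProbabilityMeasure P] (G : T → Ω' → ℝ) (P' : Measure Ω')
    [IsProbabilityMeasure P'] : Prop :=
  ∀ (N : ℕ) (z : Fin N → T),
    TendstoInDistribution (fun (n : ℝ) ω (i : Fin N) => X n (z i) ω) atTop
      (fun ω (i : Fin N) => G (z i) ω) (fun _ => P) P'

/-- `G` is a centred stationary Gaussian field with covariance `Cov(G(z), G(w)) = K(z - w)`. -/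
structure IsCentredStationaryGaussianField {Ω' : Type*} [MeasurableSpace Ω'] {d : ℕ}
    (P' : Measure Ω') (G : Space d → Ω' → ℝ) (K : Space d → ℝ) : Prop where
  gaussian : IsGaussianProcess G P'
  centred : ∀ z, ∫ ω, G z ω ∂P' = 0
  covariance : ∀ z w, cov[G z, G w; P'] = K (z - w)
  stationary : ∀ (h : Space d) (N : ℕ) (z : Fin N → Space d),
    IdentDistrib (fun ω (i : Fin N) => G (z i + h) ω) (fun ω (i : Fin N) => G (z i) ω) P' P'

/-- `B` is a (two-sided) fractional Brownian motion with Hurst index `H`: a centred Gaussian process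
with covariance `(|s|^{2H} + |t|^{2H} - |t - s|^{2H}) / 2`. -/
structure IsFractionalBrownianMotion {Ω' : Type*} [MeasurableSpace Ω']
    (P' : Measure Ω') (B : ℝ → Ω' → ℝ) (H : ℝ) : Prop where
  gaussian : IsGaussianProcess B P'
  centred : ∀ t, ∫ ω, B t ω ∂P' = 0
  covariance : ∀ s t, cov[B s, B t; P'] =
    (|s| ^ (2 * H) + |t| ^ (2 * H) - |t - s| ^ (2 * H)) / 2

/-- The limit covariance `cov` exists, and the normalized box counts converge, in the sense of
finite-dimensional distributions, to a centred stationary Gaussian field with covariance `cov`. -/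
def BoxCountCLT {Ω : Type*} [MeasurableSpace Ω] {d : ℕ} (P : Measure Ω) [IsProbabilityMeasure P]
    (η : Ω → Measure (Space d)) : Prop :=
  ∃ K : Space d → ℝ, IsLimitCovariance P η K ∧
    ∃ (Ω' : Type) (_ : MeasurableSpace Ω') (P' : Measure Ω') (_ : IsProbabilityMeasure P')
      (G : Space d → Ω' → ℝ),
      IsCentredStationaryGaussianField P' G K ∧ TendstoFDD (normalizedCount P η) P G P'

/-- Dimension one: the same, the limit being the field of increments `z ↦ B(z + 1) - B(z)` of a
fractional Brownian motion `B` with Hurst index `H`. -/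
def BoxCountCLTFractional {Ω : Type*} [MeasurableSpace Ω] (P : Measure Ω) [IsProbabilityMeasure P]
    (η : Ω → Measure (Space 1)) (H : ℝ) : Prop :=
  ∃ K : Space 1 → ℝ, IsLimitCovariance P η K ∧
    ∃ (Ω' : Type) (_ : MeasurableSpace Ω') (P' : Measure Ω') (_ : IsProbabilityMeasure P')
      (B : ℝ → Ω' → ℝ),
      IsFractionalBrownianMotion P' B H ∧
      IsCentredStationaryGaussianField P' (fun z ω => B (z 0 + 1) ω - B (z 0) ω) K ∧
      TendstoFDD (normalizedCount P η) P (fun z ω => B (z 0 + 1) ω - B (z 0) ω) P'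

end

/-! By the Cramér–Wold device it suffices to follow the characteristic function of one linear
combination of normalized box counts. Its cumulants are controlled as follows. The moment generating
function of a weighted count is, as a formal series, `M = ∑ 1/k! ∫ ∏ (exp (t f(x_i)) - 1) dα^k`. The
coefficients of `M ^ m` are sums over colourings with `m` colours. Grouped by partitions into
blocks, they become polynomials in `m` through falling factorials, and the part linear in `m` is the
logarithm of `M`. Since the linear coefficient of the falling factorial with `k` factors is
`(-1)^(k-1) (k-1)!`, this part is a combination of factorial cumulants
(`exists_polynomial_coeff_pow`, `isExpSeq_of_coeff_pow`). Brillinger mixing bounds each of these on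
subsets of `U` by a constant times the volume of `U`, so all cumulants of the unnormalized sum are
`O(n^d)` (`exists_cumulant_bound`).

The variance of a hyperuniform process is `o(n^d)`, so the normalized cumulants of low order need
not visibly vanish. The variance does grow like some `n^δ`, `δ > 0`, and the `k`-th normalized
cumulant is then `O(n^(d - kδ/2))`, which tends to zero for all large `k`. Marcinkiewicz' theorem
settles the remaining orders. After rescaling, the cumulants converge along an ultrafilter to the
coefficients of a polynomial `Q`. Positivity of moments passes to the limit as the ridge inequality
`Re Q(s + it) ≤ Q(s)`, which forces `Q` to have degree at most two
(`tendsto_cumulant_zero_of_ultrafilter`). The limit is therefore Gaussian as soon as the normalized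
covariances converge.

Covariances of box counts are integrals of products of tent functions against the signed measure
`δ_0 + β` (`covariance_box`). Hyperuniformity says exactly that this measure has total mass zero
(`pairIntegral_one`). A second difference of the covariance in one coordinate direction has order
`n^(d-1)`, because `δ_0 + β` charges a coordinate hyperplane with mass at least one; this gives the
lower bound `c n^(d-1)` on the variance (`exists_variance_lower_bound`).

Convergence of the normalized covariances has a different reason in each case. If `|y|` is
integrable, the constant term of the tents is cancelled by the zero total mass and the rescaled
covariance converges to the integral of a one-sided derivative. In dimension one the covariance is a
second difference of the variance, and the variance is `2G`. In dimension two the same second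
difference is taken in each coordinate, and integrals of products of tents are combinations of
values of `G_-`. In dimension one, regular variation also upgrades the constant lower bound on the
variance to a power.

The limit kernel is a limit of covariances, hence positive semidefinite, and an isonormal process
over its reproducing kernel Hilbert space realizes the Gaussian field; the same argument produces
the fractional Brownian motion. -/

/-! ### Exponentials of formal series, in terms of coefficients -/

/-- `∑ m_k t^k = exp (∑_{k ≥ 1} κ_k t^k)`, expressed by the recursion for the coefficients. -/
structure IsExpSeq (m κ : ℕ → ℝ) : Prop where
  zero : m 0 = 1
  succ : ∀ k : ℕ, (k + 1 : ℝ) * m (k + 1) =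
    ∑ i ∈ Finset.range (k + 1), (i + 1 : ℝ) * κ (i + 1) * m (k - i)

/-- The coefficients of the exponential of a formal series. -/
noncomputable def expSeq (κ : ℕ → ℝ) : ℕ → ℝ
  | 0 => 1
  | k + 1 => (∑ i : Fin (k + 1), (((i : ℕ) : ℝ) + 1) * κ ((i : ℕ) + 1) * expSeq κ (k - (i : ℕ))) / (k + 1)

theorem isExpSeq_expSeq (κ : ℕ → ℝ) : IsExpSeq (expSeq κ) κ where
  zero := by rw [expSeq]
  succ k := by
    rw [expSeq, mul_div_cancel₀ _ (by positivity), Finset.sum_range]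

/-- The recursion expresses `m k` as a fixed polynomial in `κ 1, …, κ k`. The value `κ 0` never
enters, so it need not converge. -/
theorem IsExpSeq.tendsto {ι : Type*} {l : Filter ι} {m κ : ι → ℕ → ℝ} {m₀ κ₀ : ℕ → ℝ}
    (h : ∀ n, IsExpSeq (m n) (κ n)) (h₀ : IsExpSeq m₀ κ₀)
    (hκ : ∀ k, 1 ≤ k → Tendsto (fun n => κ n k) l (𝓝 (κ₀ k))) (k : ℕ) :
    Tendsto (fun n => m n k) l (𝓝 (m₀ k)) := by
  induction k using Nat.strong_induction_on with
  | _ k ih =>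
    cases k with
    | zero => simpa [(h _).zero, h₀.zero] using tendsto_const_nhds
    | succ k =>
      have e : ∀ n, m n (k + 1) = (∑ i ∈ Finset.range (k + 1),
          (i + 1 : ℝ) * κ n (i + 1) * m n (k - i)) / (k + 1) := fun n => by
        rw [← (h n).succ, mul_div_cancel_left₀ _ (by positivity)]
      have e₀ : m₀ (k + 1) = (∑ i ∈ Finset.range (k + 1),
          (i + 1 : ℝ) * κ₀ (i + 1) * m₀ (k - i)) / (k + 1) := by
        rw [← h₀.succ, mul_div_cancel_left₀ _ (by positivity)]
      simp_rw [e, e₀]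
      refine Tendsto.div_const (tendsto_finsetSum _ fun i _ => ?_) _
      exact ((hκ _ (by omega)).const_mul _).mul (ih _ (by omega))

theorem IsExpSeq.rescale {m κ : ℕ → ℝ} (h : IsExpSeq m κ) (r : ℝ) :
    IsExpSeq (fun k => r ^ k * m k) (fun k => r ^ k * κ k) where
  zero := by simp [h.zero]
  succ k := by
    have := congrArg (fun x => r ^ (k + 1) * x) (h.succ k)
    simp only [Finset.mul_sum] at this
    rw [mul_left_comm, this]
    refine Finset.sum_congr rfl fun i hi => ?_
    obtain ⟨j, rfl⟩ := Nat.exists_eq_add_of_le (Nat.lt_succ_iff.1 (Finset.mem_range.1 hi))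
    rw [Nat.add_sub_cancel_left]
    ring

theorem iteratedDeriv_polynomial_eval (Q : Polynomial ℂ) (k : ℕ) :
    iteratedDeriv k (fun w => Q.eval w) = fun w => (Polynomial.derivative^[k] Q).eval w := by
  induction k with
  | zero => simp
  | succ k ih =>
    rw [iteratedDeriv_succ, ih]
    ext w
    rw [Polynomial.deriv, Function.iterate_succ_apply']

/-- Leibniz' rule applied to `(exp q)' = q' exp q` gives the Taylor coefficients the same recursion
as `m`. -/
theorem iteratedDeriv_exp_polynomial (Q : Polynomial ℝ) (hQ : Q.coeff 0 = 0) {m : ℕ → ℝ}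
    (h : IsExpSeq m Q.coeff) (k : ℕ) :
    iteratedDeriv k (fun w : ℂ => Complex.exp ((Q.map (algebraMap ℝ ℂ)).eval w)) 0 =
      k.factorial * m k := by
  set q := Q.map (algebraMap ℝ ℂ) with hq
  induction k using Nat.strong_induction_on with
  | _ k ih =>
    cases k with
    | zero =>
      have : q.eval 0 = 0 := by rw [← Polynomial.coeff_zero_eq_eval_zero]; simp [hq, hQ]
      simp [h.zero, this]
    | succ k =>
      have hd : deriv (fun w : ℂ => Complex.exp (q.eval w)) =
          (fun w => q.derivative.eval w) * fun w => Complex.exp (q.eval w) := by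
        ext w
        simpa [mul_comm] using (q.hasDerivAt w).cexp.deriv
      have hq' : ContDiffAt ℂ k (fun w : ℂ => q.derivative.eval w) 0 :=
        (Polynomial.contDiff_aeval (𝕜 := ℂ) q.derivative _).contDiffAt
      have he' : ContDiffAt ℂ k (fun w : ℂ => Complex.exp (q.eval w)) 0 :=
        (Complex.contDiff_exp.comp (Polynomial.contDiff_aeval (𝕜 := ℂ) q _)).contDiffAt
      rw [iteratedDeriv_succ', hd, iteratedDeriv_mul hq' he']
      have hs : ((k + 1).factorial : ℂ) * m (k + 1) = k.factorial *
          ∑ i ∈ Finset.range (k + 1), ((i + 1 : ℝ) * Q.coeff (i + 1) * m (k - i) : ℝ) := by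
        rw [← h.succ]
        push_cast [Nat.factorial_succ]
        ring
      rw [hs, Complex.ofReal_sum, Finset.mul_sum]
      refine Finset.sum_congr rfl fun i hi => ?_
      have hi : i ≤ k := Nat.lt_succ_iff.1 (Finset.mem_range.1 hi)
      rw [ih _ (by omega), iteratedDeriv_polynomial_eval]
      beta_reduce
      rw [← Polynomial.coeff_zero_eq_eval_zero,
        Polynomial.coeff_iterate_derivative, Polynomial.coeff_derivative, zero_add,
        Nat.descFactorial_self, ← Nat.choose_mul_factorial_mul_factorial hi, hq,
        Polynomial.coeff_map]
      push_cast
      simp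
      ring

/-- `exp ∘ Q` is entire, so the formal exponential of a polynomial converges at every complex
argument. All later interchanges of limits rest on this. -/
theorem hasSum_expSeq_polynomial (Q : Polynomial ℝ) (hQ : Q.coeff 0 = 0) {m : ℕ → ℝ}
    (h : IsExpSeq m Q.coeff) (w : ℂ) :
    HasSum (fun k => (m k : ℂ) * w ^ k) (Complex.exp ((Q.map (algebraMap ℝ ℂ)).eval w)) := by
  have hd : Differentiable ℂ fun w : ℂ => Complex.exp ((Q.map (algebraMap ℝ ℂ)).eval w) :=
    (Polynomial.differentiable _).cexp
  have hs := Complex.hasSum_taylorSeries_of_entire hd 0 w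
  refine hs.congr_fun fun k => ?_
  rw [iteratedDeriv_exp_polynomial Q hQ h]
  have : (k.factorial : ℂ) ≠ 0 := by exact_mod_cast k.factorial_ne_zero
  simp
  field_simp

theorem summable_expSeq_polynomial (Q : Polynomial ℝ) (hQ : Q.coeff 0 = 0) {m : ℕ → ℝ}
    (h : IsExpSeq m Q.coeff) (r : ℝ) : Summable fun k => |m k| * |r| ^ k := by
  have := (hasSum_expSeq_polynomial Q hQ h r).summable.norm
  simpa using this

/-! ### Marcinkiewicz' theorem -/

theorem tendsto_eval_smul_div_pow (Q : Polynomial ℂ) (z : ℂ) :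
    Tendsto (fun r : ℝ => Q.eval (r * z) / (r : ℂ) ^ Q.natDegree) atTop
      (𝓝 (Q.leadingCoeff * z ^ Q.natDegree)) := by
  have e : ∀ᶠ r : ℝ in atTop, ∑ k ∈ Finset.range (Q.natDegree + 1),
      Q.coeff k * z ^ k * ((r⁻¹ ^ (Q.natDegree - k) : ℝ) : ℂ) =
        Q.eval (r * z) / (r : ℂ) ^ Q.natDegree := by
    filter_upwards [eventually_gt_atTop 0] with r hr
    have hr' : (r : ℂ) ≠ 0 := by exact_mod_cast hr.ne'
    rw [Polynomial.eval_eq_sum_range, Finset.sum_div]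
    refine Finset.sum_congr rfl fun k hk => ?_
    obtain ⟨j, hj⟩ := Nat.exists_eq_add_of_le (Nat.lt_succ_iff.1 (Finset.mem_range.1 hk))
    rw [hj, Nat.add_sub_cancel_left]
    push_cast
    rw [pow_add, inv_pow, mul_pow]
    field_simp
  refine Tendsto.congr' e ?_
  rw [Polynomial.leadingCoeff]
  have : Q.coeff Q.natDegree * z ^ Q.natDegree = ∑ k ∈ Finset.range (Q.natDegree + 1),
      Q.coeff k * z ^ k * ((if k = Q.natDegree then 1 else 0 : ℝ) : ℂ) := by
    rw [Finset.sum_eq_single Q.natDegree] <;> simp +contextual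
  rw [this]
  refine tendsto_finsetSum _ fun k hk => Tendsto.const_mul _ ?_
  refine (Complex.continuous_ofReal.tendsto _).comp ?_
  split_ifs with hk'
  · simp [hk']
  · have : Q.natDegree - k ≠ 0 := by have := Finset.mem_range.1 hk; omega
    simpa [this, -inv_pow, hk'] using
      (tendsto_inv_atTop_zero (𝕜 := ℝ)).pow (Q.natDegree - k)

/-- The core of Marcinkiewicz' theorem: a polynomial with the ridge property is at most
quadratic. -/
theorem natDegree_le_two_of_ridge (Q : Polynomial ℝ)
    (h : ∀ s t : ℝ, ((Q.map (algebraMap ℝ ℂ)).eval (s + t * Complex.I)).re ≤ Q.eval s) :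
    Q.natDegree ≤ 2 := by
  by_contra! hD
  set D := Q.natDegree with hDdef
  set c := Q.leadingCoeff with hc
  have hc0 : c ≠ 0 := by
    rw [hc, Polynomial.leadingCoeff_ne_zero]
    rintro rfl
    simp [hDdef] at hD
  set q := Q.map (algebraMap ℝ ℂ) with hq
  have hqD : q.natDegree = D := Polynomial.natDegree_map_eq_of_injective Complex.ofReal_injective _
  have hqc : q.leadingCoeff = c := by
    rw [hq, Polynomial.leadingCoeff_map_of_injective Complex.ofReal_injective]; rfl
  -- Divide the ridge inequality at `r e^{iθ}` by `r^D` and let `r → ∞`: only the leading terms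
  -- survive.
  have key : ∀ θ : ℝ, c * Real.cos (D * θ) ≤ c * Real.cos θ ^ D := by
    intro θ
    have h1 := (Complex.continuous_re.tendsto _).comp
      (tendsto_eval_smul_div_pow q (Complex.exp (θ * Complex.I)))
    have h2 := (Complex.continuous_re.tendsto _).comp
      (tendsto_eval_smul_div_pow q (Real.cos θ))
    rw [hqD, hqc] at h1 h2
    have e1 : ((c : ℂ) * Complex.exp (θ * Complex.I) ^ D).re = c * Real.cos (D * θ) := by
      rw [← Complex.exp_nat_mul, Complex.re_ofReal_mul,
        show (D : ℂ) * (θ * Complex.I) = ((D * θ : ℝ) : ℂ) * Complex.I by push_cast; ring,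
        Complex.exp_ofReal_mul_I_re]
    have e2 : ((c : ℂ) * (Real.cos θ : ℂ) ^ D).re = c * Real.cos θ ^ D := by
      rw [← Complex.ofReal_pow, ← Complex.ofReal_mul, Complex.ofReal_re]
    rw [e1] at h1
    rw [e2] at h2
    refine le_of_tendsto_of_tendsto h1 h2 ?_
    filter_upwards [eventually_gt_atTop 0] with r hr
    have hdiv : ∀ x : ℂ, (x / (r : ℂ) ^ D).re = x.re / r ^ D := fun x => by
      rw [← Complex.ofReal_pow, Complex.div_ofReal_re]
    simp only [Function.comp_apply, hdiv]
    refine div_le_div_of_nonneg_right ?_ (by positivity)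
    have := h (r * Real.cos θ) (r * Real.sin θ)
    rw [Complex.exp_mul_I, ← Complex.ofReal_cos, ← Complex.ofReal_sin]
    have e3 : Q.eval (r * Real.cos θ) = (q.eval ((r : ℂ) * (Real.cos θ : ℂ))).re := by
      rw [hq, ← Complex.ofReal_mul, ← Complex.coe_algebraMap, Polynomial.eval_map_algebraMap,
        Polynomial.aeval_algebraMap_apply]
      simp
    rw [e3] at this
    rw [← Complex.ofReal_mul] at this
    rwa [mul_add, ← mul_assoc, ← Complex.ofReal_mul, ← Complex.ofReal_mul]
  have hD0 : (0 : ℝ) < D := by positivity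
  have hD3 : (3 : ℝ) ≤ D := by exact_mod_cast hD
  have habs : ∀ θ : ℝ, 0 < θ → θ < Real.pi → |Real.cos θ ^ D| < 1 := by
    intro θ h1 h2
    rw [abs_pow]
    refine pow_lt_one₀ (abs_nonneg _) ?_ (by omega)
    rw [← sq_lt_one_iff_abs_lt_one, ← Real.sin_sq_add_cos_sq θ]
    have := Real.sin_pos_of_pos_of_lt_pi h1 h2
    nlinarith
  -- Choose `θ` so that `cos (Dθ)` is `-1` or `1` according to the sign of `c`. As `D ≥ 3`, both
  -- `π/D` and `2π/D` lie in `(0, π)`, where `|cos^D| < 1`. For `D = 2` the angle `2π/D` would be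
  -- `π` itself.
  rcases hc0.lt_or_gt with hneg | hpos
  · have := key (Real.pi / D)
    rw [mul_div_cancel₀ _ hD0.ne', Real.cos_pi] at this
    have h2 := habs (Real.pi / D) (by positivity) (by
      rw [div_lt_iff₀ hD0]; nlinarith [Real.pi_pos])
    rw [abs_lt] at h2
    nlinarith
  · have := key (2 * Real.pi / D)
    rw [mul_div_cancel₀ _ hD0.ne', Real.cos_two_pi] at this
    have h2 := habs (2 * Real.pi / D) (by positivity) (by
      rw [div_lt_iff₀ hD0]; nlinarith [Real.pi_pos])
    rw [abs_lt] at h2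
    nlinarith

/-! ### The method of moments -/

section Moments

variable {Ω : Type*} [MeasurableSpace Ω] {P : Measure Ω}

/-- The partial sums of the exponential series of `w * x`. -/
noncomputable def truncExp (N : ℕ) (w : ℂ) (x : ℝ) : ℂ :=
  ∑ i ∈ Finset.range N, (w * x) ^ i / i.factorial

theorem integrable_ofReal_pow {X : Ω → ℝ} (hX : ∀ k : ℕ, Integrable (fun ω => X ω ^ k) P) (k : ℕ) :
    Integrable (fun ω => (X ω : ℂ) ^ k) P := by
  simpa using (hX k).ofReal (𝕜 := ℂ)

theorem truncExp_mul_truncExp (N : ℕ) (u v : ℂ) (x : ℝ) :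
    truncExp N u x * truncExp N v x = ∑ p ∈ Finset.range N ×ˢ Finset.range N,
      u ^ p.1 * v ^ p.2 / (p.1.factorial * p.2.factorial) * (x : ℂ) ^ (p.1 + p.2) := by
  rw [truncExp, truncExp, Finset.sum_mul_sum, Finset.sum_product]
  refine Finset.sum_congr rfl fun i _ => Finset.sum_congr rfl fun j _ => ?_
  rw [mul_pow, mul_pow, pow_add]
  ring

theorem integrable_truncExp_mul {X : Ω → ℝ} (hX : ∀ k : ℕ, Integrable (fun ω => X ω ^ k) P)
    (N : ℕ) (u v : ℂ) : Integrable (fun ω => truncExp N u (X ω) * truncExp N v (X ω)) P := by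
  simp_rw [truncExp_mul_truncExp]
  exact integrable_finsetSum _ fun p _ => (integrable_ofReal_pow hX _).const_mul _

theorem integral_truncExp_mul {X : Ω → ℝ} (hX : ∀ k : ℕ, Integrable (fun ω => X ω ^ k) P)
    (N : ℕ) (u v : ℂ) : ∫ ω, truncExp N u (X ω) * truncExp N v (X ω) ∂P =
      ∑ p ∈ Finset.range N ×ˢ Finset.range N, u ^ p.1 * v ^ p.2 / (p.1.factorial * p.2.factorial) *
        ((∫ ω, X ω ^ (p.1 + p.2) ∂P : ℝ) : ℂ) := by
  simp_rw [truncExp_mul_truncExp]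
  rw [integral_finsetSum _ fun p _ => (integrable_ofReal_pow hX _).const_mul _]
  refine Finset.sum_congr rfl fun p _ => ?_
  rw [integral_const_mul, ← integral_complex_ofReal]
  simp

theorem truncExp_mul_conj (N : ℕ) (u : ℂ) (x : ℝ) :
    truncExp N u x * truncExp N (starRingEnd ℂ u) x = ((‖truncExp N u x‖ ^ 2 : ℝ) : ℂ) := by
  have : truncExp N (starRingEnd ℂ u) x = starRingEnd ℂ (truncExp N u x) := by
    simp [truncExp, map_sum]
  rw [this, Complex.mul_conj, Complex.normSq_eq_norm_sq]

/-- This is `|ab| ≤ (|a|² + |b|²)/2` under the integral. The squares are written as products at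
conjugate arguments, so both sides involve finitely many moments and the inequality survives
convergence of moments. -/
theorem norm_integral_truncExp_mul_le {X : Ω → ℝ} (hX : ∀ k : ℕ, Integrable (fun ω => X ω ^ k) P)
    (N : ℕ) (u v : ℂ) : ‖∫ ω, truncExp N u (X ω) * truncExp N v (X ω) ∂P‖ ≤
      (‖∫ ω, truncExp N u (X ω) * truncExp N (starRingEnd ℂ u) (X ω) ∂P‖ +
        ‖∫ ω, truncExp N v (X ω) * truncExp N (starRingEnd ℂ v) (X ω) ∂P‖) / 2 := by
  have hi : ∀ w : ℂ, Integrable (fun ω => ‖truncExp N w (X ω)‖ ^ 2) P := fun w => by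
    have := (integrable_truncExp_mul hX N w (starRingEnd ℂ w)).re
    simpa [truncExp_mul_conj, -Complex.ofReal_pow] using this
  have he : ∀ w : ℂ, ‖∫ ω, truncExp N w (X ω) * truncExp N (starRingEnd ℂ w) (X ω) ∂P‖ =
      ∫ ω, ‖truncExp N w (X ω)‖ ^ 2 ∂P := fun w => by
    simp_rw [truncExp_mul_conj]
    rw [integral_complex_ofReal, Complex.norm_real, Real.norm_of_nonneg]
    exact integral_nonneg fun _ => by positivity
  rw [he, he, ← integral_add (hi u) (hi v), ← integral_div]
  refine (norm_integral_le_integral_norm _).trans (integral_mono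
    (integrable_truncExp_mul hX N u v).norm (((hi u).add (hi v)).div_const _) fun ω => ?_)
  simp only [norm_mul]
  nlinarith [sq_nonneg (‖truncExp N u (X ω)‖ - ‖truncExp N v (X ω)‖)]

/-- On the antidiagonal `i + j = k` the binomial theorem collapses the terms to `m k * (u + v)^k`.
Absolute convergence of the double series allows the sum to be taken over squares, as products of
truncated exponentials require. -/
theorem hasSum_double_expSeq (Q : Polynomial ℝ) (hQ : Q.coeff 0 = 0) {m : ℕ → ℝ}
    (h : IsExpSeq m Q.coeff) (u v : ℂ) :
    HasSum (fun p : ℕ × ℕ => u ^ p.1 * v ^ p.2 / (p.1.factorial * p.2.factorial) *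
      (((p.1 + p.2).factorial * m (p.1 + p.2) : ℝ) : ℂ))
      (Complex.exp ((Q.map (algebraMap ℝ ℂ)).eval (u + v))) := by
  rw [← Finset.HasAntidiagonal.sigmaAntidiagonalEquivProd.hasSum_iff]
  have hsum : ∀ (u v : ℂ) (a : ℕ → ℂ) (k : ℕ), ∑ c : Finset.HasAntidiagonal.antidiagonal k,
      u ^ c.1.1 * v ^ c.1.2 / (c.1.1.factorial * c.1.2.factorial) *
        ((c.1.1 + c.1.2).factorial * a (c.1.1 + c.1.2)) = a k * (u + v) ^ k := by
    intro u v a k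
    rw [Finset.sum_coe_sort (Finset.HasAntidiagonal.antidiagonal k) fun c => u ^ c.1 * v ^ c.2 /
      (c.1.factorial * c.2.factorial) * ((c.1 + c.2).factorial * a (c.1 + c.2)),
      (Commute.all u v).add_pow', Finset.mul_sum]
    refine Finset.sum_congr rfl fun c hc => ?_
    rw [Finset.HasAntidiagonal.mem_antidiagonal] at hc
    rw [← hc, ← Nat.add_choose_mul_factorial_mul_factorial]
    have h1 : (c.1.factorial : ℂ) ≠ 0 := by exact_mod_cast c.1.factorial_ne_zero
    have h2 : (c.2.factorial : ℂ) ≠ 0 := by exact_mod_cast c.2.factorial_ne_zero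
    push_cast
    rw [nsmul_eq_mul, Nat.choose_symm_add]
    field_simp
  refine HasSum.sigma_of_hasSum (hasSum_expSeq_polynomial Q hQ h (u + v)) (fun k => ?_) ?_
  · rw [← hsum u v (fun k => (m k : ℂ)) k]
    simpa using hasSum_fintype (fun c : Finset.HasAntidiagonal.antidiagonal k => u ^ c.1.1 * v ^ c.1.2 /
      (c.1.1.factorial * c.1.2.factorial) * ((c.1.1 + c.1.2).factorial * (m (c.1.1 + c.1.2) : ℂ)))
  · refine Summable.of_norm ?_
    rw [summable_sigma_of_nonneg fun _ => norm_nonneg _]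
    refine ⟨fun k => (hasSum_fintype _).summable, ?_⟩
    have := summable_expSeq_polynomial Q hQ h (‖u‖ + ‖v‖)
    refine this.congr fun k => ?_
    rw [tsum_fintype]
    have e := hsum ‖u‖ ‖v‖ (fun k => (|m k| : ℝ)) k
    rw [abs_of_nonneg (a := ‖u‖ + ‖v‖) (by positivity)]
    have : ((|m k| * (‖u‖ + ‖v‖) ^ k : ℝ) : ℂ) = (|m k| : ℝ) * ((‖u‖ : ℂ) + ‖v‖) ^ k := by
      push_cast; rfl
    rw [← Complex.ofReal_inj, this, ← e]
    simp [Finset.HasAntidiagonal.sigmaAntidiagonalEquivProd]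

theorem tendsto_range_product_range :
    Tendsto (fun N : ℕ => Finset.range N ×ˢ Finset.range N) atTop atTop := by
  refine tendsto_atTop_finset_of_monotone
    (fun a b hab => Finset.product_subset_product (Finset.range_mono hab) (Finset.range_mono hab))
    fun p => ⟨p.1 + p.2 + 1, ?_⟩
  simp only [Finset.mem_product, Finset.mem_range]
  omega

/-- For a random variable `X` with the limiting moments this would be `|E exp ((s + it) X)| ≤ E exp
(s X)`. No such `X` is constructed: the inequality is proved for truncated exponentials, first along
`l`, then as the truncation level grows. -/
theorem ridge_of_tendsto_moments {ι : Type*} {l : Filter ι} [l.NeBot] {X : ι → Ω → ℝ}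
    (hX : ∀ n, ∀ k : ℕ, Integrable (fun ω => X n ω ^ k) P) (Q : Polynomial ℝ)
    (hQ : Q.coeff 0 = 0) {m : ℕ → ℝ} (h : IsExpSeq m Q.coeff)
    (hm : ∀ k : ℕ, Tendsto (fun n => (∫ ω, X n ω ^ k ∂P) / k.factorial) l (𝓝 (m k))) (s t : ℝ) :
    ((Q.map (algebraMap ℝ ℂ)).eval (s + t * Complex.I)).re ≤ Q.eval s := by
  have hlim : ∀ (N : ℕ) (u v : ℂ), Tendsto
      (fun n => ‖∫ ω, truncExp N u (X n ω) * truncExp N v (X n ω) ∂P‖) l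
      (𝓝 ‖∑ p ∈ Finset.range N ×ˢ Finset.range N, u ^ p.1 * v ^ p.2 /
        (p.1.factorial * p.2.factorial) * (((p.1 + p.2).factorial * m (p.1 + p.2) : ℝ) : ℂ)‖) := by
    intro N u v
    simp_rw [integral_truncExp_mul (hX _)]
    refine (tendsto_finsetSum _ fun p _ => Tendsto.const_mul _ ?_).norm
    refine (Complex.continuous_ofReal.tendsto _).comp ?_
    refine ((hm (p.1 + p.2)).const_mul ((p.1 + p.2).factorial : ℝ)).congr fun n => ?_
    rw [mul_div_cancel₀ _ (by positivity)]
  have hlim' : ∀ u v : ℂ, Tendsto (fun N => ‖∑ p ∈ Finset.range N ×ˢ Finset.range N,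
      u ^ p.1 * v ^ p.2 / (p.1.factorial * p.2.factorial) *
        (((p.1 + p.2).factorial * m (p.1 + p.2) : ℝ) : ℂ)‖) atTop
      (𝓝 ‖Complex.exp ((Q.map (algebraMap ℝ ℂ)).eval (u + v))‖) := fun u v => by
    have hs := hasSum_double_expSeq Q hQ h u v
    rw [HasSum, SummationFilter.unconditional_filter] at hs
    exact (hs.comp tendsto_range_product_range).norm
  -- With this choice `u + v = s + it`, while `u + conj u` and `v + conj v` both equal `s`.
  set u : ℂ := ((s / 2 : ℝ) : ℂ) with hu
  set v : ℂ := ((s / 2 : ℝ) : ℂ) + t * Complex.I with hv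
  have key := le_of_tendsto_of_tendsto' (hlim' u v)
    (((hlim' u (starRingEnd ℂ u)).add (hlim' v (starRingEnd ℂ v))).div_const 2) fun N =>
      le_of_tendsto_of_tendsto' (hlim N u v)
        (((hlim N u (starRingEnd ℂ u)).add (hlim N v (starRingEnd ℂ v))).div_const 2) fun n =>
          norm_integral_truncExp_mul_le (hX n) N u v
  have e1 : u + v = s + t * Complex.I := by rw [hu, hv]; push_cast; ring
  have e2 : u + starRingEnd ℂ u = s := by
    rw [Complex.add_conj, hu, Complex.ofReal_re, mul_div_cancel₀ _ two_ne_zero]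
  have e3 : v + starRingEnd ℂ v = s := by
    have : v.re = s / 2 := by simp [hv]
    rw [Complex.add_conj, this, mul_div_cancel₀ _ two_ne_zero]
  have e4 : ((Q.map (algebraMap ℝ ℂ)).eval (s : ℂ)).re = Q.eval s := by
    rw [← Complex.coe_algebraMap, Polynomial.eval_map_algebraMap,
        Polynomial.aeval_algebraMap_apply]
    simp
  rw [e1, e2, e3, add_self_div_two, Complex.norm_exp, Complex.norm_exp, e4, Real.exp_le_exp] at key
  exact key

end Moments

/-- Along `t ↦ t c` the derivative of the Taylor remainder of order `N + 1` is `c` times the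
remainder of order `N`. Induction on `N` integrates the bound. -/
theorem norm_exp_mul_I_sub_sum_le (y : ℝ) (N : ℕ) :
    ‖Complex.exp (y * Complex.I) - ∑ k ∈ Finset.range N, (y * Complex.I) ^ k / k.factorial‖ ≤
      |y| ^ N / N.factorial := by
  set c : ℂ := y * Complex.I with hc
  have hcn : ‖c‖ = |y| := by simp [hc]
  have key : ∀ (N : ℕ) (t : ℝ), t ∈ Set.Icc (0 : ℝ) 1 →
      ‖Complex.exp (t * c) - ∑ k ∈ Finset.range N, (t * c) ^ k / k.factorial‖ ≤
        |y| ^ N * t ^ N / N.factorial := by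
    intro N
    induction N with
    | zero =>
      intro t _
      have : (t : ℂ) * c = ((t * y : ℝ) : ℂ) * Complex.I := by rw [hc]; push_cast; ring
      simp [this, Complex.norm_exp_ofReal_mul_I, -Complex.ofReal_mul]
    | succ N ih =>
      have hd : ∀ t : ℝ, HasDerivAt (fun t : ℝ => Complex.exp (t * c) -
          ∑ k ∈ Finset.range (N + 1), (t * c) ^ k / k.factorial)
          (c * (Complex.exp (t * c) - ∑ k ∈ Finset.range N, (t * c) ^ k / k.factorial)) t := by
        intro t
        have h1 : HasDerivAt (fun t : ℝ => (t : ℂ) * c) c t := by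
          simpa using (Complex.ofRealCLM.hasDerivAt (x := t)).mul_const c
        have h2 : HasDerivAt (fun t : ℝ => ∑ k ∈ Finset.range (N + 1),
            ((t : ℂ) * c) ^ k / (k.factorial : ℂ))
            (∑ k ∈ Finset.range (N + 1), (k * ((t : ℂ) * c) ^ (k - 1) * c) / k.factorial) t :=
          HasDerivAt.fun_sum fun k _ => (h1.pow k).div_const _
        refine (h1.cexp.sub h2).congr_deriv ?_
        rw [Finset.sum_range_succ', mul_sub, Finset.mul_sum, mul_comm c]
        simp only [Nat.cast_zero, zero_mul, zero_div, add_zero]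
        congr 1
        refine Finset.sum_congr rfl fun k _ => ?_
        have : (k.factorial : ℂ) ≠ 0 := by exact_mod_cast k.factorial_ne_zero
        have h' : ((k : ℂ) + 1) ≠ 0 := by exact_mod_cast k.succ_ne_zero
        rw [Nat.factorial_succ, Nat.add_sub_cancel]
        push_cast
        field_simp
      have hB : ∀ t : ℝ, HasDerivAt (fun t : ℝ => |y| ^ (N + 1) * t ^ (N + 1) / (N + 1).factorial)
          (|y| * (|y| ^ N * t ^ N / N.factorial)) t := by
        intro t
        refine (((hasDerivAt_pow (N + 1) t).const_mul (|y| ^ (N + 1))).div_const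
          ((N + 1).factorial : ℝ)).congr_deriv ?_
        have : (N.factorial : ℝ) ≠ 0 := by exact_mod_cast N.factorial_ne_zero
        rw [Nat.factorial_succ, Nat.add_sub_cancel]
        push_cast
        field_simp
        ring
      intro t ht
      refine image_norm_le_of_norm_deriv_right_le_deriv_boundary
        (fun x _ => (hd x).continuousAt.continuousWithinAt)
        (fun x _ => (hd x).hasDerivWithinAt) ?_ hB (fun x hx => ?_) ht
      · simp [Finset.sum_range_succ']
      · rw [norm_mul, hcn]
        exact mul_le_mul_of_nonneg_left (ih x ⟨hx.1, hx.2.le⟩) (abs_nonneg _)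
  simpa using key N 1 (by simp)

/-! ### Characteristic functions from moments and cumulants -/

section Moments

variable {Ω : Type*} [MeasurableSpace Ω] {P : Measure Ω}

/-- Evenness of `N` turns the Taylor error `|X|^N` into the moment `X^N`. -/
theorem norm_charFun_sub_sum_le [IsProbabilityMeasure P] {X : Ω → ℝ}
    (hX : ∀ k : ℕ, Integrable (fun ω => X ω ^ k) P) {N : ℕ} (hN : Even N) :
    ‖(∫ ω, Complex.exp (X ω * Complex.I) ∂P) - ∑ k ∈ Finset.range N,
      (((∫ ω, X ω ^ k ∂P) / k.factorial : ℝ) : ℂ) * Complex.I ^ k‖ ≤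
      (∫ ω, X ω ^ N ∂P) / N.factorial := by
  have hm : AEStronglyMeasurable X P := by simpa using (hX 1).aestronglyMeasurable
  have hi : Integrable (fun ω => Complex.exp (X ω * Complex.I)) P := by
    refine Integrable.of_bound (C := 1) ?_ (ae_of_all _ fun ω => ?_)
    · exact (by fun_prop : Continuous fun x : ℝ => Complex.exp (x * Complex.I)).comp_aestronglyMeasurable hm
    · rw [Complex.norm_exp_ofReal_mul_I]
  have hs : ∀ k ∈ Finset.range N,
      Integrable (fun ω => ((X ω : ℂ) * Complex.I) ^ k / (k.factorial : ℂ)) P := fun k _ => by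
    simp_rw [mul_pow]
    exact ((integrable_ofReal_pow hX k).mul_const _).div_const _
  have e : ∑ k ∈ Finset.range N, (((∫ ω, X ω ^ k ∂P) / k.factorial : ℝ) : ℂ) * Complex.I ^ k =
      ∫ ω, ∑ k ∈ Finset.range N, ((X ω : ℂ) * Complex.I) ^ k / (k.factorial : ℂ) ∂P := by
    rw [integral_finsetSum _ hs]
    refine Finset.sum_congr rfl fun k _ => ?_
    simp_rw [mul_pow]
    rw [integral_div, integral_mul_const]
    have : ∫ ω, (X ω : ℂ) ^ k ∂P = ((∫ ω, X ω ^ k ∂P : ℝ) : ℂ) := by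
      rw [← integral_complex_ofReal]; simp
    rw [this]
    push_cast
    ring
  rw [e, ← integral_sub hi (integrable_finsetSum _ hs), ← integral_div]
  refine (norm_integral_le_integral_norm _).trans (integral_mono
    (hi.sub (integrable_finsetSum _ hs)).norm ((hX N).div_const _) fun ω => ?_)
  have := norm_exp_mul_I_sub_sum_le (X ω) N
  rwa [hN.pow_abs] at this

/-- The Taylor error of even order `N` is at most the `N`-th moment over `N!`, which is close to `m
N`. The `m N` tend to zero as coefficients of an entire function, so one truncation level serves for
almost all indices. -/
theorem tendsto_charFun_of_tendsto_moments [IsProbabilityMeasure P] {ι : Type*} {l : Filter ι}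
    {X : ι → Ω → ℝ} (hX : ∀ n, ∀ k : ℕ, Integrable (fun ω => X n ω ^ k) P) (Q : Polynomial ℝ)
    (hQ : Q.coeff 0 = 0) {m : ℕ → ℝ} (h : IsExpSeq m Q.coeff)
    (hm : ∀ k : ℕ, Tendsto (fun n => (∫ ω, X n ω ^ k ∂P) / k.factorial) l (𝓝 (m k))) :
    Tendsto (fun n => ∫ ω, Complex.exp (X n ω * Complex.I) ∂P) l
      (𝓝 (Complex.exp ((Q.map (algebraMap ℝ ℂ)).eval Complex.I))) := by
  rw [Metric.tendsto_nhds]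
  intro ε hε
  have h1 := (hasSum_expSeq_polynomial Q hQ h Complex.I).tendsto_sum_nat
  have h2 : Tendsto (fun k => m k) atTop (𝓝 0) := by
    have := (summable_expSeq_polynomial Q hQ h 1).tendsto_atTop_zero
    simp only [abs_one, one_pow, mul_one] at this
    exact (tendsto_zero_iff_abs_tendsto_zero _).2 this
  have h3 : ∀ᶠ N in atTop, dist (∑ k ∈ Finset.range N, (m k : ℂ) * Complex.I ^ k)
      (Complex.exp ((Q.map (algebraMap ℝ ℂ)).eval Complex.I)) < ε / 3 ∧ m N < ε / 3 :=
    (Metric.tendsto_nhds.1 h1 _ (by positivity)).and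
      (h2.eventually (gt_mem_nhds (by positivity)))
  obtain ⟨N₀, hN₀⟩ := eventually_atTop.1 h3
  obtain ⟨hN1, hN2⟩ := hN₀ (2 * N₀) (by omega)
  have h4 : Tendsto (fun n => ∑ k ∈ Finset.range (2 * N₀),
      (((∫ ω, X n ω ^ k ∂P) / k.factorial : ℝ) : ℂ) * Complex.I ^ k) l
      (𝓝 (∑ k ∈ Finset.range (2 * N₀), (m k : ℂ) * Complex.I ^ k)) :=
    tendsto_finsetSum _ fun k _ => ((Complex.continuous_ofReal.tendsto _).comp (hm k)).mul_const _
  filter_upwards [Metric.tendsto_nhds.1 h4 (ε / 3) (by positivity),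
    (hm (2 * N₀)).eventually (gt_mem_nhds hN2)] with n hn1 hn2
  have h5 := norm_charFun_sub_sum_le (hX n) (even_two_mul N₀)
  rw [← dist_eq_norm] at h5
  calc _ ≤ _ := dist_triangle4 _ (∑ k ∈ Finset.range (2 * N₀),
          (((∫ ω, X n ω ^ k ∂P) / k.factorial : ℝ) : ℂ) * Complex.I ^ k)
          (∑ k ∈ Finset.range (2 * N₀), (m k : ℂ) * Complex.I ^ k) _
    _ < ε / 3 + ε / 3 + ε / 3 := by gcongr; exact h5.trans_lt hn2
    _ = ε := by ring

/-- `M` is the maximum of `1` and the `|κ k|^(1/k)`. Dividing the random variable by `M` brings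
these cumulants into `[-1, 1]`, and one of them has modulus exactly one unless `M = 1`. -/
theorem exists_pow_normalization (κ : ℕ → ℝ) (K : ℕ) (hK : 2 ≤ K) :
    ∃ M : ℝ, 1 ≤ M ∧ (∀ k ∈ Finset.Icc 2 K, |κ k| ≤ M ^ k) ∧
      (M = 1 ∨ ∃ k ∈ Finset.Icc 2 K, |κ k| = M ^ k) := by
  obtain ⟨j, hj, hmax⟩ := Finset.exists_max_image (Finset.Icc 2 K)
    (fun k => |κ k| ^ ((k : ℝ)⁻¹)) ⟨2, by simp [hK]⟩
  have hpow : ∀ k ∈ Finset.Icc 2 K, (|κ k| ^ ((k : ℝ)⁻¹)) ^ k = |κ k| := fun k hk =>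
    Real.rpow_inv_natCast_pow (abs_nonneg _) (by rw [Finset.mem_Icc] at hk; omega)
  refine ⟨max 1 (|κ j| ^ ((j : ℝ)⁻¹)), le_max_left _ _, fun k hk => ?_, ?_⟩
  · rw [← hpow k hk]
    exact pow_le_pow_left₀ (by positivity) ((hmax k hk).trans (le_max_right _ _)) _
  · rcases max_choice 1 (|κ j| ^ ((j : ℝ)⁻¹)) with h | h
    · exact Or.inl h
    · exact Or.inr ⟨j, hj, by rw [h, hpow j hj]⟩

/-- Along an ultrafilter, if the variances converge and all cumulants of sufficiently high order
vanish in the limit, then so do all cumulants of order at least three. -/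
theorem tendsto_cumulant_zero_of_ultrafilter {ι : Type*} (U : Ultrafilter ι)
    {X : ι → Ω → ℝ} (hX : ∀ n, ∀ k : ℕ, Integrable (fun ω => X n ω ^ k) P) {κ : ι → ℕ → ℝ}
    (hκ : ∀ n, IsExpSeq (fun k => (∫ ω, X n ω ^ k ∂P) / k.factorial) (κ n)) {v : ℝ}
    (h1 : Tendsto (fun n => κ n 1) U (𝓝 0)) (h2 : Tendsto (fun n => κ n 2) U (𝓝 v)) {K : ℕ}
    (hK : 2 ≤ K) (h : ∀ k, K < k → Tendsto (fun n => κ n k) U (𝓝 0)) (k : ℕ) (hk : 3 ≤ k) :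
    Tendsto (fun n => κ n k) U (𝓝 0) := by
  choose M hM1 hMle hMeq using fun n => exists_pow_normalization (κ n) K hK
  set r : ι → ℝ := fun n => (M n)⁻¹ with hr
  have hr0 : ∀ n, 0 < r n := fun n => inv_pos.2 (by linarith [hM1 n])
  have hr1 : ∀ n, r n ≤ 1 := fun n => inv_le_one_of_one_le₀ (hM1 n)
  have hb : ∀ n, ∀ k ∈ Finset.Icc 2 K, |r n ^ k * κ n k| ≤ 1 := fun n k hk => by
    have hM : 0 < M n := by linarith [hM1 n]
    rw [abs_mul, abs_of_pos (pow_pos (hr0 n) k), hr, inv_pow, inv_mul_le_iff₀ (by positivity),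
      mul_one]
    exact hMle n k hk
  -- The use of an ultrafilter: every bounded family converges, without passing to subsequences.
  have hlim : ∀ (f : ι → ℝ), (∀ n, |f n| ≤ 1) → ∃ x, Tendsto f U (𝓝 x) := fun f hf => by
    obtain ⟨x, -, hx⟩ := (isCompact_Icc (a := (-1 : ℝ)) (b := 1)).ultrafilter_le_nhds (U.map f)
      (by
        rw [le_principal_iff, Ultrafilter.coe_map, mem_map]
        exact Filter.univ_mem' fun n => abs_le.1 (hf n))
    exact ⟨x, hx⟩
  have hex : ∀ k, ∃ x, k ∈ Finset.Icc 2 K → Tendsto (fun n => r n ^ k * κ n k) U (𝓝 x) := by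
    intro k
    by_cases hk : k ∈ Finset.Icc 2 K
    · obtain ⟨x, hx⟩ := hlim _ fun n => hb n k hk
      exact ⟨x, fun _ => hx⟩
    · exact ⟨0, fun h => absurd h hk⟩
  choose c hc using hex
  set Q : Polynomial ℝ := ∑ k ∈ Finset.Icc 2 K, Polynomial.monomial k (c k) with hQdef
  have hQc : ∀ k, Q.coeff k = if k ∈ Finset.Icc 2 K then c k else 0 := fun k => by
    simp [hQdef, Polynomial.coeff_monomial]
  have hQ0 : Q.coeff 0 = 0 := by rw [hQc]; simp
  have hsmall : ∀ j, Tendsto (fun n => κ n j) U (𝓝 0) →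
      Tendsto (fun n => r n ^ j * κ n j) U (𝓝 0) := fun j hj => by
    refine squeeze_zero_norm (fun n => ?_) (tendsto_zero_iff_abs_tendsto_zero _ |>.1 hj)
    rw [Real.norm_eq_abs, abs_mul, abs_of_pos (pow_pos (hr0 n) j)]
    exact mul_le_of_le_one_left (abs_nonneg _) (pow_le_one₀ (hr0 n).le (hr1 n))
  have hlimQ : ∀ j, 1 ≤ j → Tendsto (fun n => r n ^ j * κ n j) U (𝓝 (Q.coeff j)) := by
    intro j hj
    rw [hQc]
    split_ifs with hjK
    · exact hc j hjK
    · rw [Finset.mem_Icc, not_and_or] at hjK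
      rcases hjK with hj' | hj'
      · obtain rfl : j = 1 := by omega
        exact hsmall 1 h1
      · exact hsmall j (h j (by omega))
  have hXr : ∀ n, ∀ k : ℕ, Integrable (fun ω => (r n * X n ω) ^ k) P := fun n k => by
    simp_rw [mul_pow]
    exact (hX n k).const_mul _
  have hmr : ∀ n (k : ℕ), (∫ ω, (r n * X n ω) ^ k ∂P) / k.factorial =
      r n ^ k * ((∫ ω, X n ω ^ k ∂P) / k.factorial) := fun n k => by
    simp_rw [mul_pow]
    rw [integral_const_mul, mul_div_assoc]
  have hridge := ridge_of_tendsto_moments hXr Q hQ0 (isExpSeq_expSeq Q.coeff) fun k => by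
    simp_rw [hmr]
    exact IsExpSeq.tendsto (fun n => (hκ n).rescale (r n)) (isExpSeq_expSeq Q.coeff) hlimQ k
  have hdeg := natDegree_le_two_of_ridge Q hridge
  have hQ3 : ∀ j, 3 ≤ j → Q.coeff j = 0 := fun j hj =>
    Polynomial.coeff_eq_zero_of_natDegree_lt (by omega)
  obtain ⟨θ, hθ⟩ := hlim r fun n => by rw [abs_of_pos (hr0 n)]; exact hr1 n
  -- If the scaling factor tended to zero, all rescaled cumulants up to order `K` would vanish in
  -- the limit: the second because `κ 2` converges, the others because `Q` has degree at most two.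
  -- The normalization keeps one of them at modulus one, or the factor at one. If instead the limit
  -- of the factor is nonzero, the scaling can be undone.
  by_cases hθ0 : θ = 0
  · exfalso
    subst hθ0
    have hz : ∀ j ∈ Finset.Icc 2 K, Tendsto (fun n => |r n ^ j * κ n j|) U (𝓝 0) := fun j hj => by
      refine (tendsto_zero_iff_abs_tendsto_zero (fun n => r n ^ j * κ n j)).1 ?_
      rcases (Finset.mem_Icc.1 hj).1.eq_or_lt with rfl | hj3
      · simpa using (hθ.pow 2).mul h2
      · rw [← hQ3 j hj3]
        exact hlimQ j (by omega)
    have hsum := tendsto_finsetSum _ hz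
    simp only [Finset.sum_const_zero] at hsum
    obtain ⟨n, hn1, hn2⟩ := ((hsum.eventually (gt_mem_nhds one_pos)).and
      (hθ.eventually (gt_mem_nhds one_pos))).exists
    rcases hMeq n with hMn | ⟨j, hj, hjeq⟩
    · simp [hr, hMn] at hn2
    · have hM : 0 < M n := by linarith [hM1 n]
      have : |r n ^ j * κ n j| = 1 := by
        rw [abs_mul, abs_of_pos (pow_pos (hr0 n) j), hjeq, hr, inv_pow,
          inv_mul_cancel₀ (by positivity)]
      have := Finset.single_le_sum (f := fun j => |r n ^ j * κ n j|)
        (fun i _ => abs_nonneg _) hj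
      linarith
  · have hlimk := (hlimQ k (by omega)).div (hθ.pow k) (pow_ne_zero k hθ0)
    rw [hQ3 k hk, zero_div] at hlimk
    refine hlimk.congr fun n => ?_
    simp only [Pi.div_apply]
    rw [mul_div_cancel_left₀ _ (pow_pos (hr0 n) k).ne']

/-- Normal convergence by higher cumulants: convergence of the first two cumulants together with
convergence to zero of all cumulants of sufficiently high order implies convergence of the
characteristic functions to that of a normal distribution. -/
theorem tendsto_charFun_of_tendsto_cumulants [IsProbabilityMeasure P] {ι : Type*} {l : Filter ι}
    {X : ι → Ω → ℝ} (hX : ∀ n, ∀ k : ℕ, Integrable (fun ω => X n ω ^ k) P) {κ : ι → ℕ → ℝ}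
    (hκ : ∀ n, IsExpSeq (fun k => (∫ ω, X n ω ^ k ∂P) / k.factorial) (κ n)) {v : ℝ}
    (h1 : Tendsto (fun n => κ n 1) l (𝓝 0)) (h2 : Tendsto (fun n => κ n 2) l (𝓝 v)) {K : ℕ}
    (h : ∀ k, K < k → Tendsto (fun n => κ n k) l (𝓝 0)) :
    Tendsto (fun n => ∫ ω, Complex.exp (X n ω * Complex.I) ∂P) l (𝓝 (Complex.exp (-v))) := by
  rw [tendsto_iff_ultrafilter]
  intro U hU
  have h3 := tendsto_cumulant_zero_of_ultrafilter U hX hκ (h1.mono_left hU) (h2.mono_left hU)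
    (le_max_left 2 K) fun k hk => (h k (lt_of_le_of_lt (le_max_right _ _) hk)).mono_left hU
  -- The `κ` are cumulants divided by factorials, so `v` is half the limiting variance and `exp
  -- (Q(i)) = exp (-v)`.
  set Q : Polynomial ℝ := Polynomial.monomial 2 v with hQ
  have hlimQ : ∀ j, 1 ≤ j → Tendsto (fun n => κ n j) U (𝓝 (Q.coeff j)) := by
    intro j hj
    rw [hQ, Polynomial.coeff_monomial]
    split_ifs with hj2
    · subst hj2
      exact h2.mono_left hU
    · rcases hj.eq_or_lt with rfl | hj1
      · exact h1.mono_left hU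
      · exact h3 j (by omega)
  have := tendsto_charFun_of_tendsto_moments hX Q (by simp [hQ, Polynomial.coeff_monomial])
    (isExpSeq_expSeq _) fun k => IsExpSeq.tendsto hκ (isExpSeq_expSeq _) hlimQ k
  simpa [hQ] using this

end Moments

/-! ### Sums over tuples of distinct points -/

section DistinctTuples

variable {ι α R : Type*} [Fintype ι] [DecidableEq ι] [DecidableEq α] [CommRing R]

/-- The `ι`-tuples of distinct elements of `S`. -/
def distinctTuples (ι : Type*) [Fintype ι] [DecidableEq ι] {α : Type*} [DecidableEq α]
    (S : Finset α) : Finset (ι → α) :=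
  (Fintype.piFinset fun _ : ι => S).filter Function.Injective

theorem mem_distinctTuples {S : Finset α} {x : ι → α} :
    x ∈ distinctTuples ι S ↔ (∀ i, x i ∈ S) ∧ Function.Injective x := by
  simp [distinctTuples]

/-- The tuples with image `T` are the bijections from `ι` onto `T`. -/
theorem card_distinctTuples_image_eq {T S : Finset α} (hTS : T ⊆ S)
    (hT : T.card = Fintype.card ι) :
    ((distinctTuples ι S).filter fun x => Finset.univ.image x = T).card =
      (Fintype.card ι).factorial := by
  have e : ι ≃ T := Fintype.equivOfCardEq (by simp [hT])
  rw [← Fintype.card_equiv e]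
  symm
  refine Finset.card_bij (fun (f : ι ≃ T) _ => fun i => (f i : α)) ?_ ?_ ?_
  · intro f _
    simp only [Finset.mem_filter, mem_distinctTuples]
    refine ⟨⟨fun i => hTS (f i).2, Subtype.val_injective.comp f.injective⟩, ?_⟩
    ext a
    simp only [Finset.mem_image, Finset.mem_univ, true_and]
    refine ⟨?_, fun ha => ⟨f.symm ⟨a, ha⟩, by simp⟩⟩
    rintro ⟨i, rfl⟩
    exact (f i).2
  · intro f _ g _ h
    ext i
    exact congrFun h i
  · intro x hx
    simp only [Finset.mem_filter, mem_distinctTuples] at hx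
    have hmem : ∀ i, x i ∈ T := fun i => hx.2 ▸ Finset.mem_image_of_mem x (Finset.mem_univ i)
    refine ⟨Equiv.ofBijective (fun i => ⟨x i, hmem i⟩) ⟨fun i j hij => ?_, fun a => ?_⟩,
      Finset.mem_univ _, rfl⟩
    · exact hx.1.2 (congrArg Subtype.val hij)
    · obtain ⟨i, -, hi⟩ := Finset.mem_image.1 (hx.2.symm ▸ a.2 : (a : α) ∈ Finset.univ.image x)
      exact ⟨i, Subtype.ext hi⟩

/-- The product depends only on the image of the tuple, and each subset of the right size is the
image of `k!` tuples, `k` being the size of `ι`. -/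
theorem sum_distinctTuples_prod (S : Finset α) (w : α → R) :
    ∑ x ∈ distinctTuples ι S, ∏ i, w (x i) =
      (Fintype.card ι).factorial * ∑ T ∈ S.powersetCard (Fintype.card ι), ∏ a ∈ T, w a := by
  have hmap : ∀ x ∈ distinctTuples ι S, Finset.univ.image x ∈ S.powersetCard (Fintype.card ι) := by
    intro x hx
    rw [mem_distinctTuples] at hx
    rw [Finset.mem_powersetCard]
    refine ⟨?_, by rw [Finset.card_image_of_injective _ hx.2, Finset.card_univ]⟩
    intro a ha
    obtain ⟨i, -, rfl⟩ := Finset.mem_image.1 ha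
    exact hx.1 i
  rw [← Finset.sum_fiberwise_of_maps_to hmap, Finset.mul_sum]
  refine Finset.sum_congr rfl fun T hT => ?_
  rw [Finset.mem_powersetCard] at hT
  rw [← card_distinctTuples_image_eq hT.1 hT.2, ← nsmul_eq_mul]
  refine Finset.sum_eq_card_nsmul fun x hx => ?_
  simp only [Finset.mem_filter, mem_distinctTuples] at hx
  rw [← hx.2, Finset.prod_image fun i _ j _ h => hx.1.2 h]

-- Expand the product over subsets. A subset with more than `l` elements contributes a multiple of
-- `X^(l+1)`, so the sum stops at `k = l`, independently of the size of `S`. This uniform cut-off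
-- permits taking expectations later.
open PowerSeries in
theorem coeff_prod_one_add_eq_sum_distinctTuples (S : Finset α) (w : α → PowerSeries ℝ)
    (hw : ∀ a, X ∣ w a) (l : ℕ) :
    coeff l (∏ a ∈ S, (1 + w a)) = ∑ k ∈ Finset.range (l + 1),
      coeff l (∑ x ∈ distinctTuples (Fin k) S, ∏ i, w (x i)) / (k.factorial : ℝ) := by
  have h1 : ∀ k, coeff l (∑ x ∈ distinctTuples (Fin k) S, ∏ i, w (x i)) / (k.factorial : ℝ) =
      ∑ T ∈ S.powersetCard k, coeff l (∏ a ∈ T, w a) := fun k => by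
    rw [sum_distinctTuples_prod, Fintype.card_fin, ← map_natCast (C (R := ℝ)), coeff_C_mul,
      mul_div_cancel_left₀ _ (by positivity), map_sum]
  have h2 : ∀ T : Finset α, l < T.card → coeff l (∏ a ∈ T, w a) = 0 := fun T hT => by
    have : (X : PowerSeries ℝ) ^ T.card ∣ ∏ a ∈ T, w a := by
      rw [← Finset.prod_const]
      exact Finset.prod_dvd_prod_of_dvd _ _ fun a _ => hw a
    exact X_pow_dvd_iff.1 this l hT
  simp_rw [h1]
  rw [Finset.prod_one_add, map_sum]
  rw [← Finset.sum_fiberwise_of_maps_to (s := S.powerset) (t := Finset.range (S.card + 1))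
    (g := Finset.card) fun T hT => by
      rw [Finset.mem_range, Nat.lt_succ_iff]
      exact Finset.card_le_card (Finset.mem_powerset.1 hT)]
  have h3 : ∀ k, S.powerset.filter (fun T => T.card = k) = S.powersetCard k := fun k =>
    (Finset.powersetCard_eq_filter).symm
  simp_rw [h3]
  have h4 : ∀ k, l < k → ∑ T ∈ S.powersetCard k, coeff l (∏ a ∈ T, w a) = 0 := fun k hk =>
    Finset.sum_eq_zero fun T hT => h2 T (by rw [(Finset.mem_powersetCard.1 hT).2]; exact hk)
  have h5 : ∀ k, S.card < k → ∑ T ∈ S.powersetCard k, coeff l (∏ a ∈ T, w a) = 0 := fun k hk => by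
    rw [Finset.powersetCard_eq_empty.2 hk, Finset.sum_empty]
  rcases le_total S.card l with h | h
  · refine Finset.sum_subset (Finset.range_mono (by omega)) fun k _ hk => h5 k ?_
    rw [Finset.mem_range] at hk
    omega
  · symm
    refine Finset.sum_subset (Finset.range_mono (by omega)) fun k _ hk => h4 k ?_
    rw [Finset.mem_range] at hk
    omega

end DistinctTuples

/-- The formal series `exp (v t) - 1`. -/
noncomputable def expSubOne (v : ℝ) : PowerSeries ℝ :=
  PowerSeries.rescale v (PowerSeries.exp ℝ) - 1

theorem X_dvd_expSubOne (v : ℝ) : PowerSeries.X ∣ expSubOne v := by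
  rw [PowerSeries.X_dvd_iff]
  have : PowerSeries.constantCoeff (PowerSeries.rescale v (PowerSeries.exp ℝ)) = 1 := by
    rw [← PowerSeries.coeff_zero_eq_constantCoeff_apply, PowerSeries.coeff_rescale]
    simp
  simp [expSubOne, this]

theorem prod_one_add_expSubOne {α : Type*} (S : Finset α) (f : α → ℝ) :
    ∏ a ∈ S, (1 + expSubOne (f a)) = PowerSeries.rescale (∑ a ∈ S, f a) (PowerSeries.exp ℝ) := by
  classical
  induction S using Finset.induction_on with
  | empty => simp
  | insert a S ha ih =>
    rw [Finset.prod_insert ha, ih, Finset.sum_insert ha, expSubOne, add_sub_cancel,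
      PowerSeries.exp_mul_exp_eq_exp_add]

theorem coeff_rescale_exp (v : ℝ) (l : ℕ) :
    PowerSeries.coeff l (PowerSeries.rescale v (PowerSeries.exp ℝ)) = v ^ l / l.factorial := by
  simp [PowerSeries.coeff_rescale, PowerSeries.coeff_exp, div_eq_mul_inv]

/-! ### Colorings and partitions -/

/-- Group the colourings by the partition into colour classes. Those with partition `π` are the
injections of the blocks into the colours, whose number is a falling factorial; unused colours
contribute `F ∅ = 1`. -/
theorem sum_coloring_eq_sum_finpartition {R : Type*} [CommSemiring R] (n m : ℕ)
    (F : Finset (Fin n) → R) (hF : F ∅ = 1) :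
    ∑ φ : Fin n → Fin m, ∏ l, F (Finset.univ.filter fun i => φ i = l) =
      ∑ π : Finpartition (Finset.univ : Finset (Fin n)),
        (m.descFactorial π.parts.card : R) * ∏ B ∈ π.parts, F B := by
  classical
  have h1 : ∀ π : Finpartition (Finset.univ : Finset (Fin n)),
      (m.descFactorial π.parts.card : R) * ∏ B ∈ π.parts, F B =
        ∑ _e : {B // B ∈ π.parts} ↪ Fin m, ∏ B ∈ π.parts, F B := fun π => by
    rw [Finset.sum_const, Finset.card_univ, Fintype.card_embedding_eq, Fintype.card_fin,
      Fintype.card_coe, nsmul_eq_mul]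
  simp_rw [h1]
  rw [← Fintype.sum_sigma' fun (π : Finpartition (Finset.univ : Finset (Fin n)))
    (_ : {B // B ∈ π.parts} ↪ Fin m) => ∏ B ∈ π.parts, F B]
  symm
  have hpart : ∀ (π : Finpartition (Finset.univ : Finset (Fin n))) (i : Fin n),
      π.part i ∈ π.parts := fun π i => π.part_mem.2 (Finset.mem_univ i)
  refine Fintype.sum_bijective (fun (s : (π : Finpartition (Finset.univ : Finset (Fin n))) ×
    ({B // B ∈ π.parts} ↪ Fin m)) (i : Fin n) => s.2 ⟨s.1.part i, hpart s.1 i⟩) ⟨?_, ?_⟩ _ _ ?_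
  · rintro ⟨π, e⟩ ⟨π', e'⟩ h
    have hp : ∀ i j, j ∈ π.part i ↔ j ∈ π'.part i := fun i j => by
      rw [Finpartition.mem_part_iff_part_eq_part _ (Finset.mem_univ _) (Finset.mem_univ _),
        Finpartition.mem_part_iff_part_eq_part _ (Finset.mem_univ _) (Finset.mem_univ _)]
      have hi := congrFun h i
      have hj := congrFun h j
      simp only at hi hj
      constructor
      · intro hij
        have : e' ⟨π'.part j, hpart π' j⟩ = e' ⟨π'.part i, hpart π' i⟩ := by
          rw [← hi, ← hj]; congr 1; exact Subtype.ext hij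
        exact congrArg Subtype.val (e'.injective this)
      · intro hij
        have : e ⟨π.part j, hpart π j⟩ = e ⟨π.part i, hpart π i⟩ := by
          rw [hi, hj]; congr 1; exact Subtype.ext hij
        exact congrArg Subtype.val (e.injective this)
    have hp' : ∀ i, π.part i = π'.part i := fun i => Finset.ext (hp i)
    have hππ : π = π' := by
      ext B
      constructor
      · intro hB
        obtain ⟨i, hi⟩ := π.nonempty_of_mem_parts hB
        rw [← π.part_eq_of_mem hB hi, hp']
        exact hpart π' i
      · intro hB
        obtain ⟨i, hi⟩ := π'.nonempty_of_mem_parts hB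
        rw [← π'.part_eq_of_mem hB hi, ← hp']
        exact hpart π i
    subst hππ
    congr 1
    ext ⟨B, hB⟩
    obtain ⟨i, hi⟩ := π.nonempty_of_mem_parts hB
    have := congrFun h i
    simp only [π.part_eq_of_mem hB hi] at this
    rw [this]
  · intro φ
    let π : Finpartition (Finset.univ : Finset (Fin n)) := Finpartition.ofSetoid (Setoid.ker φ)
    have hπ : ∀ i j, j ∈ π.part i ↔ φ i = φ j := fun i j =>
      Finpartition.mem_part_ofSetoid_iff_rel
    have hne : ∀ B : {B // B ∈ π.parts}, B.1.Nonempty := fun B => π.nonempty_of_mem_parts B.2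
    choose c hc using hne
    refine ⟨⟨π, ⟨fun B => φ (c B), fun B B' hBB => ?_⟩⟩, ?_⟩
    · have h1 := π.part_eq_of_mem B.2 (hc B)
      have h2 := π.part_eq_of_mem B'.2 (hc B')
      refine Subtype.ext (π.eq_of_mem_parts B.2 B'.2 (hc B) ?_)
      rw [← h2, hπ]
      exact hBB.symm
    · funext i
      exact ((hπ i _).1 (hc ⟨π.part i, hpart π i⟩)).symm
  · rintro ⟨π, e⟩
    simp only
    have hfib : ∀ B : {B // B ∈ π.parts},
        (Finset.univ.filter fun i => e ⟨π.part i, hpart π i⟩ = e B) = B.1 := by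
      rintro ⟨B, hB⟩
      ext i
      simp only [Finset.mem_filter, Finset.mem_univ, true_and, EmbeddingLike.apply_eq_iff_eq,
        Subtype.mk.injEq]
      exact π.part_eq_iff_mem hB
    have hsub : ∏ l ∈ Finset.univ.map e,
        F (Finset.univ.filter fun i => e ⟨π.part i, hpart π i⟩ = l) =
          ∏ l, F (Finset.univ.filter fun i => e ⟨π.part i, hpart π i⟩ = l) := by
      refine Finset.prod_subset (Finset.subset_univ _) fun l _ hl => ?_
      have : (Finset.univ.filter fun i => e ⟨π.part i, hpart π i⟩ = l) = ∅ := by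
        rw [Finset.filter_eq_empty_iff]
        intro i _ hi
        exact hl (Finset.mem_map.2 ⟨_, Finset.mem_univ _, hi⟩)
      rw [this, hF]
    rw [← hsub, Finset.prod_map]
    simp_rw [hfib]
    rw [Finset.prod_coe_sort π.parts F]

/-- The power of an exponential generating function as a sum over colorings. -/
theorem coeff_pow_eq_sum_coloring {R : Type*} [CommRing R] [Algebra ℚ R] (a : ℕ → R) (n m : ℕ) :
    (n.factorial : R) * PowerSeries.coeff n
        ((PowerSeries.mk fun k => ((k.factorial : ℚ)⁻¹) • a k) ^ m) =
      ∑ φ : Fin n → Fin m, ∏ l, a (Finset.univ.filter fun i => φ i = l).card := by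
  classical
  -- An umbral functional, replacing `X_l^s` by `a s` independently in each variable. The identity
  -- results from expanding `(∑ X_l)^n` both over words and by the multinomial theorem.
  let Λ : MvPolynomial (Fin m) R →ₗ[R] R :=
    (MvPolynomial.basisMonomials (Fin m) R).constr R fun s => ∏ l, a (s l)
  have hΛ : ∀ s : Fin m →₀ ℕ, Λ (MvPolynomial.monomial s 1) = ∏ l, a (s l) := fun s => by
    have := (MvPolynomial.basisMonomials (Fin m) R).constr_basis R (fun s => ∏ l, a (s l)) s
    simpa [Λ] using this
  have hmon : ∀ k : Fin m → ℕ, ∏ l, (MvPolynomial.X l : MvPolynomial (Fin m) R) ^ k l =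
      MvPolynomial.monomial (Finsupp.equivFunOnFinite.symm k) 1 := fun k => by
    rw [MvPolynomial.monomial_eq, map_one, one_mul, Finsupp.prod_fintype _ _ (by simp)]
    rfl
  have e1 : Λ ((∑ l, MvPolynomial.X l) ^ n) =
      ∑ φ : Fin n → Fin m, ∏ l, a (Finset.univ.filter fun i => φ i = l).card := by
    rw [Fintype.sum_pow, map_sum]
    refine Finset.sum_congr rfl fun φ _ => ?_
    have : ∏ i, (MvPolynomial.X (φ i) : MvPolynomial (Fin m) R) =
        ∏ l, MvPolynomial.X l ^ (Finset.univ.filter fun i => φ i = l).card := by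
      rw [← Finset.prod_fiberwise Finset.univ φ fun i => MvPolynomial.X (φ i)]
      refine Finset.prod_congr rfl fun l _ => ?_
      rw [← Finset.prod_const]
      exact Finset.prod_congr rfl fun i hi => by rw [(Finset.mem_filter.1 hi).2]
    rw [this, hmon, hΛ]
    rfl
  rw [← e1, Finset.sum_pow_eq_sum_piAntidiag, map_sum, ← Fin.prod_const, PowerSeries.coeff_prod,
    Finset.mul_sum]
  refine Finset.sum_bij (fun s _ => ⇑s) ?_ ?_ ?_ ?_
  · intro s hs
    rw [Finset.mem_finsuppAntidiag] at hs
    rw [Finset.mem_piAntidiag]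
    exact ⟨hs.1, fun i _ => Finset.mem_univ i⟩
  · intro s _ t _ h
    exact DFunLike.coe_injective h
  · intro k hk
    rw [Finset.mem_piAntidiag] at hk
    exact ⟨Finsupp.equivFunOnFinite.symm k, by
      rw [Finset.mem_finsuppAntidiag]; exact ⟨hk.1, Finset.subset_univ _⟩, rfl⟩
  · intro s hs
    rw [Finset.mem_finsuppAntidiag] at hs
    rw [hmon, ← nsmul_eq_mul (Nat.multinomial _ _), map_nsmul, hΛ, nsmul_eq_mul]
    have hspec := Nat.multinomial_spec Finset.univ s
    have hs1 : ∑ i, s i = n := hs.1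
    rw [hs1] at hspec
    simp only [PowerSeries.coeff_mk, Algebra.smul_def, Finset.prod_mul_distrib, ← map_prod,
      ← map_natCast (algebraMap ℚ R)]
    rw [← mul_assoc, ← map_mul]
    congr 2
    rw [← hspec, Finset.prod_inv_distrib]
    push_cast
    have : (∏ i, ((s i).factorial : ℚ)) ≠ 0 :=
      Finset.prod_ne_zero_iff.2 fun i _ => by exact_mod_cast (s i).factorial_ne_zero
    field_simp

/-! ### Collapsing a bigraded formal series -/

section Collapse

open PowerSeries

/-- The value at `u = 1` of a formal series in `u` whose `n`-th coefficient is divisible by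
`t ^ n`. -/
noncomputable def collapse (F : PowerSeries (PowerSeries ℝ)) : PowerSeries ℝ :=
  PowerSeries.mk fun l => ∑ n ∈ Finset.range (l + 1), coeff l (coeff n F)

/-- The `n`-th coefficient is divisible by `t ^ n`. -/
def IsAdmissible (F : PowerSeries (PowerSeries ℝ)) : Prop :=
  ∀ n, (X : PowerSeries ℝ) ^ n ∣ coeff n F

theorem IsAdmissible.mul {F G : PowerSeries (PowerSeries ℝ)} (hF : IsAdmissible F)
    (hG : IsAdmissible G) : IsAdmissible (F * G) := fun n => by
  rw [coeff_mul]
  refine Finset.dvd_sum fun p hp => ?_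
  rw [← Finset.HasAntidiagonal.mem_antidiagonal.1 hp, pow_add]
  exact mul_dvd_mul (hF _) (hG _)

theorem isAdmissible_one : IsAdmissible 1 := fun n => by
  rw [coeff_one]
  split_ifs with h <;> simp [h]

theorem IsAdmissible.pow {F : PowerSeries (PowerSeries ℝ)} (hF : IsAdmissible F) (m : ℕ) :
    IsAdmissible (F ^ m) := by
  induction m with
  | zero => simpa using isAdmissible_one
  | succ m ih => rw [pow_succ]; exact ih.mul hF

/-- Coefficients beyond `l` do not reach degree `l`, so any longer range gives the same value; this
lets factors of different degree share one range. -/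
theorem IsAdmissible.coeff_collapse {F : PowerSeries (PowerSeries ℝ)} (hF : IsAdmissible F)
    {l L : ℕ} (h : l ≤ L) :
    coeff l (collapse F) = coeff l (∑ n ∈ Finset.range (L + 1), coeff n F) := by
  rw [collapse, coeff_mk, map_sum]
  refine Finset.sum_subset (Finset.range_mono (by omega)) fun n _ hn => ?_
  exact X_pow_dvd_iff.1 (hF n) l (by rw [Finset.mem_range] at hn; omega)

theorem collapse_one : collapse 1 = 1 := by
  ext l
  rw [isAdmissible_one.coeff_collapse le_rfl, Finset.sum_eq_single 0]
  · simp
  · intro n _ hn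
    simp [coeff_one, hn]
  · simp

/-- The product of the two truncated sums contains extra pairs with index sum above `l`; by
admissibility these are multiples of `X^(l+1)`. -/
theorem collapse_mul {F G : PowerSeries (PowerSeries ℝ)} (hF : IsAdmissible F)
    (hG : IsAdmissible G) : collapse (F * G) = collapse F * collapse G := by
  ext l
  have h1 : coeff l (collapse F * collapse G) = coeff l ((∑ n ∈ Finset.range (l + 1), coeff n F) *
      ∑ n ∈ Finset.range (l + 1), coeff n G) := by
    rw [coeff_mul, coeff_mul]
    refine Finset.sum_congr rfl fun p hp => ?_
    have := Finset.HasAntidiagonal.mem_antidiagonal.1 hp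
    rw [hF.coeff_collapse (by omega : p.1 ≤ l), hG.coeff_collapse (by omega : p.2 ≤ l)]
  rw [h1, (hF.mul hG).coeff_collapse le_rfl, Finset.sum_mul_sum, ← Finset.sum_product', map_sum,
    map_sum]
  simp_rw [coeff_mul (R := PowerSeries ℝ), map_sum]
  rw [Finset.sum_sigma']
  refine Finset.sum_of_injOn (fun s => s.2) ?_ ?_ ?_ ?_
  · rintro ⟨n, p⟩ h ⟨n', p'⟩ h' hpp
    simp only [Finset.coe_sigma, Set.mem_sigma_iff, Finset.mem_coe,
      Finset.HasAntidiagonal.mem_antidiagonal] at h h'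
    simp only at hpp
    subst hpp
    have : n = n' := by rw [← h.2, ← h'.2]
    subst this
    rfl
  · rintro ⟨n, p⟩ h
    simp only [Finset.coe_sigma, Set.mem_sigma_iff, Finset.mem_coe, Finset.mem_range,
      Finset.HasAntidiagonal.mem_antidiagonal] at h
    simp only [Finset.coe_product, Set.mem_prod, Finset.mem_coe, Finset.mem_range]
    omega
  · rintro p - hp
    have hlt : l < p.1 + p.2 := by
      by_contra! hle
      exact hp ⟨⟨p.1 + p.2, p⟩, by simp; omega, rfl⟩
    refine X_pow_dvd_iff.1 ?_ l hlt
    rw [pow_add]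
    exact mul_dvd_mul (hF _) (hG _)
  · rintro ⟨n, p⟩ _
    rfl

theorem collapse_pow {F : PowerSeries (PowerSeries ℝ)} (hF : IsAdmissible F) (m : ℕ) :
    collapse (F ^ m) = collapse F ^ m := by
  induction m with
  | zero => simp [collapse_one]
  | succ m ih => rw [pow_succ, pow_succ, collapse_mul (hF.pow m) hF, ih]

end Collapse

/-- The linear coefficient of `x(x-1)⋯(x-k+1)` is the product of the `-j`, `1 ≤ j < k`. It is
precisely the weight of a partition into `k` blocks in the factorial cumulant. -/
theorem coeff_one_descPochhammer (k : ℕ) (hk : 1 ≤ k) :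
    (descPochhammer ℝ k).coeff 1 = (-1) ^ (k - 1) * ((k - 1).factorial : ℝ) := by
  obtain ⟨k, rfl⟩ := Nat.exists_eq_add_of_le' hk
  rw [descPochhammer_succ_left, Polynomial.coeff_X_mul, Polynomial.coeff_zero_eq_eval_zero,
    Polynomial.eval_comp, Nat.add_sub_cancel]
  simp only [Polynomial.eval_sub, Polynomial.eval_X, Polynomial.eval_one, zero_sub]
  induction k with
  | zero => simp
  | succ k ih =>
    rw [descPochhammer_succ_eval, ih (by omega), Nat.factorial_succ]
    push_cast
    ring

/-- If the coefficients of `M ^ m` are polynomials in `m`, then their linear coefficients are the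
coefficients of the logarithm of `M`. -/
theorem isExpSeq_of_coeff_pow {M : PowerSeries ℝ} (hM : PowerSeries.coeff 0 M = 1)
    (p : ℕ → Polynomial ℝ) (hp : ∀ (l m : ℕ), PowerSeries.coeff l (M ^ m) = (p l).eval (m : ℝ)) :
    IsExpSeq (fun l => PowerSeries.coeff l M) fun l => (p l).coeff 1 where
  zero := hM
  succ k := by
    -- The value at `m = 0`, where the power is `1`.
    have h0 : ∀ l, (p l).coeff 0 = if l = 0 then 1 else 0 := fun l => by
      rw [Polynomial.coeff_zero_eq_eval_zero, ← Nat.cast_zero (R := ℝ), ← hp, pow_zero,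
        PowerSeries.coeff_one, Nat.cast_zero]
    -- The coefficients of `(M^m)' M = m M^m M'` are polynomial identities in `m`, valid at all
    -- naturals and hence as polynomials. Comparing the terms linear in `m` gives the recursion,
    -- since on the right only `p 0` has a constant term.
    have key : ∑ x ∈ Finset.HasAntidiagonal.antidiagonal k, Polynomial.C (((x.1 : ℝ) + 1) *
          PowerSeries.coeff x.2 M) * p (x.1 + 1) =
        Polynomial.X * ∑ x ∈ Finset.HasAntidiagonal.antidiagonal k,
          Polynomial.C (((x.2 : ℝ) + 1) * PowerSeries.coeff (x.2 + 1) M) * p x.1 := by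
      refine Polynomial.eq_of_infinite_eval_eq _ _
        ((Set.infinite_range_of_injective Nat.cast_injective).mono ?_)
      rintro _ ⟨m, rfl⟩
      have hd : PowerSeries.derivative ℝ (M ^ m) * M =
          m * (M ^ m * PowerSeries.derivative ℝ M) := by
        cases m with
        | zero => simp
        | succ m =>
          rw [Derivation.leibniz_pow, Nat.add_sub_cancel, pow_succ]
          simp only [nsmul_eq_mul, smul_eq_mul]
          ring
      have := congrArg (PowerSeries.coeff k) hd
      rw [PowerSeries.coeff_mul, ← map_natCast (PowerSeries.C (R := ℝ)), PowerSeries.coeff_C_mul,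
        PowerSeries.coeff_mul] at this
      simp only [PowerSeries.coeff_derivative] at this
      simp only [Set.mem_ofPred_eq, Polynomial.eval_finsetSum, Polynomial.eval_mul,
        Polynomial.eval_C, Polynomial.eval_X, ← hp]
      convert! this using 2
      · ring
      · refine Finset.sum_congr rfl fun x _ => ?_
        ring
    have := congrArg (fun q : Polynomial ℝ => q.coeff 1) key
    simp only [Polynomial.coeff_X_mul, Polynomial.finsetSum_coeff, Polynomial.coeff_C_mul, h0]
      at this
    rw [Finset.Nat.sum_antidiagonal_eq_sum_range_succ_mk,
      Finset.Nat.sum_antidiagonal_eq_sum_range_succ_mk] at this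
    have h1 : ∑ x ∈ Finset.range k.succ, ((((k - x : ℕ) : ℝ) + 1) *
        PowerSeries.coeff (k - x + 1) M * if x = 0 then 1 else 0) =
          (k + 1) * PowerSeries.coeff (k + 1) M := by
      rw [Finset.sum_eq_single_of_mem 0 (by simp) (fun j _ hj => by simp [hj])]
      simp
    rw [← h1, ← this]
    exact Finset.sum_congr rfl fun i _ => by ring

/-! ### Powers of simple counting measures -/

section Counting

variable {d : ℕ} {ι : Type} [Fintype ι] [DecidableEq ι]

theorem IsSimpleCounting.exists_finset {μ : Measure (Space d)} (h : IsSimpleCounting μ)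
    {U : Set (Space d)} (hU : MeasurableSet U) (hUb : Bornology.IsBounded U) :
    ∃ F : Finset (Space d), μ.restrict U = ∑ x ∈ F, Measure.dirac x := by
  classical
  obtain ⟨S, hS, rfl⟩ := h
  refine ⟨(hS U hUb).toFinset, ?_⟩
  rw [Measure.restrict_restrict hU]
  ext B hB
  have hfin : (S ∩ U ∩ B).Finite := (hS U hUb).subset Set.inter_subset_left
  rw [Measure.restrict_apply hB, Measure.finsetSum_apply,
    show B ∩ (U ∩ S) = S ∩ U ∩ B by ext; simp; tauto,
    Measure.count_apply_finite _ hfin]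
  simp_rw [Measure.dirac_apply' _ hB]
  simp only [Set.indicator_apply, Pi.one_apply, Finset.sum_boole]
  congr 2
  ext x
  simp

theorem IsSimpleCounting.measure_lt_top {μ : Measure (Space d)} (h : IsSimpleCounting μ)
    {U : Set (Space d)} (hUb : Bornology.IsBounded U) : μ U < ∞ := by
  obtain ⟨r, hr⟩ := hUb.subset_closedBall 0
  obtain ⟨F, hF⟩ := h.exists_finset (Metric.isClosed_closedBall (x := (0 : Space d)) (ε := r)).measurableSet
    Metric.isBounded_closedBall
  calc μ U ≤ μ (Metric.closedBall 0 r) := measure_mono hr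
    _ = μ.restrict (Metric.closedBall 0 r) Set.univ := by simp
    _ < ∞ := by
      rw [hF, Measure.finsetSum_apply]
      simp

theorem IsSimpleCounting.sigmaFinite {μ : Measure (Space d)} (h : IsSimpleCounting μ) :
    SigmaFinite μ := by
  refine ⟨⟨⟨fun n => Metric.closedBall 0 n, fun _ => trivial,
    fun n => h.measure_lt_top Metric.isBounded_closedBall, ?_⟩⟩⟩
  rw [Metric.iUnion_closedBall_nat]

theorem pi_sum_dirac (F : Finset (Space d)) :
    Measure.pi (fun _ : ι => ∑ x ∈ F, Measure.dirac x) =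
      ∑ x ∈ Fintype.piFinset fun _ : ι => F, Measure.dirac x := by
  have : SigmaFinite (∑ x ∈ F, Measure.dirac x) := by
    have : IsFiniteMeasure (∑ x ∈ F, Measure.dirac x) := ⟨by
      rw [Measure.finsetSum_apply]; simp⟩
    infer_instance
  refine Measure.pi_eq fun s hs => ?_
  rw [Measure.finsetSum_apply]
  simp_rw [Measure.finsetSum_apply]
  rw [Finset.prod_univ_sum]
  refine Finset.sum_congr rfl fun x _ => ?_
  rw [Measure.dirac_apply' _ (MeasurableSet.univ_pi hs)]
  simp_rw [Measure.dirac_apply' _ (hs _)]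
  classical
  by_cases h : x ∈ Set.pi Set.univ s
  · rw [Set.indicator_of_mem h, Finset.prod_eq_one]
    · rfl
    · intro i _
      rw [Set.indicator_of_mem (h i (Set.mem_univ i))]
      rfl
  · rw [Set.indicator_of_notMem h]
    simp only [Set.mem_pi, Set.mem_univ, true_imp_iff, not_forall] at h
    obtain ⟨i, hi⟩ := h
    exact (Finset.prod_eq_zero (Finset.mem_univ i) (Set.indicator_of_notMem hi _)).symm

omit [DecidableEq ι] in
theorem measurableSet_injective : MeasurableSet {x : ι → Space d | Function.Injective x} := by
  have : {x : ι → Space d | Function.Injective x} =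
      ⋂ (i) (j), {x : ι → Space d | x i = x j → i = j} := by
    ext x; simp [Function.Injective]
  rw [this]
  refine MeasurableSet.iInter fun i => MeasurableSet.iInter fun j => ?_
  by_cases h : i = j
  · simp [h]
  · simp only [h, imp_false]
    exact (measurableSet_eq_fun (measurable_pi_apply i) (measurable_pi_apply j)).compl

open scoped Classical in
-- Inside `U` the measure is a finite sum of point masses, so the restricted power literally counts
-- tuples of distinct points. This turns pathwise statements into finite combinatorics.
theorem IsSimpleCounting.pi_restrict_injective {μ : Measure (Space d)} (h : IsSimpleCounting μ)
    {U : Set (Space d)} {F : Finset (Space d)} (hF : μ.restrict U = ∑ x ∈ F, Measure.dirac x)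
    {A : ι → Set (Space d)} (hA : ∀ i, MeasurableSet (A i)) (hAU : ∀ i, A i ⊆ U) :
    (Measure.pi fun _ : ι => μ).restrict {x | Function.Injective x} (Set.pi Set.univ A) =
      ((distinctTuples ι F).filter fun x => ∀ i, x i ∈ A i).card := by
  have := h.sigmaFinite
  have hm := MeasurableSet.univ_pi hA
  rw [Measure.restrict_apply hm]
  have hsub : Set.pi Set.univ A ∩ {x | Function.Injective x} ⊆ Set.pi Set.univ fun _ => U :=
    fun x hx i hi => hAU i (hx.1 i hi)
  have hm' := hm.inter (measurableSet_injective (d := d) (ι := ι))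
  rw [← Set.inter_eq_left.2 hsub, ← Measure.restrict_apply hm', Measure.restrict_pi_pi, hF,
    pi_sum_dirac, Measure.finsetSum_apply]
  simp_rw [Measure.dirac_apply' _ hm']
  simp only [Set.indicator_apply, Pi.one_apply, Finset.sum_boole]
  congr 2
  ext x
  simp only [Finset.mem_filter, Fintype.mem_piFinset, mem_distinctTuples]
  simp
  tauto

end Counting

/-! ### Factorial moments of a point process on rectangles -/

section FactorialMoment

variable {Ω : Type*} [MeasurableSpace Ω] {P : Measure Ω} {d : ℕ} {η : Ω → Measure (Space d)}
  {ι : Type} [Fintype ι]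

/-- The argument by a `π`-system needs finite measures, so the process is first restricted to balls
and the powers are recovered as suprema. -/
theorem IsPointProcess.measurable_pi (h : IsPointProcess η) :
    Measurable fun ω => Measure.pi fun _ : ι => η ω := by
  classical
  have := fun ω => (h.simple ω).sigmaFinite
  refine Measure.measurable_of_measurable_coe _ fun W hW => ?_
  set b : ℕ → Set (Space d) := fun n => Metric.closedBall 0 n with hb
  have hbm : ∀ n, MeasurableSet (b n) := fun n => Metric.isClosed_closedBall.measurableSet
  have e : ∀ ω, (Measure.pi fun _ : ι => η ω) W =
      ⨆ n, (Measure.pi fun _ : ι => (η ω).restrict (b n)) W := fun ω => by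
    have hWU : W = ⋃ n, W ∩ Set.pi Set.univ fun _ : ι => b n := by
      rw [← Set.inter_iUnion]
      symm
      rw [Set.inter_eq_left]
      intro x _
      obtain ⟨n, hn⟩ := exists_nat_ge ‖x‖
      refine Set.mem_iUnion.2 ⟨n, fun i _ => ?_⟩
      simpa [hb] using (norm_le_pi_norm x i).trans hn
    have hmono : Monotone fun n => W ∩ Set.pi Set.univ fun _ : ι => b n := fun m n hmn =>
      Set.inter_subset_inter_right _ (Set.pi_mono fun i _ =>
        Metric.closedBall_subset_closedBall (by exact_mod_cast hmn))
    conv_lhs => rw [hWU]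
    rw [hmono.measure_iUnion]
    refine iSup_congr fun n => ?_
    rw [← Measure.restrict_pi_pi, Measure.restrict_apply hW]
  simp_rw [e]
  refine Measurable.iSup fun n => ?_
  have : ∀ ω, IsFiniteMeasure ((η ω).restrict (b n)) := fun ω =>
    ⟨by simpa using (h.simple ω).measure_lt_top Metric.isBounded_closedBall⟩
  have hcoe : ∀ B, MeasurableSet B → Measurable fun ω => (η ω).restrict (b n) B := fun B hB => by
    simp_rw [Measure.restrict_apply hB]
    exact (Measure.measurable_coe (hB.inter (hbm n))).comp h.measurable
  have hrect : ∀ s : ι → Set (Space d), (∀ i, MeasurableSet (s i)) →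
      Measurable fun ω => (Measure.pi fun _ : ι => (η ω).restrict (b n)) (Set.pi Set.univ s) :=
    fun s hs => by
      simp_rw [Measure.pi_pi]
      exact Finset.measurable_fun_prod _ fun i _ => hcoe _ (hs i)
  have hmeas : Measurable fun ω => Measure.pi fun _ : ι => (η ω).restrict (b n) := by
    refine Measurable.measure_of_isPiSystem generateFrom_pi.symm isPiSystem_pi ?_ ?_
    · rintro _ ⟨s, hs, rfl⟩
      exact hrect s fun i => hs i (Set.mem_univ i)
    · simpa using hrect (fun _ => Set.univ) fun _ => MeasurableSet.univ
  exact (Measure.measurable_coe hW).comp hmeas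

theorem IsPointProcess.measurable_distinct (h : IsPointProcess η) :
    Measurable fun ω => (Measure.pi fun _ : ι => η ω).restrict {x | Function.Injective x} := by
  refine Measure.measurable_of_measurable_coe _ fun W hW => ?_
  simp_rw [Measure.restrict_apply hW]
  exact (Measure.measurable_coe (hW.inter measurableSet_injective)).comp h.measurable_pi

theorem IsPointProcess.factorialMoment_apply (h : IsPointProcess η) {W : Set (ι → Space d)}
    (hW : MeasurableSet W) : factorialMoment P η ι W =
      ∫⁻ ω, (Measure.pi fun _ : ι => η ω).restrict {x | Function.Injective x} W ∂P :=
  Measure.bind_apply hW h.measurable_distinct.aemeasurable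

/-- The number of tuples of distinct points of `η` in a rectangle. -/
noncomputable def distinctCount (η : Ω → Measure (Space d)) (A : ι → Set (Space d)) (ω : Ω) : ℝ :=
  ((Measure.pi fun _ : ι => η ω).restrict {x | Function.Injective x} (Set.pi Set.univ A)).toReal

/-- The value of the factorial moment measure on a rectangle, as a real number. -/
noncomputable def factorialMomentReal (P : Measure Ω) (η : Ω → Measure (Space d))
    (A : ι → Set (Space d)) : ℝ :=
  (factorialMoment P η ι (Set.pi Set.univ A)).toReal

theorem IsPointProcess.exists_points (h : IsPointProcess η) {U : Set (Space d)}
    (hU : MeasurableSet U) (hUb : Bornology.IsBounded U) :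
    ∃ F : Ω → Finset (Space d), ∀ ω, (η ω).restrict U = ∑ x ∈ F ω, Measure.dirac x := by
  choose F hF using fun ω => (h.simple ω).exists_finset hU hUb
  exact ⟨F, hF⟩

open scoped Classical in
theorem IsPointProcess.distinctCount_eq (h : IsPointProcess η) {U : Set (Space d)}
    {F : Ω → Finset (Space d)} (hF : ∀ ω, (η ω).restrict U = ∑ x ∈ F ω, Measure.dirac x)
    {A : ι → Set (Space d)} (hA : ∀ i, MeasurableSet (A i)) (hAU : ∀ i, A i ⊆ U) (ω : Ω) :
    distinctCount η A ω = ((distinctTuples ι (F ω)).filter fun x => ∀ i, x i ∈ A i).card := by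
  rw [distinctCount, (h.simple ω).pi_restrict_injective (hF ω) hA hAU, ENNReal.toReal_natCast]

theorem IsPointProcess.measurable_distinctCount (h : IsPointProcess η) {A : ι → Set (Space d)}
    (hA : ∀ i, MeasurableSet (A i)) : Measurable (distinctCount η A) :=
  ((Measure.measurable_coe (MeasurableSet.univ_pi hA)).comp h.measurable_distinct).ennreal_toReal

theorem IsPointProcess.ofReal_distinctCount (h : IsPointProcess η) {A : ι → Set (Space d)}
    (hA : ∀ i, MeasurableSet (A i)) (hAb : ∀ i, Bornology.IsBounded (A i)) (ω : Ω) :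
    ENNReal.ofReal (distinctCount η A ω) =
      (Measure.pi fun _ : ι => η ω).restrict {x | Function.Injective x} (Set.pi Set.univ A) := by
  classical
  obtain ⟨F, hF⟩ := (h.simple ω).exists_finset (U := ⋃ i, A i) (MeasurableSet.iUnion hA)
    ((Bornology.isBounded_iUnion).2 hAb)
  rw [distinctCount, ENNReal.ofReal_toReal]
  rw [(h.simple ω).pi_restrict_injective hF hA fun i => Set.subset_iUnion A i]
  exact ENNReal.natCast_ne_top _

theorem IsPointProcess.factorialMoment_pi (h : IsPointProcess η) {A : ι → Set (Space d)}
    (hA : ∀ i, MeasurableSet (A i)) (hAb : ∀ i, Bornology.IsBounded (A i)) :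
    factorialMoment P η ι (Set.pi Set.univ A) =
      ∫⁻ ω, ENNReal.ofReal (distinctCount η A ω) ∂P := by
  rw [h.factorialMoment_apply (MeasurableSet.univ_pi hA)]
  simp_rw [h.ofReal_distinctCount hA hAb]

omit [MeasurableSpace Ω] in
theorem distinctCount_nonneg (A : ι → Set (Space d)) (ω : Ω) : 0 ≤ distinctCount η A ω :=
  ENNReal.toReal_nonneg

/-- Relabelling is needed to compare factorial moments indexed by the blocks of a partition with
those indexed by `Fin k`. -/
theorem IsPointProcess.distinctCount_comp_equiv (h : IsPointProcess η) {κ : Type} [Fintype κ]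
    (e : κ ≃ ι) {A : ι → Set (Space d)} (hA : ∀ i, MeasurableSet (A i))
    (hAb : ∀ i, Bornology.IsBounded (A i)) (ω : Ω) :
    distinctCount η (fun k => A (e k)) ω = distinctCount η A ω := by
  classical
  obtain ⟨F, hF⟩ := h.exists_points (U := ⋃ i, A i) (MeasurableSet.iUnion hA)
    ((Bornology.isBounded_iUnion).2 hAb)
  rw [h.distinctCount_eq hF hA fun i => Set.subset_iUnion A i,
    h.distinctCount_eq hF (fun k => hA _) fun k => Set.subset_iUnion A (e k)]
  congr 1
  refine Finset.card_bij (fun x _ i => x (e.symm i)) ?_ ?_ ?_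
  · intro x hx
    simp only [Finset.mem_filter, mem_distinctTuples] at hx ⊢
    exact ⟨⟨fun i => hx.1.1 _, hx.1.2.comp e.symm.injective⟩, fun i => by
      simpa using hx.2 (e.symm i)⟩
  · intro x _ y _ hxy
    ext1 k
    simpa using congrFun hxy (e k)
  · intro y hy
    simp only [Finset.mem_filter, mem_distinctTuples] at hy
    refine ⟨fun k => y (e k), ?_, by ext1 i; simp⟩
    simp only [Finset.mem_filter, mem_distinctTuples]
    exact ⟨⟨fun k => hy.1.1 _, hy.1.2.comp e.injective⟩, fun k => hy.2 _⟩

theorem IsBrillingerMixing.factorialMoment_pi_lt_top (hη : IsPointProcess η)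
    (hB : IsBrillingerMixing P η) {A : ι → Set (Space d)}
    (hA : ∀ i, MeasurableSet (A i)) (hAb : ∀ i, Bornology.IsBounded (A i)) :
    factorialMoment P η ι (Set.pi Set.univ A) < ∞ := by
  let e := (Fintype.equivFin ι).symm
  rw [hη.factorialMoment_pi hA hAb]
  simp_rw [← hη.distinctCount_comp_equiv e hA hAb]
  rw [← hη.factorialMoment_pi (fun k => hA _) fun k => hAb _]
  exact hB.locallyFinite _ _ (Bornology.IsBounded.pi fun k => hAb _)

theorem IsBrillingerMixing.integrable_distinctCount (hη : IsPointProcess η)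
    (hB : IsBrillingerMixing P η) {A : ι → Set (Space d)}
    (hA : ∀ i, MeasurableSet (A i)) (hAb : ∀ i, Bornology.IsBounded (A i)) :
    Integrable (distinctCount η A) P := by
  refine ⟨(hη.measurable_distinctCount hA).aestronglyMeasurable, ?_⟩
  rw [hasFiniteIntegral_iff_ofReal (ae_of_all _ (distinctCount_nonneg A)),
    ← hη.factorialMoment_pi hA hAb]
  exact hB.factorialMoment_pi_lt_top hη hA hAb

theorem IsPointProcess.factorialMomentReal_eq (h : IsPointProcess η) {A : ι → Set (Space d)}
    (hA : ∀ i, MeasurableSet (A i)) (hAb : ∀ i, Bornology.IsBounded (A i)) :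
    factorialMomentReal P η A = ∫ ω, distinctCount η A ω ∂P := by
  rw [factorialMomentReal, h.factorialMoment_pi hA hAb, integral_eq_lintegral_of_nonneg_ae
    (ae_of_all _ (distinctCount_nonneg A)) (h.measurable_distinctCount hA).aestronglyMeasurable]

theorem IsBrillingerMixing.sigmaFinite_factorialMoment (hη : IsPointProcess η)
    (hB : IsBrillingerMixing P η) : SigmaFinite (factorialMoment P η ι) := by
  refine ⟨⟨⟨fun n => Set.pi Set.univ fun _ => Metric.closedBall 0 n, fun _ => trivial,
    fun n => hB.factorialMoment_pi_lt_top hη (fun _ => Metric.isClosed_closedBall.measurableSet)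
      fun _ => Metric.isBounded_closedBall, ?_⟩⟩⟩
  refine Set.eq_univ_of_forall fun x => ?_
  obtain ⟨n, hn⟩ := exists_nat_ge ‖x‖
  refine Set.mem_iUnion.2 ⟨n, fun i _ => ?_⟩
  simpa using (norm_le_pi_norm x i).trans hn

/-- A rectangle pulls back, under the reindexing by blocks, to a product of rectangles. Local
finiteness provides the `σ`-finiteness that product measures require. -/
theorem partitionMoment_pi (hη : IsPointProcess η) (hB : IsBrillingerMixing P η) {n : ℕ}
    (π : Finpartition (Finset.univ : Finset (Fin n))) {A : Fin n → Set (Space d)}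
    (hA : ∀ i, MeasurableSet (A i)) :
    (partitionMoment P η π (Set.pi Set.univ A)).toReal =
      ∏ B : {B // B ∈ π.parts}, factorialMomentReal P η fun i : {i // i ∈ B.1} => A i := by
  have : ∀ B : {B : Finset (Fin n) // B ∈ π.parts},
      SigmaFinite (factorialMoment P η {i : Fin n // i ∈ B.1}) := fun B =>
    hB.sigmaFinite_factorialMoment hη
  rw [partitionMoment, Measure.map_apply (by fun_prop) (MeasurableSet.univ_pi hA)]
  have : (fun (x : (B : {B : Finset (Fin n) // B ∈ π.parts}) → {i : Fin n // i ∈ B.1} → Space d)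
      (i : Fin n) => x ⟨π.part i, π.part_mem.2 (Finset.mem_univ i)⟩
        ⟨i, π.mem_part (Finset.mem_univ i)⟩) ⁻¹' (Set.pi Set.univ A) =
      Set.pi Set.univ fun B : {B : Finset (Fin n) // B ∈ π.parts} =>
        Set.pi Set.univ fun i : {i : Fin n // i ∈ B.1} => A i := by
    ext x
    simp only [Set.mem_preimage, Set.mem_pi, Set.mem_univ, true_imp_iff]
    constructor
    · rintro h ⟨B, hB'⟩ ⟨i, hi⟩
      obtain rfl := π.part_eq_of_mem hB' hi
      exact h i
    · intro h i
      exact h ⟨π.part i, π.part_mem.2 (Finset.mem_univ i)⟩ ⟨i, π.mem_part (Finset.mem_univ i)⟩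
  rw [this, Measure.pi_pi, ENNReal.toReal_prod]
  rfl

end FactorialMoment

/-! ### Moments and cumulants of weighted counts -/

section WeightedMoment

variable {Ω : Type*} [MeasurableSpace Ω] {P : Measure Ω} {d : ℕ} {η : Ω → Measure (Space d)}
  {J : Type} [Fintype J] {ι : Type} [Fintype ι]

open scoped Classical in
/-- The integral of `∏_i ∑_j 1_{A_j}(x_i) (exp (v_j t) - 1)` with respect to the factorial moment
measure, as a formal power series in `t`. -/
noncomputable def weightedMoment (P : Measure Ω) (η : Ω → Measure (Space d))
    (A : J → Set (Space d)) (v : J → ℝ) (ι : Type) [Fintype ι] : PowerSeries ℝ :=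
  ∑ j : ι → J, factorialMomentReal P η (fun i => A (j i)) • ∏ i, expSubOne (v (j i))

theorem weightedMoment_congr (hη : IsPointProcess η) {κ : Type} [Fintype κ] (e : κ ≃ ι)
    {A : J → Set (Space d)} (hA : ∀ j, MeasurableSet (A j))
    (hAb : ∀ j, Bornology.IsBounded (A j)) (v : J → ℝ) :
    weightedMoment P η A v κ = weightedMoment P η A v ι := by
  classical
  refine Fintype.sum_equiv (e.arrowCongr (Equiv.refl J)) _ _ fun j => ?_
  congr 1
  · rw [hη.factorialMomentReal_eq (fun _ => hA _) fun _ => hAb _,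
      hη.factorialMomentReal_eq (fun _ => hA _) fun _ => hAb _]
    congr 1
    ext1 ω
    rw [← hη.distinctCount_comp_equiv e (fun _ => hA _) fun _ => hAb _]
    simp [Equiv.arrowCongr]
  · refine Fintype.prod_equiv e _ _ fun i => ?_
    simp [Equiv.arrowCongr]

theorem X_pow_dvd_weightedMoment (A : J → Set (Space d)) (v : J → ℝ) :
    (PowerSeries.X : PowerSeries ℝ) ^ Fintype.card ι ∣ weightedMoment P η A v ι := by
  refine Finset.dvd_sum fun j _ => ?_
  rw [PowerSeries.smul_eq_C_mul]
  refine Dvd.dvd.mul_left ?_ _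
  rw [← Finset.card_univ, ← Finset.prod_const]
  exact Finset.prod_dvd_prod_of_dvd _ _ fun i _ => X_dvd_expSubOne _

/-- There is exactly one empty tuple, so the value is the mass of `P`. This supplies the factor one
for unused colours. -/
theorem weightedMoment_zero [IsProbabilityMeasure P] (hη : IsPointProcess η)
    (A : J → Set (Space d)) (v : J → ℝ) : weightedMoment P η A v (Fin 0) = 1 := by
  classical
  rw [weightedMoment, Fintype.sum_unique, Finset.univ_eq_empty, Finset.prod_empty,
    hη.factorialMomentReal_eq (fun i => i.elim0) fun i => i.elim0]
  have : distinctCount η (fun i : Fin 0 => A ((default : Fin 0 → J) i)) = fun _ => 1 := by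
    ext1 ω
    rw [hη.distinctCount_eq (U := ∅) (F := fun _ => ∅) (fun ω => by simp) (fun i => i.elim0)
      fun i => i.elim0]
    rw [Nat.cast_eq_one, Finset.card_eq_one]
    refine ⟨Fin.elim0, ?_⟩
    ext x
    simp only [Finset.mem_filter, mem_distinctTuples, Finset.mem_singleton]
    refine ⟨fun _ => Subsingleton.elim _ _, fun _ => ⟨⟨fun i => i.elim0, fun i => i.elim0⟩,
      fun i => i.elim0⟩⟩
  rw [this]
  simp

omit [MeasurableSpace Ω] in
open scoped Classical in
theorem pointCount_eq_card {U A : Set (Space d)} (hA : MeasurableSet A) (hAU : A ⊆ U)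
    {F : Ω → Finset (Space d)} (hF : ∀ ω, (η ω).restrict U = ∑ x ∈ F ω, Measure.dirac x) (ω : Ω) :
    pointCount η A ω = ((F ω).filter fun x => x ∈ A).card := by
  have : η ω A = ((F ω).filter fun x => x ∈ A).card := by
    rw [← Set.inter_eq_left.2 hAU, ← Measure.restrict_apply hA, hF, Measure.finsetSum_apply]
    simp_rw [Measure.dirac_apply' _ hA]
    simp only [Set.indicator_apply, Pi.one_apply, Finset.sum_boole, Set.inter_eq_left.2 hAU]
  rw [pointCount, this, ENNReal.toReal_natCast]

/-- A pathwise identity. With `f = ∑ v_j 1_{A_j}`, the product of `1 + (exp (t f(x)) - 1)` over the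
points is `exp (t ∑ f(x))`, and it is expanded over tuples of distinct points. Disjointness makes
`exp (t f) - 1` equal to the sum of the `1_{A_j} (exp (t v_j) - 1)`. -/
theorem sum_weighted_distinctCount (hη : IsPointProcess η) {U : Set (Space d)}
    (hU : MeasurableSet U) (hUb : Bornology.IsBounded U)
    {A : J → Set (Space d)} (hA : ∀ j, MeasurableSet (A j)) (hAU : ∀ j, A j ⊆ U)
    (hdisj : Pairwise (Function.onFun Disjoint A)) (v : J → ℝ) (l : ℕ) (ω : Ω) :
    ∑ k ∈ Finset.range (l + 1), (∑ j : Fin k → J, distinctCount η (fun i => A (j i)) ω *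
      PowerSeries.coeff l (∏ i, expSubOne (v (j i)))) / (k.factorial : ℝ) =
      (∑ j, v j * pointCount η (A j) ω) ^ l / l.factorial := by
  classical
  obtain ⟨F, hF⟩ := hη.exists_points hU hUb
  set f : Space d → ℝ := fun x => ∑ j, if x ∈ A j then v j else 0 with hf
  have hfw : ∀ x, expSubOne (f x) = ∑ j, if x ∈ A j then expSubOne (v j) else 0 := fun x => by
    by_cases h : ∃ j, x ∈ A j
    · obtain ⟨j, hj⟩ := h
      have hne : ∀ i, i ≠ j → x ∉ A i := fun i hi hx =>
        Set.disjoint_left.1 (hdisj hi) hx hj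
      simp only [hf]
      rw [Finset.sum_eq_single j (fun i _ hi => if_neg (hne i hi)) (by simp), if_pos hj,
        Finset.sum_eq_single j (fun i _ hi => if_neg (hne i hi)) (by simp), if_pos hj]
    · push Not at h
      simp [hf, h, expSubOne]
  have hsum : ∑ x ∈ F ω, f x = ∑ j, v j * pointCount η (A j) ω := by
    simp only [hf]
    rw [Finset.sum_comm]
    refine Finset.sum_congr rfl fun j _ => ?_
    rw [pointCount_eq_card (hA j) (hAU j) hF, ← Finset.sum_filter, Finset.sum_const, nsmul_eq_mul,
      mul_comm]
  have h := coeff_prod_one_add_eq_sum_distinctTuples (F ω) (fun x => expSubOne (f x))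
    (fun x => X_dvd_expSubOne _) l
  rw [prod_one_add_expSubOne, coeff_rescale_exp, hsum] at h
  rw [h]
  refine Finset.sum_congr rfl fun k _ => ?_
  congr 1
  have : ∑ x ∈ distinctTuples (Fin k) (F ω), ∏ i, expSubOne (f (x i)) =
      ∑ j : Fin k → J, distinctCount η (fun i => A (j i)) ω • ∏ i, expSubOne (v (j i)) := by
    simp_rw [hfw, Finset.prod_univ_sum, Fintype.piFinset_univ]
    rw [Finset.sum_comm]
    refine Finset.sum_congr rfl fun j _ => ?_
    rw [hη.distinctCount_eq hF (fun i => hA _) fun i => hAU _, Nat.cast_smul_eq_nsmul,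
      ← Finset.sum_const, Finset.sum_filter]
    refine Finset.sum_congr (by ext; simp [mem_distinctTuples]) fun x _ => ?_
    split_ifs with hx
    · exact Finset.prod_congr rfl fun i _ => if_pos (hx i)
    · push Not at hx
      obtain ⟨i, hi⟩ := hx
      exact Finset.prod_eq_zero (Finset.mem_univ i) (if_neg hi)
  rw [this, map_sum]
  exact Finset.sum_congr rfl fun j _ => by rw [PowerSeries.coeff_smul, smul_eq_mul]

/-- The generating function, in a second variable `u`, of the weighted factorial moments. -/
noncomputable def weightedSeries (P : Measure Ω) (η : Ω → Measure (Space d))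
    (A : J → Set (Space d)) (v : J → ℝ) : PowerSeries (PowerSeries ℝ) :=
  PowerSeries.mk fun k => ((k.factorial : ℚ)⁻¹) • weightedMoment P η A v (Fin k)

theorem coeff_rat_smul (q : ℚ) (l : ℕ) (F : PowerSeries ℝ) :
    PowerSeries.coeff l (q • F) = (q : ℝ) * PowerSeries.coeff l F := by
  have : q • F = (q : ℝ) • F := by
    ext n
    simp [Rat.smul_def]
  rw [this, PowerSeries.coeff_smul, smul_eq_mul]

theorem isAdmissible_weightedSeries (A : J → Set (Space d)) (v : J → ℝ) :
    IsAdmissible (weightedSeries P η A v) := fun n => by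
  rw [weightedSeries, PowerSeries.coeff_mk, Algebra.smul_def]
  refine Dvd.dvd.mul_left ?_ _
  simpa using X_pow_dvd_weightedMoment (P := P) (η := η) (ι := Fin n) A v

/-- A power of a weighted count is a finite linear combination of numbers of distinct tuples, which
are integrable by local finiteness of the factorial moments. -/
theorem integrable_weighted_pow (hη : IsPointProcess η) (hB : IsBrillingerMixing P η)
    {U : Set (Space d)} (hU : MeasurableSet U) (hUb : Bornology.IsBounded U)
    {A : J → Set (Space d)} (hA : ∀ j, MeasurableSet (A j)) (hAU : ∀ j, A j ⊆ U)
    (hdisj : Pairwise (Function.onFun Disjoint A)) (v : J → ℝ) (l : ℕ) :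
    Integrable (fun ω => (∑ j, v j * pointCount η (A j) ω) ^ l) P := by
  have h : ∀ ω, (∑ j, v j * pointCount η (A j) ω) ^ l = l.factorial *
      ∑ k ∈ Finset.range (l + 1), (∑ j : Fin k → J, distinctCount η (fun i => A (j i)) ω *
      PowerSeries.coeff l (∏ i, expSubOne (v (j i)))) / (k.factorial : ℝ) := fun ω => by
    rw [sum_weighted_distinctCount hη hU hUb hA hAU hdisj]
    field_simp
  simp_rw [h]
  refine Integrable.const_mul (integrable_finsetSum _ fun k _ => Integrable.div_const
    (integrable_finsetSum _ fun j _ => Integrable.mul_const ?_ _) _) _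
  exact hB.integrable_distinctCount hη (fun _ => hA _) fun _ => hUb.subset (hAU _)

/-- The expectation of the pathwise expansion: the collapsed series is the moment generating
function of the weighted count. -/
theorem coeff_collapse_weightedSeries (hη : IsPointProcess η) (hB : IsBrillingerMixing P η)
    {U : Set (Space d)} (hU : MeasurableSet U) (hUb : Bornology.IsBounded U)
    {A : J → Set (Space d)} (hA : ∀ j, MeasurableSet (A j)) (hAU : ∀ j, A j ⊆ U)
    (hdisj : Pairwise (Function.onFun Disjoint A)) (v : J → ℝ) (l : ℕ) :
    PowerSeries.coeff l (collapse (weightedSeries P η A v)) =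
      (∫ ω, (∑ j, v j * pointCount η (A j) ω) ^ l ∂P) / l.factorial := by
  rw [← integral_div]
  simp_rw [← sum_weighted_distinctCount hη hU hUb hA hAU hdisj]
  have hint : ∀ (k : ℕ) (j : Fin k → J), Integrable (distinctCount η fun i => A (j i)) P :=
    fun k j => hB.integrable_distinctCount hη (fun _ => hA _) fun _ => hUb.subset (hAU _)
  rw [integral_finsetSum _ fun k _ => Integrable.div_const
    (integrable_finsetSum _ fun j _ => Integrable.mul_const (hint k j) _) _, collapse,
    PowerSeries.coeff_mk]
  refine Finset.sum_congr rfl fun k _ => ?_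
  rw [integral_div, integral_finsetSum _ fun j _ => Integrable.mul_const (hint k j) _,
    weightedSeries, PowerSeries.coeff_mk, coeff_rat_smul, weightedMoment, map_sum, div_eq_inv_mul]
  push_cast
  congr 1
  refine Finset.sum_congr ?_ fun j _ => ?_
  · ext; simp
  rw [PowerSeries.coeff_smul, smul_eq_mul, integral_mul_const,
    hη.factorialMomentReal_eq (fun _ => hA _) fun _ => hUb.subset (hAU _)]

/-- Choosing an index map on every block amounts to choosing one index map on `Fin n`; multiply out
and regroup. -/
theorem prod_parts_weightedMoment (hη : IsPointProcess η) (hB : IsBrillingerMixing P η)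
    {A : J → Set (Space d)} (hA : ∀ j, MeasurableSet (A j))
    (hAb : ∀ j, Bornology.IsBounded (A j)) (v : J → ℝ) {n : ℕ}
    (π : Finpartition (Finset.univ : Finset (Fin n))) :
    ∏ B ∈ π.parts, weightedMoment P η A v (Fin B.card) =
      ∑ j : Fin n → J, (partitionMoment P η π (Set.pi Set.univ fun i => A (j i))).toReal •
        ∏ i, expSubOne (v (j i)) := by
  classical
  rw [← Finset.prod_coe_sort]
  have h1 : ∀ B : {B // B ∈ π.parts}, weightedMoment P η A v (Fin B.1.card) =
      weightedMoment P η A v {i // i ∈ B.1} := fun B =>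
    weightedMoment_congr hη B.1.equivFin.symm hA hAb v
  simp_rw [h1, weightedMoment]
  rw [Finset.prod_univ_sum]
  symm
  refine Finset.sum_bij' (fun j _ (B : {B // B ∈ π.parts}) (i : {i // i ∈ B.1}) => j i.1)
    (fun p _ i => p ⟨π.part i, π.part_mem.2 (Finset.mem_univ i)⟩
      ⟨i, π.mem_part (Finset.mem_univ i)⟩) ?_ ?_ ?_ ?_ ?_
  · intro j _
    simp
  · intro p _
    simp
  · intro j _
    rfl
  · intro p _
    ext ⟨B, hB'⟩ ⟨i, hi⟩
    obtain rfl := π.part_eq_of_mem hB' hi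
    rfl
  · intro j _
    rw [partitionMoment_pi hη hB π fun i => hA _, Finset.prod_smul]
    congr 1
    have h2 : ∀ B : {B // B ∈ π.parts}, ∏ i : {i // i ∈ B.1}, expSubOne (v (j i)) =
        ∏ i ∈ B.1, expSubOne (v (j i)) := fun B =>
      Finset.prod_coe_sort B.1 fun i => expSubOne (v (j i))
    simp_rw [h2]
    rw [Finset.prod_coe_sort π.parts fun B => ∏ i ∈ B, expSubOne (v (j i))]
    have h3 := Finset.prod_biUnion (s := π.parts) (t := id) (f := fun i => expSubOne (v (j i)))
      π.supIndep.pairwiseDisjoint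
    rw [π.biUnion_parts] at h3
    exact h3

/-- The linear coefficient, in `m`, of the coefficients of the `m`-th power of the moment generating
function. -/
theorem exists_polynomial_coeff_pow [IsProbabilityMeasure P] (hη : IsPointProcess η)
    (hB : IsBrillingerMixing P η) {A : J → Set (Space d)} (hA : ∀ j, MeasurableSet (A j))
    (hAb : ∀ j, Bornology.IsBounded (A j)) (v : J → ℝ) :
    ∃ p : ℕ → Polynomial ℝ,
      (∀ l m : ℕ, PowerSeries.coeff l (collapse (weightedSeries P η A v) ^ m) =
        (p l).eval (m : ℝ)) ∧
      ∀ l, (p l).coeff 1 = ∑ n ∈ Finset.range l, ∑ j : Fin (n + 1) → J,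
        ((n + 1).factorial : ℝ)⁻¹ * PowerSeries.coeff l (∏ i, expSubOne (v (j i))) *
          factorialCumulant P η (Set.pi Set.univ fun i => A (j i)) := by
  classical
  set a : ℕ → PowerSeries ℝ := fun k => weightedMoment P η A v (Fin k) with ha
  -- In each order `n`, the sum over colourings becomes a sum over partitions `π` weighted by the
  -- falling factorial of `m` of length `|π|`.
  refine ⟨fun l => ∑ n ∈ Finset.range (l + 1),
    ∑ π : Finpartition (Finset.univ : Finset (Fin n)),
      Polynomial.C ((n.factorial : ℝ)⁻¹ * PowerSeries.coeff l (∏ B ∈ π.parts, a B.card)) *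
        descPochhammer ℝ π.parts.card, fun l m => ?_, fun l => ?_⟩
  · rw [← collapse_pow (isAdmissible_weightedSeries A v), collapse, PowerSeries.coeff_mk,
      Polynomial.eval_finsetSum]
    refine Finset.sum_congr rfl fun n _ => ?_
    have h := coeff_pow_eq_sum_coloring a n m
    rw [sum_coloring_eq_sum_finpartition n m (fun B => a B.card)
      (weightedMoment_zero hη A v)] at h
    have h' := congrArg (PowerSeries.coeff l) h
    rw [← map_natCast (PowerSeries.C (R := ℝ)), PowerSeries.coeff_C_mul] at h'
    rw [weightedSeries, ← mul_right_inj' (Nat.cast_ne_zero.2 n.factorial_ne_zero : (n.factorial : ℝ) ≠ 0), h', map_sum,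
      Polynomial.eval_finsetSum, Finset.mul_sum]
    refine Finset.sum_congr rfl fun π _ => ?_
    rw [← map_natCast (PowerSeries.C (R := ℝ)), PowerSeries.coeff_C_mul, Polynomial.eval_mul,
      Polynomial.eval_C, descPochhammer_eval_eq_descFactorial]
    have := n.factorial_ne_zero
    field_simp
  · rw [Polynomial.finsetSum_coeff, Finset.sum_range_succ']
    -- Order zero is constant in `m`; dropping it shifts the index to `n + 1`.
    have h0 : (∑ π : Finpartition (Finset.univ : Finset (Fin 0)),
        Polynomial.C (((0 : ℕ).factorial : ℝ)⁻¹ * PowerSeries.coeff l (∏ B ∈ π.parts, a B.card)) *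
        descPochhammer ℝ π.parts.card).coeff 1 = 0 := by
      rw [Polynomial.finsetSum_coeff]
      refine Finset.sum_eq_zero fun π _ => ?_
      have : π.parts = ∅ := by
        rw [π.parts_eq_empty_iff]
        rfl
      rw [this, Finset.card_empty, descPochhammer_zero, mul_one, Polynomial.coeff_C_of_ne_zero one_ne_zero]
    rw [h0, add_zero]
    refine Finset.sum_congr rfl fun n _ => ?_
    rw [Polynomial.finsetSum_coeff]
    simp_rw [factorialCumulant, Finset.mul_sum]
    rw [Finset.sum_comm]
    refine Finset.sum_congr rfl fun π _ => ?_
    have hπ : 1 ≤ π.parts.card := by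
      rw [Nat.one_le_iff_ne_zero, Finset.card_ne_zero]
      exact π.parts_nonempty (Finset.univ_nonempty.ne_empty)
    rw [Polynomial.coeff_C_mul, coeff_one_descPochhammer _ hπ,
      prod_parts_weightedMoment hη hB hA hAb, map_sum, Finset.mul_sum, Finset.sum_mul]
    refine Finset.sum_congr rfl fun j _ => ?_
    rw [PowerSeries.coeff_smul, smul_eq_mul]
    ring

end WeightedMoment

/-! ### Bounds for the cumulants -/

section CumulantBound

variable {Ω : Type*} [MeasurableSpace Ω] {P : Measure Ω} {d : ℕ} {η : Ω → Measure (Space d)}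

theorem IsPointProcess.measurable_pointCount (hη : IsPointProcess η) {A : Set (Space d)}
    (hA : MeasurableSet A) : Measurable (pointCount η A) :=
  ((Measure.measurable_coe hA).comp hη.measurable).ennreal_toReal

theorem IsPointProcess.integral_pointCount (hη : IsPointProcess η) (hI : HasUnitIntensity P η)
    {A : Set (Space d)} (hA : MeasurableSet A) (hAb : Bornology.IsBounded A) :
    ∫ ω, pointCount η A ω ∂P = (volume A).toReal := by
  simp only [pointCount]
  rw [integral_toReal (f := fun ω => η ω A) ((Measure.measurable_coe hA).comp hη.measurable).aemeasurable
    (ae_of_all _ fun ω => (hη.simple ω).measure_lt_top hAb), hI _ hA]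

theorem abs_signedMeasure_le {α : Type*} [MeasurableSpace α] (γ : SignedMeasure α) (W : Set α) :
    |γ W| ≤ (γ.totalVariation Set.univ).toReal := by
  by_cases hW : MeasurableSet W
  · conv_lhs => rw [← γ.toSignedMeasure_toJordanDecomposition]
    rw [JordanDecomposition.toSignedMeasure, sub_apply,
      Measure.toSignedMeasure_apply_measurable hW, Measure.toSignedMeasure_apply_measurable hW,
      SignedMeasure.totalVariation, Measure.add_apply, ENNReal.toReal_add (measure_ne_top _ _)
      (measure_ne_top _ _)]
    have h1 := measureReal_mono (μ := γ.toJordanDecomposition.posPart) (Set.subset_univ W)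
    have h2 := measureReal_mono (μ := γ.toJordanDecomposition.negPart) (Set.subset_univ W)
    have h3 := measureReal_nonneg (μ := γ.toJordanDecomposition.posPart) (s := W)
    have h4 := measureReal_nonneg (μ := γ.toJordanDecomposition.negPart) (s := W)
    simp only [measureReal_def] at *
    rw [abs_le]
    constructor <;> linarith
  · rw [γ.not_measurable hW, abs_zero]
    exact ENNReal.toReal_nonneg

/-- The last coordinate of the shifted tuple is `y`, so the integrand of the reduced cumulant
vanishes unless `y ∈ U`; elsewhere it is at most the total variation. The first cumulant is the
intensity measure. The constant does not depend on the sets. -/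
theorem IsBrillingerMixing.exists_abs_factorialCumulant_le [IsProbabilityMeasure P]
    (hη : IsPointProcess η)
    (hB : IsBrillingerMixing P η) (hI : HasUnitIntensity P η) (n : ℕ) :
    ∃ C, 0 ≤ C ∧ ∀ (U : Set (Space d)) (A : Fin (n + 1) → Set (Space d)), MeasurableSet U →
      Bornology.IsBounded U → (∀ i, MeasurableSet (A i)) → (∀ i, A i ⊆ U) →
      |factorialCumulant P η (Set.pi Set.univ A)| ≤ C * (volume U).toReal := by
  classical
  rcases n with _ | n
  · refine ⟨1, zero_le_one, fun U A hU hUb hA hAU => ?_⟩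
    have hat : IsAtom (Finset.univ : Finset (Fin 1)) := Finset.isAtom_iff.2 ⟨0, rfl⟩
    let : Unique (Finpartition (Finset.univ : Finset (Fin 1))) :=
      IsAtom.uniqueFinpartition (P := Finpartition.indiscrete hat.1) hat
    have : factorialCumulant P η (Set.pi Set.univ A) = (volume (A 0)).toReal := by
      have hp : ∀ π : Finpartition (Finset.univ : Finset (Fin 1)),
          π.parts = {Finset.univ} := fun π => by
        rw [Subsingleton.elim π (Finpartition.indiscrete hat.1)]
        rfl
      rw [factorialCumulant, Fintype.sum_unique, partitionMoment_pi hη hB _ hA]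
      rw [Finset.prod_coe_sort (Finpartition.parts _)
        fun B : Finset (Fin 1) => factorialMomentReal P η fun i : {i : Fin 1 // i ∈ B} => A i, hp, Finset.prod_singleton,
        hη.factorialMomentReal_eq (fun i => hA _) fun i => hUb.subset (hAU _)]
      have : distinctCount η (fun i : {i // i ∈ (Finset.univ : Finset (Fin 1))} => A i) =
          pointCount η (A 0) := by
        obtain ⟨F, hF⟩ := hη.exists_points hU hUb
        ext1 ω
        rw [hη.distinctCount_eq hF (fun i => hA _) fun i => hAU _, pointCount_eq_card (hA 0) (hAU 0) hF]
        congr 1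
        refine Finset.card_bij (fun x _ => x ⟨0, Finset.mem_univ _⟩) ?_ ?_ ?_
        · intro x hx
          simp only [Finset.mem_filter, mem_distinctTuples] at hx ⊢
          exact ⟨hx.1.1 _, hx.2 ⟨0, Finset.mem_univ _⟩⟩
        · intro x _ y _ hxy
          ext1 ⟨i, hi⟩
          obtain rfl := Subsingleton.elim i 0
          exact hxy
        · intro y hy
          refine ⟨fun _ => y, ?_, rfl⟩
          simp only [Finset.mem_filter, mem_distinctTuples] at hy ⊢
          exact ⟨⟨fun _ => hy.1, Function.injective_of_subsingleton _⟩, fun ⟨i, hi⟩ => by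
            obtain rfl := Subsingleton.elim i 0
            exact hy.2⟩
      rw [this]
      rw [hη.integral_pointCount hI (hA 0) (hUb.subset (hAU 0))]
      simp
    rw [this, one_mul, abs_of_nonneg ENNReal.toReal_nonneg]
    exact ENNReal.toReal_mono hUb.measure_lt_top.ne (measure_mono (hAU 0))
  · obtain ⟨γ, hγ⟩ := hB.reducedCumulant (n + 1) (by omega)
    refine ⟨(γ.totalVariation Set.univ).toReal, ENNReal.toReal_nonneg,
      fun U A hU hUb hA hAU => ?_⟩
    rw [hγ _ (MeasurableSet.univ_pi hA) (Bornology.IsBounded.pi fun i => hUb.subset (hAU i)),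
      ← Real.norm_eq_abs]
    have h0 : ∀ y ∉ U, γ {x | shiftSnoc x y ∈ Set.pi Set.univ A} = 0 := fun y hy => by
      have : {x : Fin (n + 1) → Space d | shiftSnoc x y ∈ Set.pi Set.univ A} = ∅ := by
        ext x
        simp only [Set.mem_ofPred_eq, Set.mem_empty_iff_false, iff_false]
        intro h
        have := h (Fin.last _) (Set.mem_univ _)
        simp only [shiftSnoc, Fin.snoc_last] at this
        exact hy (hAU _ this)
      rw [this, VectorMeasure.empty]
    rw [← setIntegral_eq_integral_of_forall_compl_eq_zero h0]
    exact norm_setIntegral_le_of_norm_le_const hUb.measure_lt_top fun y _ => by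
      rw [Real.norm_eq_abs]
      exact abs_signedMeasure_le γ _

end CumulantBound

/-! ### Cumulants of linear combinations of centred counts -/

/-- The recursion is the differential equation `M' = κ' M`, from which Leibniz' rule makes cumulants
additive under products. -/
theorem isExpSeq_iff {m κ : ℕ → ℝ} : IsExpSeq m κ ↔ m 0 = 1 ∧
    PowerSeries.derivative ℝ (PowerSeries.mk m) =
      PowerSeries.derivative ℝ (PowerSeries.mk κ) * PowerSeries.mk m := by
  have h : ∀ k : ℕ, ((k + 1 : ℝ) * m (k + 1) =
      ∑ i ∈ Finset.range (k + 1), (i + 1 : ℝ) * κ (i + 1) * m (k - i)) ↔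
      PowerSeries.coeff k (PowerSeries.derivative ℝ (PowerSeries.mk m)) = PowerSeries.coeff k
        (PowerSeries.derivative ℝ (PowerSeries.mk κ) * PowerSeries.mk m) := fun k => by
    rw [PowerSeries.coeff_mul, Finset.Nat.sum_antidiagonal_eq_sum_range_succ_mk]
    simp only [PowerSeries.coeff_derivative, PowerSeries.coeff_mk]
    rw [mul_comm]
    refine Eq.congr_right (Finset.sum_congr rfl fun i _ => by ring)
  exact ⟨fun hm => ⟨hm.zero, PowerSeries.ext fun k => (h k).1 (hm.succ k)⟩,
    fun hm => ⟨hm.1, fun k => (h k).2 (by rw [hm.2])⟩⟩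

theorem IsExpSeq.mul {m κ m' κ' : ℕ → ℝ} (h : IsExpSeq m κ) (h' : IsExpSeq m' κ') :
    IsExpSeq (fun k => ∑ x ∈ Finset.HasAntidiagonal.antidiagonal k, m x.1 * m' x.2)
      fun k => κ k + κ' k := by
  rw [isExpSeq_iff] at *
  have e1 : (PowerSeries.mk fun k => ∑ x ∈ Finset.HasAntidiagonal.antidiagonal k, m x.1 * m' x.2) =
      PowerSeries.mk m * PowerSeries.mk m' := by
    ext k
    simp [PowerSeries.coeff_mul]
  have e2 : (PowerSeries.mk fun k => κ k + κ' k) = PowerSeries.mk κ + PowerSeries.mk κ' := by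
    ext k
    simp
  refine ⟨by simp [h.1, h'.1], ?_⟩
  rw [e1, e2, Derivation.leibniz, h.2, h'.2, map_add, smul_eq_mul, smul_eq_mul]
  ring

theorem isExpSeq_pow_div_factorial (c : ℝ) :
    IsExpSeq (fun k => c ^ k / k.factorial) fun k => if k = 1 then c else 0 where
  zero := by simp
  succ k := by
    rw [Finset.sum_eq_single_of_mem 0 (by simp) fun i _ hi => by simp [hi]]
    rw [Nat.factorial_succ]
    have := k.factorial_ne_zero
    push_cast
    have : (k + 1 : ℝ) ≠ 0 := by positivity
    simp
    field_simp
    ring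

/-- The binomial theorem makes the moments of `X + c`, divided by factorials, a Cauchy product with
the series of `exp (c t)`. A translation therefore changes only the first cumulant. -/
theorem isExpSeq_moments_add_const {Ω : Type*} [MeasurableSpace Ω] {P : Measure Ω}
    [IsProbabilityMeasure P] {X : Ω → ℝ} (hX : ∀ k : ℕ, Integrable (fun ω => X ω ^ k) P)
    {κ : ℕ → ℝ} (h : IsExpSeq (fun k => (∫ ω, X ω ^ k ∂P) / k.factorial) κ) (c : ℝ) :
    (∀ k : ℕ, Integrable (fun ω => (X ω + c) ^ k) P) ∧
    IsExpSeq (fun k => (∫ ω, (X ω + c) ^ k ∂P) / k.factorial)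
      fun k => κ k + if k = 1 then c else 0 := by
  have e : ∀ (k : ℕ) ω, (X ω + c) ^ k = ∑ x ∈ Finset.HasAntidiagonal.antidiagonal k,
      k.choose x.1 * (X ω ^ x.1 * c ^ x.2) := fun k ω => by
    rw [(Commute.all (X ω) c).add_pow']
    simp only [nsmul_eq_mul]
  have hi : ∀ (k : ℕ) (x : ℕ × ℕ), Integrable (fun ω => (k.choose x.1 : ℝ) * (X ω ^ x.1 * c ^ x.2)) P :=
    fun k x => ((hX _).mul_const _).const_mul _
  refine ⟨fun k => ?_, ?_⟩
  · simp_rw [e]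
    exact integrable_finsetSum _ fun x _ => hi k x
  · convert! h.mul (isExpSeq_pow_div_factorial c) using 2 with k
    simp_rw [e]
    rw [integral_finsetSum _ fun x _ => hi k x, Finset.sum_div]
    refine Finset.sum_congr rfl fun x hx => ?_
    rw [Finset.HasAntidiagonal.mem_antidiagonal] at hx
    rw [integral_const_mul, integral_mul_const, ← hx, Nat.choose_symm_add, Nat.add_choose,
      Nat.cast_div (Nat.factorial_mul_factorial_dvd_factorial_add _ _) (by positivity)]
    have := x.1.factorial_ne_zero
    have := x.2.factorial_ne_zero
    have := (x.1 + x.2).factorial_ne_zero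
    push_cast
    field_simp

/-! ### Volume bounds for the cumulants of centred counts -/

section

variable {Ω : Type*} [MeasurableSpace Ω] {P : Measure Ω} {d : ℕ} {η : Ω → Measure (Space d)}

theorem IsBrillingerMixing.integrable_pointCount_pow (hB : IsBrillingerMixing P η)
    (hη : IsPointProcess η) {A : Set (Space d)} (hA : MeasurableSet A)
    (hAb : Bornology.IsBounded A) (k : ℕ) : Integrable (fun ω => pointCount η A ω ^ k) P := by
  simpa using integrable_weighted_pow (P := P) (J := Unit) hη hB hA hAb (fun _ => hA)
    (fun _ => subset_rfl) (fun a b hab => (hab rfl).elim) (fun _ => 1) k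

theorem IsBrillingerMixing.memLp_pointCount (hB : IsBrillingerMixing P η)
    (hη : IsPointProcess η) {A : Set (Space d)} (hA : MeasurableSet A)
    (hAb : Bornology.IsBounded A) : MemLp (pointCount η A) 2 P :=
  (memLp_two_iff_integrable_sq (hη.measurable_pointCount hA).aestronglyMeasurable).2
    (hB.integrable_pointCount_pow hη hA hAb 2)

/-- The cumulant of order `l` is a finite combination of factorial cumulants of order at most `l` on
rectangles. Its coefficients depend only on the weights `v`, so `C` is uniform in the sets. -/
theorem exists_cumulant_bound_of_disjoint [IsProbabilityMeasure P] (hη : IsPointProcess η)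
    (hB : IsBrillingerMixing P η) (hI : HasUnitIntensity P η) {J : Type} [Fintype J] (v : J → ℝ) :
    ∃ C : ℕ → ℝ, ∀ (U : Set (Space d)) (A : J → Set (Space d)), MeasurableSet U →
      Bornology.IsBounded U → (∀ j, MeasurableSet (A j)) → (∀ j, A j ⊆ U) →
      Pairwise (Function.onFun Disjoint A) →
      ∃ κ, IsExpSeq (fun l => (∫ ω, (∑ j, v j * pointCount η (A j) ω) ^ l ∂P) / l.factorial) κ ∧
        ∀ l, |κ l| ≤ C l * (volume U).toReal := by
  classical
  choose C hC0 hC using hB.exists_abs_factorialCumulant_le (P := P) hη hI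
  refine ⟨fun l => ∑ n ∈ Finset.range l, ∑ j : Fin (n + 1) → J,
    |((n + 1).factorial : ℝ)⁻¹ * PowerSeries.coeff l (∏ i, expSubOne (v (j i)))| * C n,
    fun U A hU hUb hA hAU hdisj => ?_⟩
  have hAb : ∀ j, Bornology.IsBounded (A j) := fun j => hUb.subset (hAU j)
  obtain ⟨p, hp, hp1⟩ := exists_polynomial_coeff_pow (P := P) hη hB hA hAb v
  have hM := coeff_collapse_weightedSeries (P := P) hη hB hU hUb hA hAU hdisj v
  refine ⟨fun l => (p l).coeff 1, ?_, fun l => ?_⟩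
  · have := isExpSeq_of_coeff_pow (M := collapse (weightedSeries P η A v))
      (by rw [hM]; simp) p hp
    simpa only [hM] using this
  · simp only [hp1]
    refine (Finset.abs_sum_le_sum_abs _ _).trans ?_
    rw [Finset.sum_mul]
    refine Finset.sum_le_sum fun n _ => (Finset.abs_sum_le_sum_abs _ _).trans ?_
    rw [Finset.sum_mul]
    refine Finset.sum_le_sum fun j _ => ?_
    rw [abs_mul, mul_assoc]
    exact mul_le_mul_of_nonneg_left (hC n U _ hU hUb (fun i => hA _) fun i => hAU _)
      (abs_nonneg _)

/-- Overlapping sets are cut into disjoint atoms, indexed by the set `S` of those `B j` that contain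
the point; an atom carries the weight `∑_{j ∈ S} t j`. -/
theorem sum_mul_pointCount_eq_sum_atoms (hη : IsPointProcess η) {N : ℕ} (t : Fin N → ℝ)
    {U : Set (Space d)} {B : Fin N → Set (Space d)} (hU : MeasurableSet U)
    (hUb : Bornology.IsBounded U) (hB : ∀ j, MeasurableSet (B j)) (hBU : ∀ j, B j ⊆ U) (ω : Ω)
    (hA : ∀ S : Finset (Fin N), MeasurableSet (U ∩ {x | ∀ j, j ∈ S ↔ x ∈ B j})) :
    ∑ S : Finset (Fin N), (∑ j ∈ S, t j) * pointCount η (U ∩ {x | ∀ j, j ∈ S ↔ x ∈ B j}) ω =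
      ∑ j, t j * pointCount η (B j) ω := by
  classical
  obtain ⟨F, hF⟩ := hη.exists_points hU hUb
  simp_rw [fun S => pointCount_eq_card (hA S) Set.inter_subset_left hF ω,
    fun j => pointCount_eq_card (hB j) (hBU j) hF ω, Finset.card_filter, Nat.cast_sum,
    Finset.mul_sum]
  rw [Finset.sum_comm, Finset.sum_comm (γ := Fin N)]
  refine Finset.sum_congr rfl fun x _ => ?_
  by_cases hx : x ∈ U
  · rw [Finset.sum_eq_single (Finset.univ.filter fun j => x ∈ B j)]
    · rw [if_pos ⟨hx, by simp⟩, Nat.cast_one, mul_one, Finset.sum_filter]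
      exact Finset.sum_congr rfl fun j _ => by split_ifs <;> simp
    · intro S _ hS
      rw [if_neg, Nat.cast_zero, mul_zero]
      rintro ⟨-, h⟩
      exact hS (by ext j; simpa using h j)
    · simp
  · rw [Finset.sum_eq_zero fun S _ => by rw [if_neg fun h => hx h.1]; simp,
      Finset.sum_eq_zero fun j _ => by rw [if_neg fun h => hx (hBU j h)]; simp]

/-- The cumulants of order at least two of a linear combination of the counts of sets contained
in `U` are at most of the order of the volume of `U`. -/
theorem exists_cumulant_bound [IsProbabilityMeasure P] (hη : IsPointProcess η)
    (hB : IsBrillingerMixing P η) (hI : HasUnitIntensity P η) {N : ℕ} (t : Fin N → ℝ) :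
    ∃ C : ℕ → ℝ, ∀ (U : Set (Space d)) (B : Fin N → Set (Space d)), MeasurableSet U →
      Bornology.IsBounded U → (∀ j, MeasurableSet (B j)) → (∀ j, B j ⊆ U) →
      (∀ k : ℕ, Integrable (fun ω => (∑ j, t j * (pointCount η (B j) ω - (volume (B j)).toReal)) ^ k) P) ∧
      ∃ κ, IsExpSeq (fun l => (∫ ω, (∑ j, t j * (pointCount η (B j) ω -
          (volume (B j)).toReal)) ^ l ∂P) / l.factorial) κ ∧ κ 1 = 0 ∧
        ∀ l, 2 ≤ l → |κ l| ≤ C l * (volume U).toReal := by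
  classical
  obtain ⟨C, hC⟩ := exists_cumulant_bound_of_disjoint (P := P) hη hB hI
    fun S : Finset (Fin N) => ∑ j ∈ S, t j
  refine ⟨C, fun U B hU hUb hBm hBU => ?_⟩
  have hA : ∀ S : Finset (Fin N), MeasurableSet (U ∩ {x | ∀ j, j ∈ S ↔ x ∈ B j}) := fun S => by
    refine hU.inter ?_
    rw [Set.ofPred_forall]
    refine MeasurableSet.iInter fun j => ?_
    by_cases h : j ∈ S
    · simpa [h] using hBm j
    · simp only [h, false_iff]
      exact (hBm j).compl
  have hdisj : Pairwise (Function.onFun Disjoint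
      fun S : Finset (Fin N) => U ∩ {x | ∀ j, j ∈ S ↔ x ∈ B j}) := fun S T hST => by
    refine Set.disjoint_left.2 fun x hx hx' => hST ?_
    ext j
    rw [hx.2 j, hx'.2 j]
  have hint := integrable_weighted_pow (P := P) hη hB hU hUb hA (fun _ => Set.inter_subset_left)
    hdisj fun S : Finset (Fin N) => ∑ j ∈ S, t j
  obtain ⟨κ, hκ, hκb⟩ := hC U _ hU hUb hA (fun _ => Set.inter_subset_left) hdisj
  simp_rw [sum_mul_pointCount_eq_sum_atoms hη t hU hUb hBm hBU _ hA] at hint hκ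
  -- Centring subtracts the mean: it makes the first cumulant vanish and leaves the bounds on the
  -- others untouched.
  obtain ⟨h1, h2⟩ := isExpSeq_moments_add_const hint hκ (-∑ j, t j * (volume (B j)).toReal)
  have e : ∀ ω, ∑ j, t j * pointCount η (B j) ω + -∑ j, t j * (volume (B j)).toReal =
      ∑ j, t j * (pointCount η (B j) ω - (volume (B j)).toReal) := fun ω => by
    rw [← sub_eq_add_neg, ← Finset.sum_sub_distrib]
    exact Finset.sum_congr rfl fun j _ => by ring
  simp_rw [e] at h1 h2
  refine ⟨h1, _, h2, ?_, fun l hl => ?_⟩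
  · have hs := h2.succ 0
    simp only [Nat.cast_zero, zero_add, one_mul, Finset.sum_range_one, Nat.sub_zero, h2.zero,
      mul_one, if_true, pow_one, Nat.factorial_one, Nat.cast_one, div_one] at hs ⊢
    have hpi : ∀ j, Integrable (pointCount η (B j)) P := fun j => by
      simpa using hB.integrable_pointCount_pow hη (hBm j) (hUb.subset (hBU j)) 1
    have hpi' : ∀ j, Integrable (fun ω => t j * (pointCount η (B j) ω - (volume (B j)).toReal)) P :=
      fun j => ((hpi j).sub (integrable_const _)).const_mul _
    rw [← hs, integral_finsetSum _ fun j _ => hpi' j]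
    refine Finset.sum_eq_zero fun j _ => ?_
    rw [integral_const_mul, integral_sub (hpi j) (integrable_const _),
      hη.integral_pointCount hI (hBm j) (hUb.subset (hBU j))]
    simp
  · rw [if_neg (by omega), add_zero]
    exact hκb l

end

/-! ### The covariance of counts -/

section PairIntegral

variable {d : ℕ} (β : SignedMeasure (Space d))

/-- The total variation of `δ_0 + β`, up to a constant. -/
noncomputable def pairVariation : Measure (Space d) :=
  (Measure.dirac 0 + β.toJordanDecomposition.posPart) + β.toJordanDecomposition.negPart

instance : IsFiniteMeasure (pairVariation β) := by
  unfold pairVariation; infer_instance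

/-- The integral with respect to the signed measure `δ_0 + β`. -/
noncomputable def pairIntegral (h : Space d → ℝ) : ℝ :=
  ∫ x, h x ∂(Measure.dirac 0 + β.toJordanDecomposition.posPart) -
    ∫ x, h x ∂β.toJordanDecomposition.negPart

variable {β}

theorem integrable_pairVariation_iff {h : Space d → ℝ} : Integrable h (pairVariation β) ↔
    Integrable h (Measure.dirac 0 + β.toJordanDecomposition.posPart) ∧
      Integrable h β.toJordanDecomposition.negPart :=
  integrable_add_measure

theorem pairIntegral_add {f g : Space d → ℝ} (hf : Integrable f (pairVariation β))
    (hg : Integrable g (pairVariation β)) :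
    pairIntegral β (fun x => f x + g x) = pairIntegral β f + pairIntegral β g := by
  rw [integrable_pairVariation_iff] at hf hg
  rw [pairIntegral, integral_add hf.1 hg.1, integral_add hf.2 hg.2, pairIntegral, pairIntegral]
  ring

theorem pairIntegral_sub {f g : Space d → ℝ} (hf : Integrable f (pairVariation β))
    (hg : Integrable g (pairVariation β)) :
    pairIntegral β (fun x => f x - g x) = pairIntegral β f - pairIntegral β g := by
  rw [integrable_pairVariation_iff] at hf hg
  rw [pairIntegral, integral_sub hf.1 hg.1, integral_sub hf.2 hg.2, pairIntegral, pairIntegral]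
  ring

theorem pairIntegral_const_mul (c : ℝ) (f : Space d → ℝ) :
    pairIntegral β (fun x => c * f x) = c * pairIntegral β f := by
  simp only [pairIntegral, integral_const_mul]
  ring

theorem pairIntegral_finsetSum {ι : Type*} (s : Finset ι) {f : ι → Space d → ℝ}
    (hf : ∀ i, Integrable (f i) (pairVariation β)) :
    pairIntegral β (fun x => ∑ i ∈ s, f i x) = ∑ i ∈ s, pairIntegral β (f i) := by
  simp only [integrable_pairVariation_iff] at hf
  simp only [pairIntegral]
  rw [integral_finsetSum _ fun i _ => (hf i).1, integral_finsetSum _ fun i _ => (hf i).2,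
    Finset.sum_sub_distrib]

theorem tendsto_pairIntegral {ι : Type*} {l : Filter ι} [l.IsCountablyGenerated]
    {h : ι → Space d → ℝ} {h₀ : Space d → ℝ} (hm : ∀ n, Measurable (h n)) {b : Space d → ℝ}
    (hb : Integrable b (pairVariation β)) (hle : ∀ᶠ n in l, ∀ x, |h n x| ≤ b x)
    (hlim : ∀ x, Tendsto (fun n => h n x) l (𝓝 (h₀ x))) :
    Tendsto (fun n => pairIntegral β (h n)) l (𝓝 (pairIntegral β h₀)) := by
  rw [integrable_pairVariation_iff] at hb
  refine Tendsto.sub (tendsto_integral_filter_of_dominated_convergence b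
    (Eventually.of_forall fun n => (hm n).aestronglyMeasurable)
    (hle.mono fun n hn => ae_of_all _ hn) hb.1 (ae_of_all _ hlim))
    (tendsto_integral_filter_of_dominated_convergence b
    (Eventually.of_forall fun n => (hm n).aestronglyMeasurable)
    (hle.mono fun n hn => ae_of_all _ hn) hb.2 (ae_of_all _ hlim))

theorem integrable_pairVariation_of_bounded {h : Space d → ℝ} (hm : Measurable h) (C : ℝ)
    (hC : ∀ x, |h x| ≤ C) : Integrable h (pairVariation β) :=
  (integrable_const C).mono' hm.aestronglyMeasurable (ae_of_all _ hC)

end PairIntegral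

section Covariance

variable {Ω : Type*} [MeasurableSpace Ω] {P : Measure Ω} {d : ℕ} {η : Ω → Measure (Space d)}
  {β : SignedMeasure (Space d)}

theorem signedMeasure_apply_eq_sub (β : SignedMeasure (Space d)) {B : Set (Space d)}
    (hB : MeasurableSet B) : β B = (β.toJordanDecomposition.posPart B).toReal -
      (β.toJordanDecomposition.negPart B).toReal := by
  conv_lhs => rw [← β.toSignedMeasure_toJordanDecomposition]
  rw [JordanDecomposition.toSignedMeasure, sub_apply,
    Measure.toSignedMeasure_apply_measurable hB, Measure.toSignedMeasure_apply_measurable hB]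
  rfl

/-- The reduced second factorial moment measure, as a measure on `ℝ^d`. -/
theorem IsTruncatedPairCorrelation.exists_measure (hβ : IsTruncatedPairCorrelation P η β) :
    ∃ ρ : Measure (Space d), SigmaFinite ρ ∧
      ρ + β.toJordanDecomposition.negPart = volume + β.toJordanDecomposition.posPart ∧
      ∀ A B : Set (Space d), MeasurableSet A → MeasurableSet B →
        factorialMoment P η (Fin 2) {x | x 0 ∈ A ∧ x 1 ∈ B} =
          ∫⁻ x, volume {y | x + y ∈ A ∧ y ∈ B} ∂ρ := by
  classical
  obtain ⟨ρ, hρ, h⟩ := hβ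
  have hme : Measurable fun x : Fin 1 → Space d => x 0 := measurable_pi_apply 0
  have hsf : SigmaFinite (ρ.map fun x : Fin 1 → Space d => x 0) := by
    refine ⟨⟨⟨fun n => Metric.closedBall 0 n, fun _ => trivial, fun n => ?_,
      Metric.iUnion_closedBall_nat _⟩⟩⟩
    rw [Measure.map_apply hme Metric.isClosed_closedBall.measurableSet]
    exact (h _ Metric.isClosed_closedBall.measurableSet Metric.isBounded_closedBall).1
  refine ⟨ρ.map fun x => x 0, hsf, ?_, fun A B hA hB => ?_⟩
  · ext S hS
    -- Both sides may be infinite on `S`, and `β` is related to the moment measure only on bounded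
    -- sets, so the identity is checked on balls and passed to the limit.
    have hS' : S = ⋃ n : ℕ, S ∩ Metric.closedBall 0 n := by
      rw [← Set.inter_iUnion, Metric.iUnion_closedBall_nat, Set.inter_univ]
    have hmono : Monotone fun n : ℕ => S ∩ Metric.closedBall (0 : Space d) n := fun m n hmn =>
      Set.inter_subset_inter_right _ (Metric.closedBall_subset_closedBall (by exact_mod_cast hmn))
    rw [hS', hmono.measure_iUnion, hmono.measure_iUnion]
    refine iSup_congr fun n => ?_
    have hm := hS.inter (Metric.isClosed_closedBall (x := (0 : Space d)) (ε := n)).measurableSet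
    have hb : Bornology.IsBounded (S ∩ Metric.closedBall (0 : Space d) n) :=
      Metric.isBounded_closedBall.subset Set.inter_subset_right
    obtain ⟨h1, h2⟩ := h _ hm hb
    rw [signedMeasure_apply_eq_sub β hm] at h2
    rw [Measure.add_apply, Measure.add_apply, Measure.map_apply hme hm, Set.preimage,
      ← ENNReal.toReal_eq_toReal_iff' (by finiteness) 
        (ENNReal.add_lt_top.2 ⟨hb.measure_lt_top, measure_lt_top _ _⟩).ne,
      ENNReal.toReal_add h1.ne (measure_ne_top _ _), ENNReal.toReal_add
      hb.measure_lt_top.ne (measure_ne_top _ _)]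
    linarith
  · have hW : MeasurableSet {x : Fin 2 → Space d | x 0 ∈ A ∧ x 1 ∈ B} :=
      (measurable_pi_apply 0 hA).inter (measurable_pi_apply 1 hB)
    have hf := hρ (Set.indicator {x : Fin 2 → Space d | x 0 ∈ A ∧ x 1 ∈ B} 1)
      (measurable_one.indicator hW)
    rw [lintegral_indicator_one hW] at hf
    rw [hf]
    have hmS : Measurable fun x : Space d × Space d =>
        Set.indicator {z : Space d × Space d | z.1 + z.2 ∈ A ∧ z.2 ∈ B} (1 : Space d × Space d → ℝ≥0∞) x := by
      refine measurable_one.indicator ?_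
      exact (measurable_add hA).inter (measurable_snd hB)
    have e : ∀ (y : Space d) (x : Fin 1 → Space d),
        Set.indicator {x : Fin 2 → Space d | x 0 ∈ A ∧ x 1 ∈ B} (1 : (Fin 2 → Space d) → ℝ≥0∞) (shiftSnoc x y) =
        Set.indicator {z : Space d × Space d | z.1 + z.2 ∈ A ∧ z.2 ∈ B} 1 (x 0, y) := fun y x => by
      simp only [Set.indicator_apply, Set.mem_ofPred_eq]
      rfl
    have e2 : ∀ y : Space d, ∫⁻ x : Fin 1 → Space d,
        Set.indicator {z : Space d × Space d | z.1 + z.2 ∈ A ∧ z.2 ∈ B} (1 : Space d × Space d → ℝ≥0∞) (x 0, y) ∂ρ =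
        ∫⁻ x, Set.indicator {z : Space d × Space d | z.1 + z.2 ∈ A ∧ z.2 ∈ B} (1 : Space d × Space d → ℝ≥0∞) (x, y)
          ∂(ρ.map fun x => x 0) := fun y => by
      rw [lintegral_map (f := fun x => Set.indicator {z : Space d × Space d | z.1 + z.2 ∈ A ∧ z.2 ∈ B} (1 : Space d × Space d → ℝ≥0∞) (x, y))
        (hmS.comp measurable_prodMk_right) hme]
    refine (lintegral_congr fun y => (lintegral_congr fun x => e y x).trans (e2 y)).trans ?_
    rw [lintegral_lintegral_swap (f := fun y x => Set.indicator {z : Space d × Space d | z.1 + z.2 ∈ A ∧ z.2 ∈ B} (1 : Space d × Space d → ℝ≥0∞) (x, y)) (hmS.comp measurable_swap).aemeasurable]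
    refine lintegral_congr fun x => ?_
    have hx : MeasurableSet {y : Space d | x + y ∈ A ∧ y ∈ B} :=
      ((measurable_const_add x) hA).inter hB
    rw [← lintegral_indicator_one hx]
    rfl

/-- Pairs of points in `A × B` are either distinct or diagonal, the latter being the points of `A ∩
B`. The diagonal is the origin of the atom `δ_0` in `pairIntegral`. -/
theorem pointCount_mul_pointCount (hη : IsPointProcess η) {A B : Set (Space d)}
    (hA : MeasurableSet A) (hAb : Bornology.IsBounded A) (hB : MeasurableSet B)
    (hBb : Bornology.IsBounded B) (ω : Ω) :
    pointCount η A ω * pointCount η B ω =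
      distinctCount η ![A, B] ω + pointCount η (A ∩ B) ω := by
  classical
  obtain ⟨F, hF⟩ := hη.exists_points (hA.union hB) (hAb.union hBb)
  have hAB : ∀ i : Fin 2, MeasurableSet (![A, B] i) := fun i => by fin_cases i <;> assumption
  rw [pointCount_eq_card hA Set.subset_union_left hF, pointCount_eq_card hB Set.subset_union_right hF,
    pointCount_eq_card (hA.inter hB) (Set.inter_subset_left.trans Set.subset_union_left) hF,
    hη.distinctCount_eq hF hAB fun i => by fin_cases i <;> simp, ← Nat.cast_mul, ← Nat.cast_add,
    Nat.cast_inj, ← Finset.card_product]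
  have h1 : ((distinctTuples (Fin 2) (F ω)).filter fun x => ∀ i : Fin 2, x i ∈ ![A, B] i).card =
      ((((F ω).filter fun x => x ∈ A) ×ˢ ((F ω).filter fun x => x ∈ B)).filter
        fun z => ¬ z.1 = z.2).card := by
    refine Finset.card_bij (fun x _ => (x 0, x 1)) ?_ ?_ ?_
    · intro x hx
      simp only [Finset.mem_filter, mem_distinctTuples, Fin.forall_fin_two, Finset.mem_product,
        Matrix.cons_val_zero, Matrix.cons_val_one] at hx ⊢
      exact ⟨⟨⟨hx.1.1.1, hx.2.1⟩, hx.1.1.2, hx.2.2⟩, fun h => by simpa using hx.1.2 h⟩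
    · intro x _ y _ hxy
      ext1 i
      fin_cases i
      · exact congrArg Prod.fst hxy
      · exact congrArg Prod.snd hxy
    · rintro ⟨a, b⟩ hab
      simp only [Finset.mem_filter, Finset.mem_product] at hab
      refine ⟨![a, b], ?_, by simp⟩
      simp only [Finset.mem_filter, mem_distinctTuples, Fin.forall_fin_two,
        Matrix.cons_val_zero, Matrix.cons_val_one]
      refine ⟨⟨⟨hab.1.1.1, hab.1.2.1⟩, ?_⟩, hab.1.1.2, hab.1.2.2⟩
      intro i j hij
      fin_cases i <;> fin_cases j <;> first | rfl | exact (hab.2 hij).elim | exact (hab.2 hij.symm).elim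
  have h2 : ((F ω).filter fun x => x ∈ A ∩ B).card =
      ((((F ω).filter fun x => x ∈ A) ×ˢ ((F ω).filter fun x => x ∈ B)).filter
        fun z => z.1 = z.2).card := by
    refine Finset.card_bij (fun x _ => (x, x)) ?_ ?_ ?_
    · intro x hx
      simp only [Finset.mem_filter, Finset.mem_product, Set.mem_inter_iff] at hx ⊢
      tauto
    · intro x _ y _ hxy
      exact congrArg Prod.fst hxy
    · rintro ⟨a, b⟩ hab
      simp only [Finset.mem_filter, Finset.mem_product, Set.mem_inter_iff] at hab ⊢
      obtain ⟨h, rfl⟩ := hab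
      exact ⟨a, ⟨h.1.1, h.1.2, h.2.2⟩, rfl⟩
  rw [← Finset.card_filter_add_card_filter_not fun z : Space d × Space d => z.1 = z.2, ← h1, ← h2,
    add_comm]
  congr!

/-- With `g x` the volume of the set of `y ∈ B` such that `x + y ∈ A`, the second moment is `∫ g dρ
+ g 0`. The product of the means is the Lebesgue integral of `g`, which turns `ρ` into `β`. -/
theorem IsTruncatedPairCorrelation.covariance_pointCount [IsProbabilityMeasure P]
    (hβ : IsTruncatedPairCorrelation P η β) (hη : IsPointProcess η)
    (hB : IsBrillingerMixing P η) (hI : HasUnitIntensity P η) {A B : Set (Space d)}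
    (hAm : MeasurableSet A) (hAb : Bornology.IsBounded A) (hBm : MeasurableSet B)
    (hBb : Bornology.IsBounded B) :
    cov[pointCount η A, pointCount η B; P] =
      pairIntegral β fun x => (volume {y | x + y ∈ A ∧ y ∈ B}).toReal := by
  classical
  obtain ⟨ρ, hsf, hρ, h⟩ := hβ.exists_measure
  have hAB : ∀ i : Fin 2, MeasurableSet (![A, B] i) := fun i => by fin_cases i <;> assumption
  have hABb : ∀ i : Fin 2, Bornology.IsBounded (![A, B] i) := fun i => by
    fin_cases i <;> assumption
  set g : Space d → ℝ≥0∞ := fun x => volume {y | x + y ∈ A ∧ y ∈ B} with hg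
  have hmeas : MeasurableSet {z : Space d × Space d | z.1 + z.2 ∈ A ∧ z.2 ∈ B} :=
    (measurable_add hAm).inter (measurable_snd hBm)
  have hgm : Measurable g := measurable_measure_prodMk_left hmeas
  have hgle : ∀ x, g x ≤ volume B := fun x => measure_mono fun y hy => hy.2
  have hBfin := hBb.measure_lt_top (μ := (volume : Measure (Space d)))
  have hAfin := hAb.measure_lt_top (μ := (volume : Measure (Space d)))
  have hgfin : ∀ x, g x < ∞ := fun x => (hgle x).trans_lt hBfin
  have hvol : ∫⁻ x, g x = volume A * volume B := by
    have e : ∀ x : Space d, g x = ∫⁻ y, Set.indicator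
        {z : Space d × Space d | z.1 + z.2 ∈ A ∧ z.2 ∈ B} (1 : Space d × Space d → ℝ≥0∞) (x, y) := fun x => by
      have hx : MeasurableSet {y : Space d | x + y ∈ A ∧ y ∈ B} :=
        ((measurable_const_add x) hAm).inter hBm
      change volume {y : Space d | x + y ∈ A ∧ y ∈ B} = _
      rw [← lintegral_indicator_one hx]
      rfl
    simp_rw [e]
    rw [lintegral_lintegral_swap (f := fun x y => Set.indicator {z : Space d × Space d | z.1 + z.2 ∈ A ∧ z.2 ∈ B} (1 : Space d × Space d → ℝ≥0∞) (x, y)) (measurable_one.indicator hmeas).aemeasurable]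
    have e2 : ∀ y : Space d, ∫⁻ x, Set.indicator
        {z : Space d × Space d | z.1 + z.2 ∈ A ∧ z.2 ∈ B} (1 : Space d × Space d → ℝ≥0∞) (x, y) =
        Set.indicator B (fun _ => volume A) y := fun y => by
      by_cases hy : y ∈ B
      · rw [Set.indicator_of_mem hy, ← measure_preimage_add_right volume y A,
          ← lintegral_indicator_one ((measurable_add_const y) hAm)]
        refine lintegral_congr fun x => ?_
        simp [Set.indicator_apply, hy]
      · rw [Set.indicator_of_notMem hy]
        simp [hy]
    rw [lintegral_congr e2, lintegral_indicator hBm]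
    simp
  have hfm : ∫ ω, distinctCount η ![A, B] ω ∂P = (∫⁻ x, g x ∂ρ).toReal := by
    rw [← hη.factorialMomentReal_eq hAB hABb, factorialMomentReal, ← h A B hAm hBm]
    congr 2
    ext x
    simp [Set.mem_pi, Fin.forall_fin_two]
  have hfin : ∫⁻ x, g x ∂ρ < ∞ := by
    rw [← h A B hAm hBm]
    refine lt_of_le_of_lt (le_of_eq ?_) (hB.factorialMoment_pi_lt_top hη hAB hABb)
    congr 1
    ext x
    simp [Set.mem_pi, Fin.forall_fin_two]
  have hfinm : ∀ μ : Measure (Space d), IsFiniteMeasure μ → ∫⁻ x, g x ∂μ < ∞ := fun μ _ =>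
    (lintegral_mono hgle).trans_lt (by simpa using ENNReal.mul_lt_top hBfin (measure_lt_top _ _))
  have hkey := congrArg (fun μ : Measure (Space d) => (∫⁻ x, g x ∂μ).toReal) hρ
  simp only [lintegral_add_measure] at hkey
  rw [ENNReal.toReal_add hfin.ne (hfinm _ inferInstance).ne, hvol,
    ENNReal.toReal_add (ENNReal.mul_lt_top hAfin hBfin).ne (hfinm _ inferInstance).ne,
    ENNReal.toReal_mul] at hkey
  have hi : ∀ μ : Measure (Space d), ∫ x, (g x).toReal ∂μ = (∫⁻ x, g x ∂μ).toReal := fun μ =>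
    integral_toReal hgm.aemeasurable (ae_of_all _ hgfin)
  have hgi : ∀ μ : Measure (Space d), IsFiniteMeasure μ → Integrable (fun x => (g x).toReal) μ :=
    fun μ hμ => integrable_toReal_of_lintegral_ne_top hgm.aemeasurable (hfinm μ hμ).ne
  have hpc : ∀ {S : Set (Space d)}, MeasurableSet S → Bornology.IsBounded S →
      Integrable (pointCount η S) P := fun hS hSb => by
    simpa using hB.integrable_pointCount_pow hη hS hSb 1
  have h0 : g 0 = volume (A ∩ B) := by
    simp only [hg, zero_add]
    rfl
  rw [covariance_eq_sub (hB.memLp_pointCount hη hAm hAb) (hB.memLp_pointCount hη hBm hBb),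
    hη.integral_pointCount hI hAm hAb, hη.integral_pointCount hI hBm hBb, pairIntegral,
    integral_add_measure (hgi _ inferInstance) (hgi _ inferInstance), integral_dirac, hi, hi, h0]
  have e3 : ∫ ω, (pointCount η A * pointCount η B) ω ∂P =
      (∫⁻ x, g x ∂ρ).toReal + (volume (A ∩ B)).toReal := by
    rw [← hfm, ← hη.integral_pointCount hI (hAm.inter hBm) (hAb.subset Set.inter_subset_left),
      ← integral_add (hB.integrable_distinctCount hη hAB hABb)
      (hpc (hAm.inter hBm) (hAb.subset Set.inter_subset_left))]
    refine integral_congr_ae (ae_of_all _ fun ω => ?_)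
    exact pointCount_mul_pointCount hη hAm hAb hBm hBb ω
  rw [e3]
  linarith

end Covariance

/-! ### Tent functions and boxes -/

/-- The length of the intersection of two intervals of length `n` whose left ends differ by `s`. -/
noncomputable def tent (n s : ℝ) : ℝ := max (n - |s|) 0

theorem tent_nonneg (n s : ℝ) : 0 ≤ tent n s := le_max_right _ _

theorem tent_le {n : ℝ} (hn : 0 ≤ n) (s : ℝ) : tent n s ≤ n :=
  max_le (by linarith [abs_nonneg s]) hn

theorem abs_tent_le {n : ℝ} (hn : 0 ≤ n) (s : ℝ) : |tent n s| ≤ n := by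
  rw [abs_of_nonneg (tent_nonneg n s)]; exact tent_le hn s

theorem tent_neg (n s : ℝ) : tent n (-s) = tent n s := by simp [tent]

theorem tent_mul {n : ℝ} (hn : 0 ≤ n) (m s : ℝ) : tent (n * m) (n * s) = n * tent m s := by
  rw [tent, tent, abs_mul, abs_of_nonneg hn, mul_max_of_nonneg _ _ hn]
  ring_nf

theorem tent_zero (s : ℝ) : tent 0 s = 0 := by simp [tent]

/-- A tent is half a second difference of the absolute value. The telescoping and second-difference
identities below come from this. -/
theorem two_mul_tent {n : ℝ} (hn : 0 ≤ n) (s : ℝ) :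
    2 * tent n s = |s - n| + |s + n| - 2 * |s| := by
  unfold tent
  rcases abs_cases s with ⟨h1, h1'⟩ | ⟨h1, h1'⟩ <;>
  rcases abs_cases (s - n) with ⟨h2, h2'⟩ | ⟨h2, h2'⟩ <;>
  rcases abs_cases (s + n) with ⟨h3, h3'⟩ | ⟨h3, h3'⟩ <;>
  rcases max_cases (n - |s|) 0 with ⟨h4, h4'⟩ | ⟨h4, h4'⟩ <;>
  rw [h4] <;> linarith

theorem abs_tent_sub_tent_le (n s t : ℝ) : |tent n s - tent n t| ≤ |s - t| := by
  refine (abs_max_sub_max_le_abs _ _ _).trans ?_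
  rw [show n - |s| - (n - |t|) = |t| - |s| by ring, abs_sub_comm s t]
  exact abs_abs_sub_abs_le _ _

theorem continuous_tent (n : ℝ) : Continuous (tent n) := by
  unfold tent; fun_prop

@[fun_prop]
theorem measurable_tent (n : ℝ) : Measurable (tent n) := (continuous_tent n).measurable

/-- For large `n` all three arguments lie where the tent is `n - |·|`, so `n` cancels and a fixed
narrow tent remains. -/
theorem tent_second_difference {n t s : ℝ} (ht : 0 ≤ t) (hn : |s| + t ≤ n) :
    2 * tent n s - tent n (s - t) - tent n (s + t) = 2 * tent t s := by
  have h1 : |s - t| ≤ n := (abs_sub s t).trans (by rwa [abs_of_nonneg ht])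
  have h2 : |s + t| ≤ n := (abs_add_le s t).trans (by rwa [abs_of_nonneg ht])
  rw [two_mul_tent ht, tent, tent, tent, max_eq_left (by linarith), max_eq_left (by linarith),
    max_eq_left (by linarith)]
  ring

theorem tendsto_tent_div (s : ℝ) : Tendsto (fun n => tent n s / n) atTop (𝓝 1) := by
  have h : Tendsto (fun n : ℝ => 1 - |s| / n) atTop (𝓝 (1 - 0)) :=
    tendsto_const_nhds.sub (tendsto_const_nhds.div_atTop tendsto_id)
  rw [sub_zero] at h
  refine h.congr' ?_
  filter_upwards [eventually_gt_atTop 0, eventually_ge_atTop |s|] with n hn hns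
  rw [tent, max_eq_left (by linarith)]
  field_simp

section Box

variable {d : ℕ}

theorem measurableSet_box (z : Space d) (n : ℝ) : MeasurableSet (box z n) := by
  have : box z n = ⋂ i, {x : Space d | z i ≤ x i ∧ x i ≤ z i + n} := by
    ext x; simp [box]
  rw [this]
  refine MeasurableSet.iInter fun i => ?_
  have hm : Measurable fun x : Space d => x i := by fun_prop
  exact (measurableSet_le measurable_const hm).inter (measurableSet_le hm measurable_const)

theorem isBounded_box (z : Space d) (n : ℝ) : Bornology.IsBounded (box z n) := by
  have h : Bornology.IsBounded (Set.pi Set.univ fun i => Set.Icc (z i) (z i + n)) :=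
    Bornology.IsBounded.pi fun i => Metric.isBounded_Icc _ _
  have h2 := (PiLp.lipschitzWith_toLp 2 fun _ : Fin d => ℝ).isBounded_image h
  refine h2.subset fun x hx => ⟨x.ofLp, fun i _ => hx i, rfl⟩

theorem volume_box_inter (z w x : Space d) (n : ℝ) :
    (volume {y : Space d | x + y ∈ box z n ∧ y ∈ box w n}).toReal =
      ∏ i, tent n ((z - w) i - x i) := by
  have e : {y : Space d | x + y ∈ box z n ∧ y ∈ box w n} = (WithLp.ofLp : Space d → Fin d → ℝ) ⁻¹'
      Set.pi Set.univ fun i => Set.Icc (max (z i - x i) (w i)) (min (z i - x i + n) (w i + n)) := by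
    ext y
    simp only [box, Set.mem_ofPred_eq, Set.mem_preimage, Set.mem_pi, Set.mem_univ, true_imp_iff,
      Set.mem_Icc, max_le_iff, le_min_iff, PiLp.add_apply, ← forall_and]
    refine forall_congr' fun i => ?_
    constructor
    · rintro ⟨⟨h1, h2⟩, h3, h4⟩
      exact ⟨⟨by linarith, h3⟩, by linarith, h4⟩
    · rintro ⟨⟨h1, h3⟩, h2, h4⟩
      exact ⟨⟨by linarith, by linarith⟩, h3, h4⟩
  rw [e, (PiLp.volume_preserving_ofLp (Fin d)).measure_preimage
    (MeasurableSet.univ_pi fun i => measurableSet_Icc).nullMeasurableSet, volume_pi_pi,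
    ENNReal.toReal_prod]
  refine Finset.prod_congr rfl fun i _ => ?_
  rw [Real.volume_Icc, ENNReal.toReal_ofReal', tent]
  congr 1
  rw [PiLp.sub_apply]
  rcases le_total (z i - x i) (w i) with h | h
  · rw [min_eq_left (by linarith), max_eq_right h, abs_of_nonpos (by linarith)]
    ring
  · rw [min_eq_right (by linarith), max_eq_left h, abs_of_nonneg (by linarith)]
    ring

/-- The covariance of the counts of two boxes of side length `n` whose corners differ by `u`. -/
noncomputable def boxCov (β : SignedMeasure (Space d)) (n : ℝ) (u : Space d) : ℝ :=
  pairIntegral β fun x => ∏ i, tent n (u i - x i)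

theorem abs_prod_le_pow {ι : Type*} (s : Finset ι) {f : ι → ℝ} {c : ℝ} (h : ∀ i, |f i| ≤ c) :
    |∏ i ∈ s, f i| ≤ c ^ s.card := by
  rw [Finset.abs_prod, ← Finset.prod_const]
  exact Finset.prod_le_prod (fun i _ => abs_nonneg _) fun i _ => h i

variable {Ω : Type*} [MeasurableSpace Ω] {P : Measure Ω} [IsProbabilityMeasure P]
  {η : Ω → Measure (Space d)} {β : SignedMeasure (Space d)}

theorem covariance_box (hη : IsStationaryHyperuniform P η) (hβ : IsTruncatedPairCorrelation P η β)
    (hB : IsBrillingerMixing P η) (n : ℝ) (z w : Space d) :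
    cov[pointCount η (box z n), pointCount η (box w n); P] = boxCov β n (z - w) := by
  rw [hβ.covariance_pointCount hη.pointProcess hB hη.unitIntensity (measurableSet_box _ _)
    (isBounded_box _ _) (measurableSet_box _ _) (isBounded_box _ _), boxCov]
  simp_rw [volume_box_inter z w]

theorem variance_box (hη : IsStationaryHyperuniform P η) (hβ : IsTruncatedPairCorrelation P η β)
    (hB : IsBrillingerMixing P η) (n : ℝ) (z : Space d) :
    Var[pointCount η (box z n); P] = boxCov β n 0 := by
  rw [← covariance_self (hη.pointProcess.measurable_pointCount (measurableSet_box _ _)).aemeasurable,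
    covariance_box hη hβ hB n, sub_self]

/-- Symmetry of the covariance. It replaces, for tents, a reflection symmetry of `β`, which
dimension one does not assume. -/
theorem boxCov_neg (hη : IsStationaryHyperuniform P η) (hβ : IsTruncatedPairCorrelation P η β)
    (hB : IsBrillingerMixing P η) (n : ℝ) (u : Space d) :
    boxCov β n (-u) = boxCov β n u := by
  have h := covariance_box hη hβ hB n 0 u
  rw [covariance_comm, covariance_box hη hβ hB n] at h
  simpa using h.symm

/-- The variance of the sum of the two counts is nonnegative. -/
theorem neg_boxCov_zero_le (hη : IsStationaryHyperuniform P η)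
    (hβ : IsTruncatedPairCorrelation P η β) (hB : IsBrillingerMixing P η) (n : ℝ)
    (u : Space d) : -boxCov β n 0 ≤ boxCov β n u := by
  have hm : ∀ z : Space d, MemLp (pointCount η (box z n)) 2 P := fun z =>
    hB.memLp_pointCount hη.pointProcess (measurableSet_box _ _) (isBounded_box _ _)
  have h := variance_add (hm u) (hm 0)
  rw [variance_box hη hβ hB n, variance_box hη hβ hB n, covariance_box hη hβ hB n, sub_zero] at h
  have := variance_nonneg (pointCount η (box u n) + pointCount η (box 0 n)) P
  linarith

/-- By dominated convergence `Var / n^d` tends to the total mass of `δ_0 + β`, and hyperuniformity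
makes this limit zero. -/
theorem pairIntegral_one (hη : IsStationaryHyperuniform P η)
    (hβ : IsTruncatedPairCorrelation P η β) (hB : IsBrillingerMixing P η) :
    pairIntegral β (fun _ => 1) = 0 := by
  refine tendsto_nhds_unique ?_ hη.hyperuniform
  have e : ∀ᶠ n : ℝ in atTop, Var[pointCount η (box 0 n); P] / n ^ d =
      pairIntegral β fun x => ∏ i, (tent n (0 - x i) / n) := by
    filter_upwards [eventually_gt_atTop 0] with n hn
    rw [variance_box hη hβ hB, boxCov, div_eq_inv_mul, ← pairIntegral_const_mul]
    congr 1
    ext x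
    rw [Finset.prod_div_distrib, Finset.prod_const, Finset.card_univ, Fintype.card_fin]
    simp [div_eq_inv_mul]
  rw [tendsto_congr' e]
  refine tendsto_pairIntegral (fun n => by fun_prop) (b := fun _ => 1) (integrable_const _) ?_
    fun x => ?_
  · filter_upwards [eventually_gt_atTop 0] with n hn x
    refine (abs_prod_le_pow (c := 1) Finset.univ fun i => ?_).trans_eq (one_pow _)
    rw [abs_div, abs_of_pos hn]
    exact (div_le_one hn).2 (abs_tent_le hn.le _)
  · rw [← Finset.prod_const_one (s := (Finset.univ : Finset (Fin d)))]
    exact tendsto_finsetProd _ fun i _ => tendsto_tent_div _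

end Box

/-! ### A lower bound for the variance -/

section VarianceLowerBound

variable {Ω : Type*} [MeasurableSpace Ω] {P : Measure Ω} [IsProbabilityMeasure P] {d : ℕ}
  {η : Ω → Measure (Space d)} {β : SignedMeasure (Space d)}

-- The hyperplane is a Lebesgue null set, so there `β` coincides with the nonnegative reduced moment
-- measure; the atom at the origin contributes one.
omit [IsProbabilityMeasure P] in
theorem one_le_pairIntegral_hyperplane (hβ : IsTruncatedPairCorrelation P η β) (i₀ : Fin d) :
    1 ≤ pairIntegral β (Set.indicator {x | x i₀ = 0} 1) := by
  obtain ⟨ρ, -, hρ, -⟩ := hβ.exists_measure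
  have hm : MeasurableSet {x : Space d | x i₀ = 0} :=
    measurableSet_eq_fun (by fun_prop) measurable_const
  have h0 : (volume : Measure (Space d)) {x | x i₀ = 0} = 0 := by
    let S : Submodule ℝ (Space d) := LinearMap.ker ((EuclideanSpace.proj i₀ : Space d →L[ℝ] ℝ) : Space d →ₗ[ℝ] ℝ)
    have hS : S ≠ ⊤ := by
      intro h
      have : EuclideanSpace.single i₀ (1 : ℝ) ∈ S := by rw [h]; trivial
      simp [S] at this
    exact Measure.addHaar_submodule volume S hS
  have h1 := congrArg (fun μ : Measure (Space d) => μ {x | x i₀ = 0}) hρ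
  simp only [Measure.add_apply, h0, zero_add] at h1
  have h2 : (β.toJordanDecomposition.negPart {x | x i₀ = 0}).toReal ≤
      (β.toJordanDecomposition.posPart {x | x i₀ = 0}).toReal :=
    ENNReal.toReal_mono (measure_ne_top _ _) (h1 ▸ le_add_self)
  rw [pairIntegral, integral_indicator_one hm, integral_indicator_one hm, measureReal_def,
    measureReal_def, Measure.add_apply, ENNReal.toReal_add (measure_ne_top _ _)
    (measure_ne_top _ _), Measure.dirac_apply' _ hm]
  simp only [Set.indicator_apply, Set.mem_ofPred_eq, PiLp.zero_apply, if_true, Pi.one_apply,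
    ENNReal.toReal_one]
  linarith

-- As `t` decreases to zero, `tent t / t` converges boundedly to the indicator of the hyperplane,
-- whose integral is at least one.
omit [IsProbabilityMeasure P] in
theorem exists_pairIntegral_tent_pos (hβ : IsTruncatedPairCorrelation P η β) (i₀ : Fin d) :
    ∃ t, 0 < t ∧ 0 < pairIntegral β fun x => tent t (x i₀) := by
  have h : Tendsto (fun t : ℝ => pairIntegral β fun x => t⁻¹ * tent t (x i₀)) (𝓝[>] 0)
      (𝓝 (pairIntegral β (Set.indicator {x | x i₀ = 0} 1))) := by
    refine tendsto_pairIntegral (fun t => by fun_prop) (b := fun _ => 1) (integrable_const _)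
      ?_ fun x => ?_
    · filter_upwards [self_mem_nhdsWithin] with t ht x
      have ht' : (0 : ℝ) < t := ht
      rw [abs_mul, abs_inv, abs_of_pos ht', inv_mul_le_iff₀ ht', mul_one]
      exact abs_tent_le ht'.le _
    · by_cases hx : x i₀ = 0
      · rw [Set.indicator_of_mem (by exact hx)]
        refine tendsto_const_nhds.congr' ?_
        filter_upwards [self_mem_nhdsWithin] with t ht
        have ht' : (0 : ℝ) < t := ht
        rw [hx, tent, abs_zero, sub_zero, max_eq_left ht'.le, inv_mul_cancel₀ ht'.ne']
        rfl
      · rw [Set.indicator_of_notMem (by exact hx)]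
        refine tendsto_const_nhds.congr' ?_
        filter_upwards [nhdsWithin_le_nhds (gt_mem_nhds (abs_pos.2 hx))] with t ht
        rw [tent, max_eq_right (by linarith), mul_zero]
  have h1 := one_le_pairIntegral_hyperplane hβ i₀
  obtain ⟨t, ht1, ht2⟩ := ((h.eventually_const_lt (zero_lt_one.trans_le h1)).and
    self_mem_nhdsWithin).exists
  have ht' : (0 : ℝ) < t := ht2
  refine ⟨t, ht', ?_⟩
  rw [pairIntegral_const_mul] at ht1
  exact pos_of_mul_pos_right ht1 (by positivity)

theorem integrable_prod_tent {ι : Type*} (s : Finset ι) (r : ι → ℝ) (g : ι → Space d → ℝ)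
    (hg : ∀ i, Measurable (g i)) :
    Integrable (fun x => ∏ i ∈ s, tent (r i) (g i x)) (pairVariation β) := by
  refine integrable_pairVariation_of_bounded (by fun_prop) (∏ i ∈ s, |r i|) fun x => ?_
  rw [Finset.abs_prod]
  refine Finset.prod_le_prod (fun i _ => abs_nonneg _) fun i _ => ?_
  rcases le_total 0 (r i) with h | h
  · rw [abs_of_nonneg h]
    exact abs_tent_le h _
  · rw [tent, max_eq_right (by linarith [abs_nonneg (g i x)])]
    simp

/-- Compare the box with its translates by `±t` in direction `i₀`. The second difference of the
covariance, divided by `n^(d-1)`, converges to twice the integral of a narrow tent in that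
coordinate, which is positive for a suitable `t`. -/
theorem exists_variance_lower_bound (hη : IsStationaryHyperuniform P η)
    (hβ : IsTruncatedPairCorrelation P η β) (hB : IsBrillingerMixing P η) (i₀ : Fin d) :
    ∃ c, 0 < c ∧ ∀ᶠ n : ℝ in atTop, c * n ^ (d - 1) ≤ boxCov β n 0 := by
  obtain ⟨t, ht, hpos⟩ := exists_pairIntegral_tent_pos hβ i₀
  set u : Space d := EuclideanSpace.single i₀ t with hu
  set s : Finset (Fin d) := Finset.univ.erase i₀ with hs
  have hcard : s.card = d - 1 := by simp [hs]
  set f : ℝ → Space d → ℝ := fun n x =>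
    (2 * tent n (x i₀) - tent n (x i₀ - t) - tent n (x i₀ + t)) * ∏ i ∈ s, tent n (x i) / n with hf
  have e : ∀ᶠ n : ℝ in atTop, pairIntegral β (f n) =
      (2 * boxCov β n 0 - boxCov β n u - boxCov β n (-u)) / n ^ (d - 1) := by
    filter_upwards [eventually_gt_atTop 0] with n hn
    have hi : ∀ v : Space d, Integrable (fun x : Space d => ∏ i, tent n (v i - x i))
        (pairVariation β) := fun v => integrable_prod_tent _ (fun _ => n) _ fun i => by fun_prop
    have hi2 : Integrable (fun x : Space d => 2 * ∏ i, tent n ((0 : Space d) i - x i) -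
        ∏ i, tent n (u i - x i)) (pairVariation β) := ((hi 0).const_mul 2).sub (hi u)
    rw [boxCov, boxCov, boxCov, ← pairIntegral_const_mul, ← pairIntegral_sub ((hi 0).const_mul 2)
      (hi u), ← pairIntegral_sub hi2 (hi _), div_eq_inv_mul,
      ← pairIntegral_const_mul]
    congr 1
    ext x
    have hp : ∀ v : Space d, (∀ i ≠ i₀, v i = 0) → ∏ i, tent n (v i - x i) =
        tent n (v i₀ - x i₀) * ∏ i ∈ s, tent n (x i) := fun v hv => by
      rw [← Finset.mul_prod_erase _ _ (Finset.mem_univ i₀)]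
      congr 1
      refine Finset.prod_congr rfl fun i hi => ?_
      rw [hv i (Finset.ne_of_mem_erase hi), zero_sub, tent_neg]
    rw [hp 0 (by simp), hp u (fun i hi => by simp [hu, hi]), hp (-u) (fun i hi => by simp [hu, hi])]
    simp only [hf, Finset.prod_div_distrib, Finset.prod_const, hcard, hu, PiLp.zero_apply, zero_sub,
      tent_neg, PiLp.neg_apply, PiLp.single_apply, if_true]
    rw [show t - x i₀ = -(x i₀ - t) by ring, show -t - x i₀ = -(x i₀ + t) by ring, tent_neg,
      tent_neg]
    field_simp
  have hlim : Tendsto (fun n => pairIntegral β (f n)) atTop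
      (𝓝 (pairIntegral β fun x => 2 * tent t (x i₀))) := by
    refine tendsto_pairIntegral (fun n => by fun_prop) (b := fun _ => 2 * t) (integrable_const _)
      ?_ fun x => ?_
    · filter_upwards [eventually_gt_atTop 0] with n hn x
      have h1 : |∏ i ∈ s, tent n (x i) / n| ≤ 1 := by
        refine (abs_prod_le_pow (c := 1) s fun i => ?_).trans_eq (one_pow _)
        rw [abs_div, abs_of_pos hn]
        exact (div_le_one hn).2 (abs_tent_le hn.le _)
      have h2 : |2 * tent n (x i₀) - tent n (x i₀ - t) - tent n (x i₀ + t)| ≤ 2 * t := by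
        have h3 := abs_tent_sub_tent_le n (x i₀) (x i₀ - t)
        have h4 := abs_tent_sub_tent_le n (x i₀) (x i₀ + t)
        rw [sub_sub_cancel, abs_of_pos ht, abs_le] at h3
        rw [sub_add_cancel_left, abs_neg, abs_of_pos ht, abs_le] at h4
        rw [abs_le]
        constructor <;> linarith
      rw [hf, abs_mul]
      calc _ ≤ 2 * t * 1 := mul_le_mul h2 h1 (abs_nonneg _) (by positivity)
        _ = 2 * t := mul_one _
    · have h1 : Tendsto (fun n => ∏ i ∈ s, tent n (x i) / n) atTop (𝓝 1) := by
        rw [← Finset.prod_const_one (s := s)]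
        exact tendsto_finsetProd _ fun i _ => tendsto_tent_div _
      have h2 : Tendsto (fun n => 2 * tent n (x i₀) - tent n (x i₀ - t) - tent n (x i₀ + t)) atTop
          (𝓝 (2 * tent t (x i₀))) := by
        refine tendsto_const_nhds.congr' ?_
        filter_upwards [eventually_ge_atTop (|x i₀| + t)] with n hn
        exact (tent_second_difference ht.le hn).symm
      have h3 := h2.mul h1
      rw [mul_one] at h3
      exact h3
  rw [pairIntegral_const_mul] at hlim
  -- Since `-Cov ≤ Var`, the second difference is at most four times the variance, whence the
  -- divisor.
  refine ⟨pairIntegral β (fun x => tent t (x i₀)) / 4, by positivity, ?_⟩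
  have hlt : pairIntegral β (fun x => tent t (x i₀)) < 2 * pairIntegral β (fun x => tent t (x i₀)) := by
    linarith
  filter_upwards [e, hlim.eventually_const_lt hlt, eventually_gt_atTop 0] with n he hn hn0
  rw [he, lt_div_iff₀ (by positivity)] at hn
  have h1 := neg_boxCov_zero_le hη hβ hB n u
  rw [boxCov_neg hη hβ hB n u] at hn
  linarith

end VarianceLowerBound

/-! ### The limit covariance in the integrable case -/

/-- Convex functions have one-sided derivatives; the kinks of the tent rule out two-sided ones. -/
theorem exists_hasDerivWithinAt_abs (a b : ℝ) :
    ∃ c, HasDerivWithinAt (fun ε : ℝ => |a - ε * b|) c (Set.Ioi 0) 0 := by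
  have hc : ConvexOn ℝ Set.univ fun ε : ℝ => |a - ε * b| := by
    refine ⟨convex_univ, fun x _ y _ s t hs ht hst => ?_⟩
    have e : a - (s * x + t * y) * b = s * (a - x * b) + t * (a - y * b) := by
      linear_combination (-a) * hst
    simp only [smul_eq_mul]
    rw [e]
    refine (abs_add_le _ _).trans_eq ?_
    rw [abs_mul, abs_mul, abs_of_nonneg hs, abs_of_nonneg ht]
  exact ⟨_, (hc.differentiableWithinAt_Ioi_of_mem_interior (by simp)).hasDerivWithinAt⟩

theorem exists_hasDerivWithinAt_tent (a b : ℝ) :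
    ∃ c, HasDerivWithinAt (fun ε : ℝ => tent 1 (a - ε * b)) c (Set.Ioi 0) 0 := by
  obtain ⟨c₁, h₁⟩ := exists_hasDerivWithinAt_abs (a - 1) b
  obtain ⟨c₂, h₂⟩ := exists_hasDerivWithinAt_abs (a + 1) b
  obtain ⟨c₃, h₃⟩ := exists_hasDerivWithinAt_abs a b
  refine ⟨_, (((h₁.add h₂).sub (h₃.const_mul 2)).div_const 2).congr_of_eventuallyEq
    (Eventually.of_forall fun ε => ?_) ?_⟩
  · have := two_mul_tent zero_le_one (a - ε * b)
    simp only [Pi.add_apply, Pi.sub_apply]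
    rw [show a - 1 - ε * b = a - ε * b - 1 by ring, show a + 1 - ε * b = a - ε * b + 1 by ring]
    linarith
  · have := two_mul_tent zero_le_one (a - 0 * b)
    simp only [Pi.add_apply, Pi.sub_apply]
    rw [show a - 1 - 0 * b = a - 0 * b - 1 by ring, show a + 1 - 0 * b = a - 0 * b + 1 by ring]
    linarith

/-- This is a right difference quotient at zero with increment `1/n`. -/
theorem exists_tendsto_mul_prod_tent_sub {ι : Type*} (s : Finset ι) (a b : ι → ℝ) :
    ∃ c, Tendsto (fun n : ℝ => n * (∏ i ∈ s, tent 1 (a i - n⁻¹ * b i) - ∏ i ∈ s, tent 1 (a i)))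
      atTop (𝓝 c) := by
  classical
  choose c hc using fun i => exists_hasDerivWithinAt_tent (a i) (b i)
  have h := HasDerivWithinAt.fun_finsetProd (u := s) fun i _ => hc i
  rw [hasDerivWithinAt_iff_tendsto_slope' (by simp)] at h
  refine ⟨_, (h.comp tendsto_inv_atTop_nhdsGT_zero).congr' ?_⟩
  filter_upwards [eventually_gt_atTop 0] with n hn
  simp [slope_def_field, div_eq_mul_inv, mul_comm]

theorem abs_prod_sub_prod_le {ι : Type*} (s : Finset ι) {f g : ι → ℝ} (hf : ∀ i, |f i| ≤ 1)
    (hg : ∀ i, |g i| ≤ 1) : |∏ i ∈ s, f i - ∏ i ∈ s, g i| ≤ ∑ i ∈ s, |f i - g i| := by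
  classical
  induction s using Finset.induction_on with
  | empty => simp
  | insert i s hi ih =>
    rw [Finset.prod_insert hi, Finset.prod_insert hi, Finset.sum_insert hi]
    have h1 : |∏ i ∈ s, f i| ≤ 1 := (abs_prod_le_pow s hf).trans_eq (one_pow _)
    calc _ = |(f i - g i) * ∏ i ∈ s, f i + g i * (∏ i ∈ s, f i - ∏ i ∈ s, g i)| := by ring_nf
      _ ≤ |f i - g i| * |∏ i ∈ s, f i| + |g i| * |∏ i ∈ s, f i - ∏ i ∈ s, g i| := by
        rw [← abs_mul, ← abs_mul]; exact abs_add_le _ _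
      _ ≤ |f i - g i| * 1 + 1 * ∑ i ∈ s, |f i - g i| :=
        add_le_add (mul_le_mul_of_nonneg_left h1 (abs_nonneg _))
          (mul_le_mul (hg i) ih (abs_nonneg _) zero_le_one)
      _ = _ := by ring

/-- The normalized covariances of boxes converge to `K`, and the variance grows at least like a
positive power. -/
structure HasBoxCovLimit {d : ℕ} (β : SignedMeasure (Space d)) (K : Space d → ℝ) : Prop where
  tendsto : ∀ u : Space d,
    Tendsto (fun n : ℝ => boxCov β n (n • u) / boxCov β n 0) atTop (𝓝 (K u))
  growth : ∃ c δ : ℝ, 0 < c ∧ 0 < δ ∧ ∀ᶠ n : ℝ in atTop, c * n ^ δ ≤ boxCov β n 0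

section

variable {Ω : Type*} [MeasurableSpace Ω] {P : Measure Ω} [IsProbabilityMeasure P] {d : ℕ}
  {η : Ω → Measure (Space d)} {β : SignedMeasure (Space d)}

theorem exists_growth_of_two_le (hd : 2 ≤ d) (hη : IsStationaryHyperuniform P η)
    (hβ : IsTruncatedPairCorrelation P η β) (hB : IsBrillingerMixing P η) :
    ∃ c δ : ℝ, 0 < c ∧ 0 < δ ∧ ∀ᶠ n : ℝ in atTop, c * n ^ δ ≤ boxCov β n 0 := by
  obtain ⟨c, hc, h⟩ := exists_variance_lower_bound hη hβ hB ⟨0, by omega⟩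
  refine ⟨c, ((d - 1 : ℕ) : ℝ), hc, by simp; omega, ?_⟩
  simpa only [Real.rpow_natCast] using h

/-- Rescaling by `n` gives `n^d` times the integral of `∏ tent 1 (u_i - x_i/n)`. The constant `∏
tent 1 (u_i)` may be subtracted because the total mass is zero. After multiplication by `n` the
difference is dominated by `d ‖x‖` and converges, so covariances are of order `n^(d-1)`; the lower
bound on the variance makes the limiting denominator positive. -/
theorem exists_hasBoxCovLimit_of_integrable (hd : 2 ≤ d) (hη : IsStationaryHyperuniform P η)
    (hβ : IsTruncatedPairCorrelation P η β) (hB : IsBrillingerMixing P η)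
    (hint : Integrable (fun y : Space d => ‖y‖) β.totalVariation) :
    ∃ K, HasBoxCovLimit β K := by
  have hint' : Integrable (fun y : Space d => d * ‖y‖) (pairVariation β) := by
    rw [SignedMeasure.totalVariation, integrable_add_measure] at hint
    exact ((((integrable_dirac (by simp)).add_measure hint.1).add_measure hint.2)).const_mul _
  choose c hc using fun u x : Space d => exists_tendsto_mul_prod_tent_sub Finset.univ u x
  have hlim : ∀ u : Space d, Tendsto (fun n : ℝ => boxCov β n (n • u) / n ^ (d - 1)) atTop
      (𝓝 (pairIntegral β (c u))) := fun u => by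
    have h1 : Tendsto (fun n : ℝ => pairIntegral β fun x =>
        n * (∏ i, tent 1 (u i - n⁻¹ * x i) - ∏ i, tent 1 (u i))) atTop
        (𝓝 (pairIntegral β (c u))) := by
      refine tendsto_pairIntegral (fun n => by fun_prop) hint' ?_ (hc u)
      filter_upwards [eventually_gt_atTop 0] with n hn x
      rw [abs_mul, abs_of_pos hn]
      calc _ ≤ n * ∑ i, |tent 1 (u i - n⁻¹ * x i) - tent 1 (u i)| :=
            mul_le_mul_of_nonneg_left (abs_prod_sub_prod_le _
              (fun i => abs_tent_le zero_le_one _) fun i => abs_tent_le zero_le_one _) hn.le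
        _ ≤ n * ∑ i : Fin d, n⁻¹ * ‖x‖ := by
            refine mul_le_mul_of_nonneg_left (Finset.sum_le_sum fun i _ => ?_) hn.le
            refine (abs_tent_sub_tent_le _ _ _).trans ?_
            rw [sub_sub_cancel_left, abs_neg, abs_mul, abs_inv, abs_of_pos hn]
            exact mul_le_mul_of_nonneg_left (PiLp.norm_apply_le x i) (by positivity)
        _ = d * ‖x‖ := by
            simp
            field_simp
    refine h1.congr' ?_
    filter_upwards [eventually_gt_atTop 0] with n hn
    have hi : Integrable (fun x : Space d => ∏ i, tent 1 (u i - n⁻¹ * x i)) (pairVariation β) :=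
      integrable_prod_tent _ (fun _ => 1) _ fun i => by fun_prop
    have hconst : pairIntegral β (fun _ => ∏ i, tent 1 (u i)) = 0 := by
      have := pairIntegral_const_mul (β := β) (∏ i, tent 1 (u i)) fun _ => 1
      rwa [pairIntegral_one hη hβ hB, mul_zero, funext fun x => mul_one _] at this
    rw [pairIntegral_const_mul, pairIntegral_sub hi (integrable_const _), hconst, sub_zero,
      eq_div_iff (by positivity), boxCov, mul_assoc, mul_comm _ (n ^ (d - 1)), ← mul_assoc,
      mul_pow_sub_one (by omega), ← pairIntegral_const_mul]
    congr 1
    ext x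
    have : n ^ d = ∏ _i : Fin d, n := by simp
    rw [this, ← Finset.prod_mul_distrib]
    refine Finset.prod_congr rfl fun i _ => ?_
    rw [← tent_mul hn.le, mul_one, mul_sub, mul_inv_cancel_left₀ hn.ne']
    rfl
  obtain ⟨a, ha, hgrow⟩ := exists_variance_lower_bound hη hβ hB (⟨0, by omega⟩ : Fin d)
  have hpos : 0 < pairIntegral β (c 0) := by
    refine ha.trans_le (ge_of_tendsto (hlim 0) ?_)
    filter_upwards [hgrow, eventually_gt_atTop 0] with n hn hn0
    rw [le_div_iff₀ (by positivity), smul_zero]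
    exact hn
  refine ⟨fun u => pairIntegral β (c u) / pairIntegral β (c 0), fun u => ?_,
    exists_growth_of_two_le hd hη hβ hB⟩
  refine ((hlim u).div (hlim 0) hpos.ne').congr' ?_
  filter_upwards [eventually_gt_atTop 0] with n hn
  simp only [Pi.div_apply]
  rw [smul_zero, div_div_div_cancel_right₀ (by positivity)]

end

/-! ### Integrated tails -/

/-- The indicator of `s ≤ t`. -/
noncomputable def step (s t : ℝ) : ℝ := if s ≤ t then 1 else 0

theorem measurable_step : Measurable fun z : ℝ × ℝ => step z.1 z.2 :=
  Measurable.ite (measurableSet_le measurable_fst measurable_snd) measurable_const measurable_const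

theorem abs_step_le (s t : ℝ) : |step s t| ≤ 1 := by
  unfold step; split_ifs <;> simp

/-- The function `t ↦ min (t⁺, r)`. -/
noncomputable def ramp (r t : ℝ) : ℝ := max (min t r) 0

@[fun_prop]
theorem measurable_ramp (r : ℝ) : Measurable (ramp r) := by unfold ramp; fun_prop

theorem abs_ramp_le {r : ℝ} (hr : 0 ≤ r) (t : ℝ) : |ramp r t| ≤ r := by
  rw [ramp, abs_of_nonneg (le_max_right _ _)]
  exact max_le (min_le_right _ _) hr

theorem two_mul_ramp {r : ℝ} (hr : 0 ≤ r) (t : ℝ) : 2 * ramp r t = |t| - |t - r| + r := by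
  unfold ramp
  rcases le_total t r with h | h
  · rw [min_eq_left h, abs_of_nonpos (by linarith : t - r ≤ 0)]
    rcases le_total t 0 with h' | h'
    · rw [max_eq_right h', abs_of_nonpos h']; ring
    · rw [max_eq_left h', abs_of_nonneg h']; ring
  · rw [min_eq_right h, max_eq_left hr, abs_of_nonneg (by linarith : 0 ≤ t - r),
      abs_of_nonneg (hr.trans h)]
    ring

/-- Ramps are what integrated tails produce; this links the variance to `G`. -/
theorem tent_eq_sub_ramp {r : ℝ} (hr : 0 ≤ r) (t : ℝ) :
    tent r t = r - ramp r t - ramp r (-t) := by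
  have h1 := two_mul_tent hr t
  have h2 := two_mul_ramp hr t
  have h3 := two_mul_ramp hr (-t)
  rw [abs_neg, show -t - r = -(t + r) by ring, abs_neg] at h3
  linarith

theorem intervalIntegral_step {r : ℝ} (hr : 0 ≤ r) (t : ℝ) :
    ∫ s in (0 : ℝ)..r, step s t = ramp r t := by
  rw [intervalIntegral.integral_of_le hr]
  have : ∀ s, step s t = Set.indicator (Set.Iic t) 1 s := fun s => by
    simp [step, Set.indicator_apply]
  simp_rw [this]
  rw [integral_indicator_one measurableSet_Iic, measureReal_restrict_apply measurableSet_Iic,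
    Set.inter_comm, Set.Ioc_inter_Iic, measureReal_def, Real.volume_Ioc, ENNReal.toReal_ofReal',
    ramp, min_comm, sub_zero]

theorem intervalIntegral_step_neg {r : ℝ} (hr : 0 ≤ r) (t : ℝ) :
    ∫ s in (0 : ℝ)..r, step (-s) t = r - ramp r (-t) := by
  have h : ∀ᵐ s : ℝ, step (-s) t = 1 - step s (-t) := by
    have : ∀ᵐ s : ℝ, s ≠ -t := by simp [ae_iff]
    filter_upwards [this] with s hs
    unfold step
    rcases lt_or_gt_of_ne hs with h | h
    · rw [if_neg (by linarith), if_pos h.le, sub_self]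
    · rw [if_pos (by linarith), if_neg (by linarith), sub_zero]
  rw [intervalIntegral.integral_congr_ae (h.mono fun s hs _ => hs), intervalIntegral.integral_sub,
    intervalIntegral_step hr]
  · simp
  · exact intervalIntegrable_const
  · rw [intervalIntegrable_iff, Set.uIoc_of_le hr]
    exact Integrable.mono' (integrable_const (1 : ℝ))
      ((measurable_step.comp (measurable_id.prodMk measurable_const)).aestronglyMeasurable)
      (ae_of_all _ fun s => abs_step_le _ _)

section Swap

variable {d : ℕ} {β : SignedMeasure (Space d)}

theorem intervalIntegral_integral_swap {α : Type*} [MeasurableSpace α] (μ : Measure α)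
    [IsFiniteMeasure μ] {k : ℝ → α → ℝ} (hk : Measurable fun z : ℝ × α => k z.1 z.2) {C : ℝ}
    (hC : ∀ s y, |k s y| ≤ C) {r : ℝ} (hr : 0 ≤ r) :
    ∫ s in (0 : ℝ)..r, ∫ y, k s y ∂μ = ∫ y, (∫ s in (0 : ℝ)..r, k s y) ∂μ := by
  simp_rw [intervalIntegral.integral_of_le hr]
  refine integral_integral_swap ?_
  exact (integrable_const C).mono' hk.aestronglyMeasurable (ae_of_all _ fun z => hC _ _)

theorem intervalIntegral_pairIntegral_swap {k : ℝ → Space d → ℝ}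
    (hk : Measurable fun z : ℝ × Space d => k z.1 z.2) {C : ℝ}
    (hC : ∀ s y, |k s y| ≤ C) {r : ℝ} (hr : 0 ≤ r) :
    ∫ s in (0 : ℝ)..r, pairIntegral β (k s) = pairIntegral β fun y => ∫ s in (0 : ℝ)..r, k s y := by
  have hi : ∀ μ : Measure (Space d), IsFiniteMeasure μ →
      IntervalIntegrable (fun s => ∫ y, k s y ∂μ) volume 0 r := fun μ hμ => by
    rw [intervalIntegrable_iff, Set.uIoc_of_le hr]
    have : Integrable (fun z : ℝ × Space d => k z.1 z.2)
        ((volume.restrict (Set.Ioc 0 r)).prod μ) :=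
      (integrable_const C).mono' hk.aestronglyMeasurable (ae_of_all _ fun z => hC _ _)
    exact this.integral_prod_left
  simp only [pairIntegral]
  rw [intervalIntegral.integral_sub (hi _ inferInstance) (hi _ inferInstance),
    intervalIntegral_integral_swap _ hk hC hr, intervalIntegral_integral_swap _ hk hC hr]

/-- One positive coordinate keeps the orthant away from the origin, so the atom `δ_0` does not
contribute. -/
theorem tail_eq_pairIntegral {x : Space d} (hx : ∃ i, 0 < x i) :
    tail β x = pairIntegral β fun y => ∏ i, step (x i) (y i) := by
  have hm : MeasurableSet {y : Space d | ∀ i, x i ≤ y i} := by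
    rw [Set.ofPred_forall]
    exact MeasurableSet.iInter fun i => measurableSet_le measurable_const (by fun_prop)
  have e : (fun y : Space d => ∏ i, step (x i) (y i)) = Set.indicator {y | ∀ i, x i ≤ y i} 1 := by
    ext y
    by_cases h : ∀ i, x i ≤ y i
    · rw [Set.indicator_of_mem (by exact h)]
      exact Finset.prod_eq_one fun i _ => if_pos (h i)
    · rw [Set.indicator_of_notMem (by exact h)]
      push Not at h
      obtain ⟨i, hi⟩ := h
      exact Finset.prod_eq_zero (Finset.mem_univ i) (if_neg (not_le.2 hi))
  have h0 : (0 : Space d) ∉ {y : Space d | ∀ i, x i ≤ y i} := by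
    obtain ⟨i, hi⟩ := hx
    intro h
    exact absurd (h i) (not_le.2 hi)
  rw [e, tail, signedMeasure_apply_eq_sub β hm, pairIntegral, integral_indicator_one hm,
    integral_indicator_one hm, measureReal_def, measureReal_def, Measure.add_apply,
    Measure.dirac_apply' _ hm, Set.indicator_of_notMem h0, zero_add]

end Swap

/-! ### The limit covariance in dimension one -/

/-- Beyond some `N` every doubling multiplies `V` by at least `2^(a/2)`, and `V` is bounded below on
`[N, 2N]`; iterate over dyadic blocks. -/
theorem exists_growth_of_tendsto_ratio {V : ℝ → ℝ} {c a : ℝ} (hc : 0 < c) (ha : 0 < a)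
    (hV : ∀ᶠ n in atTop, c ≤ V n)
    (h : Tendsto (fun n => V (2 * n) / V n) atTop (𝓝 (2 ^ a))) :
    ∃ c δ : ℝ, 0 < c ∧ 0 < δ ∧ ∀ᶠ n : ℝ in atTop, c * n ^ δ ≤ V n := by
  have hlt : (2 : ℝ) ^ (a / 2) < 2 ^ a := Real.rpow_lt_rpow_of_exponent_lt one_lt_two (by linarith)
  obtain ⟨N, hN⟩ := eventually_atTop.1 ((hV.and (h.eventually_const_lt hlt)).and
    (eventually_ge_atTop 1))
  have hN1 : 1 ≤ N := (hN N le_rfl).2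
  have key : ∀ k : ℕ, ∀ n, N ≤ n → n ≤ 2 ^ (k + 1) * N → c * (n / (2 * N)) ^ (a / 2) ≤ V n := by
    intro k
    have base : ∀ n, N ≤ n → n ≤ 2 * N → c * (n / (2 * N)) ^ (a / 2) ≤ V n := fun n h1 h2 => by
      refine le_trans ?_ (hN n h1).1.1
      refine mul_le_of_le_one_right hc.le (Real.rpow_le_one
        (div_nonneg (by linarith) (by linarith)) ?_ (by positivity))
      rw [div_le_one (by positivity)]
      exact h2
    induction k with
    | zero => simpa using base
    | succ k ih =>
      intro n h1 h2
      rcases le_or_gt n (2 * N) with h3 | h3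
      · exact base n h1 h3
      · have h4 : N ≤ n / 2 := by linarith
        have h5 := ih (n / 2) h4 (by rw [pow_succ] at h2; linarith)
        obtain ⟨⟨h6, h7⟩, -⟩ := hN (n / 2) h4
        rw [mul_div_cancel₀ _ two_ne_zero, lt_div_iff₀ (hc.trans_le h6)] at h7
        refine le_trans ?_ h7.le
        calc c * (n / (2 * N)) ^ (a / 2) = 2 ^ (a / 2) * (c * (n / 2 / (2 * N)) ^ (a / 2)) := by
              rw [show n / (2 * N) = 2 * (n / 2 / (2 * N)) by ring,
                Real.mul_rpow zero_le_two (div_nonneg (by linarith) (by linarith))]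
              ring
          _ ≤ _ := mul_le_mul_of_nonneg_left h5 (by positivity)
  refine ⟨c / (2 * N) ^ (a / 2), a / 2, by positivity, by positivity, ?_⟩
  filter_upwards [eventually_ge_atTop N] with n hn
  obtain ⟨k, hk⟩ := pow_unbounded_of_one_lt n one_lt_two
  have h1 : n ≤ 2 ^ (k + 1) * N := by
    have : (0 : ℝ) < 2 ^ k := by positivity
    rw [pow_succ]
    nlinarith
  refine le_trans (le_of_eq ?_) (key k n hn h1)
  rw [Real.div_rpow (by linarith) (by positivity)]
  ring

/-- Symmetrizing in `x` trades a second difference in position for a second difference in the width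
of centred tents, that is, a covariance for variances. -/
theorem tent_add_tent {n : ℝ} (hn : 0 ≤ n) (c x : ℝ) :
    tent n (c - x) + tent n (c + x) = tent |c + n| x + tent |c - n| x - 2 * tent |c| x := by
  have h : ∀ r : ℝ, 2 * tent |r| x = |x - r| + |x + r| - 2 * |x| := fun r => by
    rcases abs_cases r with ⟨hr, -⟩ | ⟨hr, -⟩
    · rw [two_mul_tent (abs_nonneg r), hr]
    · rw [two_mul_tent (abs_nonneg r), hr, sub_neg_eq_add, ← sub_eq_add_neg]
      ring
  have h1 := two_mul_tent hn (c - x)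
  have h2 := two_mul_tent hn (c + x)
  have h3 := h (c + n)
  have h4 := h (c - n)
  have h5 := h c
  rw [show c - x - n = -(x - (c - n)) by ring, show c - x + n = -(x - (c + n)) by ring,
    show c - x = -(x - c) by ring, abs_neg, abs_neg, abs_neg] at h1
  rw [show c + x - n = x + (c - n) by ring, show c + x + n = x + (c + n) by ring,
    show c + x = x + c by ring] at h2
  rw [show c - x = -(x - c) by ring, show c + x = x + c by ring]
  linarith

section DimensionOne

variable {Ω : Type*} [MeasurableSpace Ω] {P : Measure Ω} [IsProbabilityMeasure P]
  {η : Ω → Measure (Space 1)} {β : SignedMeasure (Space 1)}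

theorem pairIntegral_tent_symm (hη : IsStationaryHyperuniform P η)
    (hβ : IsTruncatedPairCorrelation P η β) (hB : IsBrillingerMixing P η) (n c : ℝ) :
    pairIntegral β (fun x => tent n (c - x 0)) = pairIntegral β fun x => tent n (c + x 0) := by
  have h := boxCov_neg hη hβ hB n !₂[c]
  simp only [boxCov, Finset.univ_unique, Finset.prod_singleton, PiLp.neg_apply] at h
  refine h.symm.trans ?_
  congr 1
  ext x
  rw [← tent_neg, neg_sub, sub_neg_eq_add, add_comm]
  rfl

/-- Average the integrand over `x` and `-x`, which the symmetry of the covariance allows, and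
rewrite it by `tent_add_tent`. -/
theorem boxCov_eq_second_difference (hη : IsStationaryHyperuniform P η)
    (hβ : IsTruncatedPairCorrelation P η β) (hB : IsBrillingerMixing P η) {n : ℝ} (hn : 0 ≤ n)
    (u : Space 1) : boxCov β n u =
      (boxCov β |u 0 + n| 0 + boxCov β |u 0 - n| 0 - 2 * boxCov β |u 0| 0) / 2 := by
  have hi : ∀ (r : ℝ) (g : Space 1 → ℝ), Measurable g →
      Integrable (fun x => tent r (g x)) (pairVariation β) := fun r g hg => by
    simpa using integrable_prod_tent (β := β) {()} (fun _ => r) (fun _ => g) fun _ => hg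
  have h0 : ∀ r, boxCov β r 0 = pairIntegral β fun x => tent r (x 0) := fun r => by
    simp [boxCov, tent_neg]
  have h1 : boxCov β n u = pairIntegral β fun x => tent n (u 0 - x 0) := by
    simp [boxCov]
  have h2 : pairIntegral β (fun x => tent n (u 0 - x 0) + tent n (u 0 + x 0)) =
      boxCov β n u + boxCov β n u := by
    rw [pairIntegral_add (hi _ _ (by fun_prop)) (hi _ _ (by fun_prop)),
      ← pairIntegral_tent_symm hη hβ hB, h1]
  simp_rw [tent_add_tent hn] at h2
  have h3 : Integrable (fun x : Space 1 => tent |u 0 + n| (x 0) + tent |u 0 - n| (x 0))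
      (pairVariation β) := (hi _ _ (by fun_prop)).add (hi _ _ (by fun_prop))
  rw [pairIntegral_sub h3
    ((hi _ _ (by fun_prop)).const_mul 2), pairIntegral_const_mul,
    pairIntegral_add (hi _ _ (by fun_prop)) (hi _ _ (by fun_prop)), ← h0, ← h0, ← h0] at h2
  linarith

theorem sum_tent_telescope {n : ℝ} (hn : 0 ≤ n) (x : ℝ) (K : ℕ) :
    2 * ∑ k ∈ Finset.range K, tent n ((k + 1) * n - x) =
      |x| - |x - n| - |x - K * n| + |x - (K + 1) * n| := by
  induction K with
  | zero => simp
  | succ K ih =>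
    rw [Finset.sum_range_succ, mul_add, ih, two_mul_tent hn]
    push_cast
    rw [show (K + 1) * n - x - n = -(x - K * n) by ring,
      show (K + 1) * n - x + n = -(x - (K + 1 + 1) * n) by ring,
      show (K + 1) * n - x = -(x - (K + 1) * n) by ring, abs_neg, abs_neg, abs_neg]
    ring

/-- The sum over consecutive adjacent intervals telescopes and is constant once `K n ≥ x`. A ramp
thus encodes the covariance of an interval with the half-line next to it. -/
theorem tendsto_sum_tent {n : ℝ} (hn : 0 < n) (x : ℝ) :
    Tendsto (fun K : ℕ => ∑ k ∈ Finset.range K, tent n ((k + 1) * n - x)) atTop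
      (𝓝 (ramp n x)) := by
  refine tendsto_const_nhds.congr' ?_
  obtain ⟨K₀, hK₀⟩ := exists_nat_ge (x / n)
  filter_upwards [eventually_ge_atTop K₀] with K hK
  have h1 := sum_tent_telescope hn.le x K
  have h2 := two_mul_ramp hn.le x
  have h3 : x ≤ K * n := by
    rw [← div_le_iff₀ hn]
    exact hK₀.trans (by exact_mod_cast hK)
  rw [abs_of_nonpos (by linarith : x - K * n ≤ 0),
    abs_of_nonpos (by linarith : x - (K + 1) * n ≤ 0)] at h1
  linarith

theorem abs_sum_tent_le {n : ℝ} (hn : 0 ≤ n) (x : ℝ) (K : ℕ) :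
    |∑ k ∈ Finset.range K, tent n ((k + 1) * n - x)| ≤ n := by
  have h1 := sum_tent_telescope hn x K
  have h2 := abs_le.1 (abs_abs_sub_abs_le x (x - n))
  have h3 := abs_le.1 (abs_abs_sub_abs_le (x - (K + 1) * n) (x - K * n))
  rw [show x - (x - n) = n by ring, abs_of_nonneg hn] at h2
  rw [show x - (K + 1) * n - (x - K * n) = -n by ring, abs_neg, abs_of_nonneg hn] at h3
  rw [abs_le]
  constructor <;> linarith

/-- Although `β` is not assumed symmetric, a ramp is a bounded limit of sums of tents, and tents
have reflection-invariant integrals. -/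
theorem pairIntegral_ramp_symm (hη : IsStationaryHyperuniform P η)
    (hβ : IsTruncatedPairCorrelation P η β) (hB : IsBrillingerMixing P η) {n : ℝ} (hn : 0 ≤ n) :
    pairIntegral β (fun x => ramp n (-x 0)) = pairIntegral β fun x => ramp n (x 0) := by
  rcases hn.eq_or_lt with rfl | hn
  · have : ∀ t, ramp 0 t = 0 := fun t => by simp [ramp]
    simp [this]
  have h : ∀ g : Space 1 → ℝ, Measurable g → Tendsto (fun K : ℕ => pairIntegral β fun x =>
      ∑ k ∈ Finset.range K, tent n ((k + 1) * n - g x)) atTop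
      (𝓝 (pairIntegral β fun x => ramp n (g x))) := fun g hg =>
    tendsto_pairIntegral (fun K => by fun_prop) (b := fun _ => n) (integrable_const _)
      (Eventually.of_forall fun K x => abs_sum_tent_le hn.le _ K) fun x => tendsto_sum_tent hn _
  refine tendsto_nhds_unique (h (fun x => -x 0) (by fun_prop)) ((h (fun x => x 0) (by fun_prop)).congr
    fun K => ?_)
  have hi : ∀ (r : ℝ) (g : Space 1 → ℝ), Measurable g →
      Integrable (fun x => tent r (g x)) (pairVariation β) := fun r g hg => by
    simpa using integrable_prod_tent (β := β) {()} (fun _ => r) (fun _ => g) fun _ => hg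
  rw [pairIntegral_finsetSum _ fun k => hi _ _ (by fun_prop),
    pairIntegral_finsetSum _ fun k => hi _ _ (by fun_prop)]
  refine Finset.sum_congr rfl fun k _ => ?_
  rw [pairIntegral_tent_symm hη hβ hB]
  simp only [sub_neg_eq_add]

theorem integratedTail_eq {n : ℝ} (hn : 0 ≤ n) :
    integratedTail β n = -pairIntegral β fun x => ramp n (x 0) := by
  have h : Set.EqOn (fun s : ℝ => tail β !₂[s]) (fun s => pairIntegral β fun y => step s (y 0))
      (Set.Ioc 0 n) := fun s hs => by
      change tail β (!₂[s] : Space 1) = pairIntegral β fun y => step s (y 0)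
      rw [tail_eq_pairIntegral ⟨0, by simpa using hs.1⟩]
      simp
  rw [integratedTail, intervalIntegral.integral_of_le hn, setIntegral_congr_fun measurableSet_Ioc h,
    ← intervalIntegral.integral_of_le hn, intervalIntegral_pairIntegral_swap (C := 1)
    (measurable_step.comp (measurable_fst.prodMk (by fun_prop))) (fun s y => abs_step_le _ _) hn]
  simp_rw [intervalIntegral_step hn]

/-- Write the tent as a constant minus two ramps: the constant integrates to zero by hyperuniformity
and the two ramps have equal integrals. -/
theorem boxCov_zero_eq_integratedTail (hη : IsStationaryHyperuniform P η)
    (hβ : IsTruncatedPairCorrelation P η β) (hB : IsBrillingerMixing P η) {n : ℝ} (hn : 0 ≤ n) :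
    boxCov β n 0 = 2 * integratedTail β n := by
  have hi : ∀ g : Space 1 → ℝ, Measurable g →
      Integrable (fun x => ramp n (g x)) (pairVariation β) := fun g hg =>
    integrable_pairVariation_of_bounded (by fun_prop) n fun x => abs_ramp_le hn _
  have h0 : boxCov β n 0 = pairIntegral β fun x => n * 1 - ramp n (x 0) - ramp n (-x 0) := by
    simp only [boxCov, Finset.univ_unique, Finset.prod_singleton, PiLp.zero_apply, zero_sub,
      tent_neg, mul_one, ← tent_eq_sub_ramp hn]
    rfl
  have h1 : Integrable (fun x : Space 1 => n * 1 - ramp n (x 0)) (pairVariation β) :=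
    (integrable_const (n * 1)).sub (hi _ (by fun_prop))
  rw [h0, pairIntegral_sub h1
    (hi _ (by fun_prop)), pairIntegral_sub (integrable_const (n * 1)) (hi _ (by fun_prop)),
    pairIntegral_const_mul, pairIntegral_one hη hβ hB, pairIntegral_ramp_symm hη hβ hB hn,
    integratedTail_eq hn]
  ring

theorem tendsto_boxCov_ratio (hη : IsStationaryHyperuniform P η)
    (hβ : IsTruncatedPairCorrelation P η β) (hB : IsBrillingerMixing P η) {a : ℝ} (ha : 0 < a)
    (hG : IsRegularlyVarying (integratedTail β) a) {s : ℝ} (hs : 0 ≤ s) :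
    Tendsto (fun n : ℝ => boxCov β (n * s) 0 / boxCov β n 0) atTop (𝓝 (s ^ a)) := by
  rcases hs.eq_or_lt with rfl | hs
  · rw [Real.zero_rpow ha.ne']
    refine tendsto_const_nhds.congr fun n => ?_
    rw [mul_zero, boxCov_zero_eq_integratedTail hη hβ hB le_rfl]
    simp [integratedTail]
  · refine (hG s hs).congr' ?_
    filter_upwards [eventually_gt_atTop 0] with n hn
    rw [boxCov_zero_eq_integratedTail hη hβ hB hn.le,
      boxCov_zero_eq_integratedTail hη hβ hB (by positivity), mul_div_mul_left _ _ two_ne_zero,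
      mul_comm]

/-- The covariance is a second difference of the variance, whose ratios converge to powers. For `d =
1` the general lower bound on the variance is only a constant; the doubling ratio `2^a` improves it
to a power. -/
theorem hasBoxCovLimit_of_isRegularlyVarying (hη : IsStationaryHyperuniform P η)
    (hβ : IsTruncatedPairCorrelation P η β) (hB : IsBrillingerMixing P η) {a : ℝ} (ha : 0 < a)
    (hG : IsRegularlyVarying (integratedTail β) a) :
    HasBoxCovLimit β fun u => (|u 0 + 1| ^ a + |u 0 - 1| ^ a - 2 * |u 0| ^ a) / 2 where
  tendsto u := by
    have h := fun s => tendsto_boxCov_ratio hη hβ hB ha hG (abs_nonneg s)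
    refine ((((h (u 0 + 1)).add (h (u 0 - 1))).sub ((h (u 0)).const_mul 2)).div_const 2).congr' ?_
    filter_upwards [eventually_gt_atTop 0] with n hn
    rw [boxCov_eq_second_difference hη hβ hB hn.le (n • u)]
    have e : ∀ t, |n * t| = n * |t| := fun t => by rw [abs_mul, abs_of_pos hn]
    rw [PiLp.smul_apply, smul_eq_mul, show n * u 0 + n = n * (u 0 + 1) by ring,
      show n * u 0 - n = n * (u 0 - 1) by ring, e, e, e]
    ring
  growth := by
    obtain ⟨c, hc, h⟩ := exists_variance_lower_bound hη hβ hB (0 : Fin 1)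
    simp only [Nat.sub_self, pow_zero, mul_one] at h
    refine exists_growth_of_tendsto_ratio hc ha h ?_
    simpa only [mul_comm] using tendsto_boxCov_ratio hη hβ hB ha hG zero_le_two

end DimensionOne

/-! ### The limit covariance in the regularly varying case in dimension two -/

section Invariance

variable {d : ℕ} {β : SignedMeasure (Space d)}

/-- Invariance of `β` is rewritten as an equality of positive measures, to which the change of
variables applies; the map fixes the origin and hence the atom. -/
theorem pairIntegral_comp {T : Space d → Space d} (hT : Measurable T) (hT0 : T 0 = 0)
    (h : ∀ B, MeasurableSet B → β (T ⁻¹' B) = β B) {f : Space d → ℝ} (hf : Measurable f)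
    {C : ℝ} (hC : ∀ x, |f x| ≤ C) :
    pairIntegral β (fun x => f (T x)) = pairIntegral β f := by
  set p := β.toJordanDecomposition.posPart with hp
  set q := β.toJordanDecomposition.negPart with hq
  have key : p.map T + q = p + q.map T := by
    ext B hB
    rw [Measure.add_apply, Measure.add_apply, Measure.map_apply hT hB, Measure.map_apply hT hB,
      ← ENNReal.toReal_eq_toReal_iff' (by finiteness) (by finiteness),
      ENNReal.toReal_add (by finiteness) (by finiteness),
      ENNReal.toReal_add (by finiteness) (by finiteness)]
    have h1 := h B hB
    rw [signedMeasure_apply_eq_sub β hB, signedMeasure_apply_eq_sub β (hT hB)] at h1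
    linarith
  have hi : ∀ μ : Measure (Space d), IsFiniteMeasure μ → Integrable f μ := fun μ _ =>
    (integrable_const C).mono' hf.aestronglyMeasurable (ae_of_all _ hC)
  have hi' : ∀ μ : Measure (Space d), IsFiniteMeasure μ → Integrable (fun x => f (T x)) μ :=
    fun μ _ => (integrable_const C).mono' (hf.comp hT).aestronglyMeasurable
      (ae_of_all _ fun x => hC _)
  have h2 := congrArg (fun μ : Measure (Space d) => ∫ x, f x ∂μ) key
  rw [integral_add_measure (hi _ inferInstance) (hi _ inferInstance),
    integral_add_measure (hi _ inferInstance) (hi _ inferInstance),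
    integral_map hT.aemeasurable hf.aestronglyMeasurable,
    integral_map hT.aemeasurable hf.aestronglyMeasurable] at h2
  rw [pairIntegral, pairIntegral, integral_add_measure (hi' _ inferInstance) (hi' _ inferInstance),
    integral_add_measure (hi _ inferInstance) (hi _ inferInstance), integral_dirac,
    integral_dirac, hT0]
  linarith

end Invariance

/-- Bounded measurable functions on the line. -/
def IsBoundedMeasurable (φ : ℝ → ℝ) : Prop :=
  Measurable φ ∧ ∃ C, ∀ t, |φ t| ≤ C

theorem isBoundedMeasurable_const (c : ℝ) : IsBoundedMeasurable fun _ => c :=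
  ⟨measurable_const, |c|, fun _ => le_rfl⟩

theorem IsBoundedMeasurable.sub {φ ψ : ℝ → ℝ} (hφ : IsBoundedMeasurable φ)
    (hψ : IsBoundedMeasurable ψ) : IsBoundedMeasurable fun t => φ t - ψ t := by
  obtain ⟨hm, C, hC⟩ := hφ
  obtain ⟨hm', C', hC'⟩ := hψ
  exact ⟨hm.sub hm', C + C', fun t => (abs_sub _ _).trans (add_le_add (hC t) (hC' t))⟩

theorem IsBoundedMeasurable.comp {φ g : ℝ → ℝ} (hφ : IsBoundedMeasurable φ)
    (hg : Measurable g) : IsBoundedMeasurable fun t => φ (g t) :=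
  ⟨hφ.1.comp hg, hφ.2.imp fun _ hC t => hC (g t)⟩

theorem isBoundedMeasurable_tent (n : ℝ) : IsBoundedMeasurable (tent n) := by
  refine ⟨measurable_tent n, |n|, fun t => ?_⟩
  rw [abs_of_nonneg (tent_nonneg n t)]
  exact max_le (by linarith [abs_nonneg t, le_abs_self n]) (abs_nonneg n)

theorem isBoundedMeasurable_ramp {n : ℝ} (hn : 0 ≤ n) : IsBoundedMeasurable (ramp n) :=
  ⟨measurable_ramp n, n, abs_ramp_le hn⟩

/-- The integral of `φ(x_1) ψ(x_2)` with respect to `δ_0 + β`. -/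
noncomputable def prodIntegral (β : SignedMeasure (Space 2)) (φ ψ : ℝ → ℝ) : ℝ :=
  pairIntegral β fun x => φ (x 0) * ψ (x 1)

section DimensionTwo

variable {β : SignedMeasure (Space 2)} {φ φ' ψ ψ' : ℝ → ℝ}

theorem IsBoundedMeasurable.integrable_mul (hφ : IsBoundedMeasurable φ)
    (hψ : IsBoundedMeasurable ψ) :
    Integrable (fun x : Space 2 => φ (x 0) * ψ (x 1)) (pairVariation β) := by
  obtain ⟨hm, C, hC⟩ := hφ
  obtain ⟨hm', C', hC'⟩ := hψ
  refine integrable_pairVariation_of_bounded (by fun_prop) (C * C') fun x => ?_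
  rw [abs_mul]
  exact mul_le_mul (hC _) (hC' _) (abs_nonneg _) ((abs_nonneg _).trans (hC 0))

theorem prodIntegral_sub_left (hφ : IsBoundedMeasurable φ) (hφ' : IsBoundedMeasurable φ')
    (hψ : IsBoundedMeasurable ψ) :
    prodIntegral β (fun t => φ t - φ' t) ψ = prodIntegral β φ ψ - prodIntegral β φ' ψ := by
  simp only [prodIntegral, sub_mul]
  exact pairIntegral_sub (hφ.integrable_mul hψ) (hφ'.integrable_mul hψ)

theorem prodIntegral_sub_right (hφ : IsBoundedMeasurable φ) (hψ : IsBoundedMeasurable ψ)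
    (hψ' : IsBoundedMeasurable ψ') :
    prodIntegral β φ (fun t => ψ t - ψ' t) = prodIntegral β φ ψ - prodIntegral β φ ψ' := by
  simp only [prodIntegral, mul_sub]
  exact pairIntegral_sub (hφ.integrable_mul hψ) (hφ.integrable_mul hψ')

theorem prodIntegral_const_left (c : ℝ) (ψ : ℝ → ℝ) :
    prodIntegral β (fun _ => c) ψ = c * prodIntegral β (fun _ => 1) ψ := by
  simp only [prodIntegral, one_mul]
  exact pairIntegral_const_mul _ _

theorem prodIntegral_const_right (c : ℝ) (φ : ℝ → ℝ) :
    prodIntegral β φ (fun _ => c) = c * prodIntegral β φ fun _ => 1 := by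
  simp only [prodIntegral, mul_one]
  rw [← pairIntegral_const_mul]
  simp only [mul_comm]

theorem exists_abs_mul_le (hφ : IsBoundedMeasurable φ) (hψ : IsBoundedMeasurable ψ) :
    ∃ C, ∀ x : Space 2, |φ (x 0) * ψ (x 1)| ≤ C := by
  obtain ⟨-, C, hC⟩ := hφ
  obtain ⟨-, C', hC'⟩ := hψ
  refine ⟨C * C', fun x => ?_⟩
  rw [abs_mul]
  exact mul_le_mul (hC _) (hC' _) (abs_nonneg _) ((abs_nonneg _).trans (hC 0))

theorem measurable_mul_coord (hφ : IsBoundedMeasurable φ) (hψ : IsBoundedMeasurable ψ) :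
    Measurable fun x : Space 2 => φ (x 0) * ψ (x 1) :=
  (hφ.1.comp (by fun_prop)).mul (hψ.1.comp (by fun_prop))

theorem prodIntegral_neg_left (hs : IsSymmetricMeasure β) (hφ : IsBoundedMeasurable φ)
    (hψ : IsBoundedMeasurable ψ) :
    prodIntegral β (fun t => φ (-t)) ψ = prodIntegral β φ ψ := by
  obtain ⟨C, hC⟩ := exists_abs_mul_le hφ hψ
  have h := pairIntegral_comp (β := β)
    (T := fun y => WithLp.toLp 2 fun i => if i = 0 then -y i else y i)
    (by refine (WithLp.measurable_toLp 2 _).comp (measurable_pi_lambda _ fun i => ?_)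
        split_ifs <;> fun_prop) (by ext i; simp) (fun B hB => hs.refl 0 B hB)
    (measurable_mul_coord hφ hψ) hC
  simpa [prodIntegral] using h

theorem prodIntegral_neg_right (hs : IsSymmetricMeasure β) (hφ : IsBoundedMeasurable φ)
    (hψ : IsBoundedMeasurable ψ) :
    prodIntegral β φ (fun t => ψ (-t)) = prodIntegral β φ ψ := by
  obtain ⟨C, hC⟩ := exists_abs_mul_le hφ hψ
  have h := pairIntegral_comp (β := β)
    (T := fun y => WithLp.toLp 2 fun i => if i = 1 then -y i else y i)
    (by refine (WithLp.measurable_toLp 2 _).comp (measurable_pi_lambda _ fun i => ?_)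
        split_ifs <;> fun_prop) (by ext i; simp) (fun B hB => hs.refl 1 B hB)
    (measurable_mul_coord hφ hψ) hC
  simpa [prodIntegral] using h

theorem prodIntegral_swap (hs : IsSymmetricMeasure β) (hφ : IsBoundedMeasurable φ)
    (hψ : IsBoundedMeasurable ψ) : prodIntegral β ψ φ = prodIntegral β φ ψ := by
  obtain ⟨C, hC⟩ := exists_abs_mul_le hφ hψ
  have h := pairIntegral_comp (β := β)
    (T := fun y => WithLp.toLp 2 fun i => y (Equiv.swap 0 1 i))
    ((WithLp.measurable_toLp 2 _).comp (measurable_pi_lambda _ fun i => by fun_prop))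
    (by ext i; simp) (fun B hB => hs.perm (Equiv.swap 0 1) B hB)
    (measurable_mul_coord hφ hψ) hC
  rw [prodIntegral, prodIntegral, ← h]
  congr 1
  ext x
  simp [mul_comm]

/-- Integrating the indicators of the tails over `x₂` and then `x₁` gives ramps, with the complement
of a ramp in the reflected coordinate. Positivity of `x₂` alone keeps the quadrants away from the
origin. -/
theorem integratedTail₂_neg_eq {y₁ y₂ : ℝ} (h₁ : 0 ≤ y₁) (h₂ : 0 ≤ y₂) :
    integratedTail₂ β (-1) y₁ y₂ =
      prodIntegral β (fun t => y₁ - ramp y₁ (-t)) (ramp y₂) := by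
  have hin : ∀ x₁ : ℝ, ∫ x₂ in (0 : ℝ)..y₂, tail β (!₂[-1 * x₁, x₂] : Space 2) =
      pairIntegral β fun y => step (-x₁) (y 0) * ramp y₂ (y 1) := fun x₁ => by
    have h : Set.EqOn (fun x₂ : ℝ => tail β (!₂[-1 * x₁, x₂] : Space 2))
        (fun x₂ => pairIntegral β fun y => step (-x₁) (y 0) * step x₂ (y 1)) (Set.Ioc 0 y₂) :=
      fun x₂ hx => by
        change tail β (!₂[-1 * x₁, x₂] : Space 2) = _
        rw [tail_eq_pairIntegral ⟨1, by simpa using hx.1⟩]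
        simp
    rw [intervalIntegral.integral_of_le h₂, setIntegral_congr_fun measurableSet_Ioc h,
      ← intervalIntegral.integral_of_le h₂, intervalIntegral_pairIntegral_swap (C := 1) ?_ ?_ h₂]
    · simp_rw [intervalIntegral.integral_const_mul, intervalIntegral_step h₂]
    · exact (measurable_step.comp (measurable_const.prodMk (by fun_prop))).mul
        (measurable_step.comp (measurable_fst.prodMk (by fun_prop)))
    · intro s y
      rw [abs_mul]
      exact mul_le_one₀ (abs_step_le _ _) (abs_nonneg _) (abs_step_le _ _)
  simp only [integratedTail₂, hin]
  rw [intervalIntegral_pairIntegral_swap (C := y₂) ?_ ?_ h₁, prodIntegral]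
  · simp_rw [intervalIntegral.integral_mul_const, intervalIntegral_step_neg h₁]
  · exact (measurable_step.comp (measurable_fst.neg.prodMk (by fun_prop))).mul
      ((measurable_ramp y₂).comp (by fun_prop))
  · intro s y
    rw [abs_mul]
    exact (mul_le_mul (abs_step_le _ _) (abs_ramp_le h₂ _) (abs_nonneg _) zero_le_one).trans_eq
      (one_mul _)

/-- Expand both tents into a constant and two ramps. By symmetry and zero total mass only the
integrals of `y₁ r₂`, `y₂ r₁` and `r₁ r₂` remain, with coefficients `-2`, `-2`, `4`, `r` denoting
the ramps. The two values of `G_-` combine these terms in the same proportion. -/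
theorem prodIntegral_tent_eq (h1 : pairIntegral β (fun _ => 1) = 0) (hs : IsSymmetricMeasure β)
    {y₁ y₂ : ℝ} (h₁ : 0 ≤ y₁) (h₂ : 0 ≤ y₂) :
    prodIntegral β (tent y₁) (tent y₂) =
      -2 * (integratedTail₂ β (-1) y₁ y₂ + integratedTail₂ β (-1) y₂ y₁) := by
  have r₁ := isBoundedMeasurable_ramp h₁
  have r₂ := isBoundedMeasurable_ramp h₂
  have r₁' := r₁.comp measurable_neg
  have r₂' := r₂.comp measurable_neg
  have c₁ := isBoundedMeasurable_const y₁
  have c₂ := isBoundedMeasurable_const y₂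
  have o := isBoundedMeasurable_const 1
  have hone : prodIntegral β (fun _ => 1) (fun _ => 1) = 0 := by
    simpa [prodIntegral] using h1
  rw [integratedTail₂_neg_eq h₁ h₂, integratedTail₂_neg_eq h₂ h₁,
    prodIntegral_sub_left c₁ r₁' r₂, prodIntegral_sub_left c₂ r₂' r₁,
    prodIntegral_neg_left hs r₁ r₂, prodIntegral_neg_left hs r₂ r₁,
    prodIntegral_const_left, prodIntegral_const_left y₂, prodIntegral_swap hs r₁ r₂,
    show tent y₁ = fun t => y₁ - ramp y₁ t - ramp y₁ (-t) from funext (tent_eq_sub_ramp h₁),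
    show tent y₂ = fun t => y₂ - ramp y₂ t - ramp y₂ (-t) from funext (tent_eq_sub_ramp h₂),
    prodIntegral_sub_left (c₁.sub r₁) r₁' ((c₂.sub r₂).sub r₂'),
    prodIntegral_neg_left hs r₁ ((c₂.sub r₂).sub r₂'),
    prodIntegral_sub_left c₁ r₁ ((c₂.sub r₂).sub r₂'),
    prodIntegral_sub_right c₁ (c₂.sub r₂) r₂', prodIntegral_sub_right c₁ c₂ r₂,
    prodIntegral_sub_right r₁ (c₂.sub r₂) r₂', prodIntegral_sub_right r₁ c₂ r₂,
    prodIntegral_neg_right hs c₁ r₂, prodIntegral_neg_right hs r₁ r₂,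
    prodIntegral_const_right y₂, prodIntegral_const_right y₂, prodIntegral_const_left y₁ fun _ => 1,
    hone, prodIntegral_const_left y₁ (ramp y₂), prodIntegral_swap hs o r₁]
  ring

theorem exists_tendsto_prodIntegral_tent (h1 : pairIntegral β (fun _ => 1) = 0)
    (hs : IsSymmetricMeasure β) {a : ℝ} {g : Space 2 → ℝ}
    (hG : IsRegularlyVarying₂ (integratedTail₂ β (-1)) a g) {y₁ y₂ : ℝ} (h₁ : 0 ≤ y₁)
    (h₂ : 0 ≤ y₂) :
    ∃ L, Tendsto (fun n : ℝ => prodIntegral β (tent (n * y₁)) (tent (n * y₂)) /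
      prodIntegral β (tent n) (tent n)) atTop (𝓝 L) := by
  rcases h₁.eq_or_lt with rfl | h₁
  · exact ⟨0, by simp [prodIntegral, tent_zero, pairIntegral]⟩
  rcases h₂.eq_or_lt with rfl | h₂
  · exact ⟨0, by simp [prodIntegral, tent_zero, pairIntegral]⟩
  have hG₁ := hG.2 !₂[y₁, y₂] (by simpa using h₁) (by simpa using h₂)
  have hG₂ := hG.2 !₂[y₂, y₁] (by simpa using h₂) (by simpa using h₁)
  refine ⟨_, ((hG₁.add hG₂).div_const 2).congr' ?_⟩
  filter_upwards [eventually_gt_atTop 0] with n hn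
  rw [prodIntegral_tent_eq h1 hs (by positivity) (by positivity),
    prodIntegral_tent_eq h1 hs hn.le hn.le]
  simp only [Matrix.cons_val_zero, Matrix.cons_val_one]
  rw [← add_div, div_div, ← two_mul, mul_div_mul_left _ _ (by norm_num : (-2 : ℝ) ≠ 0), mul_comm 2]

theorem boxCov_eq_prodIntegral (n : ℝ) (u : Space 2) :
    boxCov β n u = prodIntegral β (fun t => tent n (u 0 - t)) fun t => tent n (u 1 - t) := by
  simp [boxCov, prodIntegral]

/-- Symmetrize in each coordinate separately, using the reflections, and apply `tent_add_tent`
twice; `1, 1, -2` are the weights of a second difference. -/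
theorem four_mul_boxCov (hs : IsSymmetricMeasure β) {n : ℝ} (hn : 0 ≤ n) (u : Space 2) :
    4 * boxCov β n u = ∑ k : Fin 3, ∑ l : Fin 3, (![1, 1, -2] k * ![1, 1, -2] l : ℝ) *
      prodIntegral β (tent (![|u 0 + n|, |u 0 - n|, |u 0|] k))
        (tent (![|u 1 + n|, |u 1 - n|, |u 1|] l)) := by
  have hb : ∀ c : ℝ, IsBoundedMeasurable fun t => tent n (c - t) := fun c =>
    (isBoundedMeasurable_tent n).comp (by fun_prop)
  have hb' : ∀ c : ℝ, IsBoundedMeasurable fun t => tent n (c - -t) := fun c =>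
    (isBoundedMeasurable_tent n).comp (by fun_prop)
  have hT : ∀ c t : ℝ, tent n (c - t) + tent n (c - -t) =
      ∑ k : Fin 3, ![1, 1, -2] k * tent (![|c + n|, |c - n|, |c|] k) t := fun c t => by
    rw [sub_neg_eq_add, tent_add_tent hn, Fin.sum_univ_three]
    simp
    ring
  have h4 : 4 * boxCov β n u = pairIntegral β fun x =>
      (tent n (u 0 - x 0) + tent n (u 0 - -x 0)) * (tent n (u 1 - x 1) + tent n (u 1 - -x 1)) := by
    have e := fun φ ψ hφ hψ => IsBoundedMeasurable.integrable_mul (β := β) (φ := φ) (ψ := ψ) hφ hψ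
    simp only [add_mul, mul_add]
    rw [pairIntegral_add ((e _ _ (hb _) (hb _)).fun_add (e _ _ (hb' _) (hb _)))
      ((e _ _ (hb _) (hb' _)).fun_add (e _ _ (hb' _) (hb' _))),
      pairIntegral_add (e _ _ (hb _) (hb _)) (e _ _ (hb' _) (hb _)),
      pairIntegral_add (e _ _ (hb _) (hb' _)) (e _ _ (hb' _) (hb' _))]
    have e1 := prodIntegral_neg_left hs (hb (u 0)) (hb (u 1))
    have e2 := prodIntegral_neg_right hs (hb (u 0)) (hb (u 1))
    have e3 := prodIntegral_neg_left hs (hb (u 0)) (hb' (u 1))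
    rw [← boxCov_eq_prodIntegral] at e1 e2
    have e4 := boxCov_eq_prodIntegral (β := β) n u
    simp only [prodIntegral] at e1 e2 e3 e4
    linarith
  rw [h4]
  simp only [hT, Finset.sum_mul_sum]
  have hi : ∀ k l : Fin 3, Integrable (fun x : Space 2 =>
      ![1, 1, -2] k * tent (![|u 0 + n|, |u 0 - n|, |u 0|] k) (x 0) *
        (![1, 1, -2] l * tent (![|u 1 + n|, |u 1 - n|, |u 1|] l) (x 1))) (pairVariation β) :=
    fun k l => by
      have := ((isBoundedMeasurable_tent (![|u 0 + n|, |u 0 - n|, |u 0|] k)).integrable_mul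
        (β := β) (isBoundedMeasurable_tent (![|u 1 + n|, |u 1 - n|, |u 1|] l))).const_mul
          (![1, 1, -2] k * ![1, 1, -2] l)
      refine this.congr (ae_of_all _ fun x => ?_)
      simp only
      ring
  rw [pairIntegral_finsetSum _ fun k => integrable_finsetSum _ fun l _ => hi k l]
  refine Finset.sum_congr rfl fun k _ => ?_
  rw [pairIntegral_finsetSum _ fun l => hi k l]
  refine Finset.sum_congr rfl fun l _ => ?_
  rw [prodIntegral, ← pairIntegral_const_mul]
  congr 1
  ext x
  ring

theorem exists_hasBoxCovLimit_of_isRegularlyVarying₂ {Ω : Type*} [MeasurableSpace Ω]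
    {P : Measure Ω} [IsProbabilityMeasure P] {η : Ω → Measure (Space 2)}
    (hη : IsStationaryHyperuniform P η) (hβ : IsTruncatedPairCorrelation P η β)
    (hB : IsBrillingerMixing P η) (hs : IsSymmetricMeasure β) {a : ℝ} {g : Space 2 → ℝ}
    (hG : IsRegularlyVarying₂ (integratedTail₂ β (-1)) a g) :
    ∃ K, HasBoxCovLimit β K := by
  have h1 := pairIntegral_one hη hβ hB
  have h : ∀ u : Space 2, ∃ L, Tendsto (fun n : ℝ => boxCov β n (n • u) / boxCov β n 0) atTop
      (𝓝 L) := fun u => by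
    have hr : ∀ k l : Fin 3, 0 ≤ ![|u 0 + 1|, |u 0 - 1|, |u 0|] k ∧
        0 ≤ ![|u 1 + 1|, |u 1 - 1|, |u 1|] l := fun k l => by
      fin_cases k <;> fin_cases l <;> exact ⟨abs_nonneg _, abs_nonneg _⟩
    choose L hL using fun k l : Fin 3 =>
      exists_tendsto_prodIntegral_tent h1 hs hG (hr k l).1 (hr k l).2
    refine ⟨_, ((tendsto_finsetSum Finset.univ fun k _ => tendsto_finsetSum Finset.univ fun l _ =>
      (hL k l).const_mul (![1, 1, -2] k * ![1, 1, -2] l : ℝ)).div_const 4).congr' ?_⟩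
    filter_upwards [eventually_gt_atTop 0] with n hn
    have e0 : boxCov β n 0 = prodIntegral β (tent n) (tent n) := by
      rw [boxCov_eq_prodIntegral]
      simp [tent_neg]
    have e : ∀ t, |n * t| = n * |t| := fun t => by rw [abs_mul, abs_of_pos hn]
    have er : ∀ (i : Fin 2) (k : Fin 3), n * ![|u i + 1|, |u i - 1|, |u i|] k =
        ![|(n • u) i + n|, |(n • u) i - n|, |(n • u) i|] k := fun i k => by
      rw [PiLp.smul_apply, smul_eq_mul, show n * u i + n = n * (u i + 1) by ring,
        show n * u i - n = n * (u i - 1) by ring, e, e, e]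
      fin_cases k <;> rfl
    simp only [er]
    have key := eq_div_of_mul_eq four_ne_zero
      ((mul_comm _ _).trans (four_mul_boxCov (β := β) hs hn.le (n • u)))
    rw [e0, key, div_right_comm]
    congr 1
    rw [Finset.sum_div]
    refine Finset.sum_congr rfl fun k _ => ?_
    rw [Finset.sum_div]
    exact Finset.sum_congr rfl fun l _ => (mul_div_assoc _ _ _).symm
  choose K hK using h
  exact ⟨K, hK, exists_growth_of_two_le le_rfl hη hβ hB⟩

end DimensionTwo

/-! ### Gaussian fields with a prescribed covariance -/

section Isonormal

theorem norm_exp_mul_I_sub_le (x y : ℝ) :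
    ‖Complex.exp (x * Complex.I) - Complex.exp (y * Complex.I)‖ ≤ |x - y| := by
  have h : Complex.exp (x * Complex.I) - Complex.exp (y * Complex.I) =
      Complex.exp (y * Complex.I) * (Complex.exp (Complex.I * (x - y : ℝ)) - 1) := by
    rw [mul_sub, ← Complex.exp_add, mul_one]
    congr 2
    push_cast
    ring
  rw [h, norm_mul, Complex.norm_exp_ofReal_mul_I, one_mul]
  exact Real.norm_exp_I_mul_ofReal_sub_one_le

variable {Ω : Type*} [MeasurableSpace Ω] {P : Measure Ω} [IsProbabilityMeasure P]

theorem integrable_exp_mul_I {X : Ω → ℝ} (hX : AEStronglyMeasurable X P) :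
    Integrable (fun ω => Complex.exp (X ω * Complex.I)) P := by
  refine (integrable_const (1 : ℝ)).mono' ?_ (ae_of_all _ fun ω => ?_)
  · exact Complex.continuous_exp.comp_aestronglyMeasurable
      ((Complex.continuous_ofReal.comp_aestronglyMeasurable hX).mul_const _)
  · rw [Complex.norm_exp_ofReal_mul_I]

/-- Characteristic functions depend continuously on the variable in `L²`, so a Gaussian law need
only be verified on a dense subspace. -/
theorem lipschitzWith_integral_exp (t : ℝ) :
    LipschitzWith (Real.toNNReal |t|)
      fun f : Lp ℝ 2 P => ∫ ω, Complex.exp ((t * f ω : ℝ) * Complex.I) ∂P := by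
  refine LipschitzWith.of_dist_le_mul fun f g => ?_
  have hm : ∀ f : Lp ℝ 2 P, AEStronglyMeasurable (fun ω => t * f ω) P := fun f =>
    (Lp.aestronglyMeasurable f).const_mul t
  rw [dist_eq_norm, ← integral_sub (integrable_exp_mul_I (hm f)) (integrable_exp_mul_I (hm g)),
    Real.coe_toNNReal _ (abs_nonneg t), dist_eq_norm, Lp.norm_def]
  have hfg : MemLp (fun ω => f ω - g ω) 2 P := (Lp.memLp f).sub (Lp.memLp g)
  have hi : Integrable (fun ω => f ω - g ω) P := hfg.integrable (by norm_num)
  calc _ ≤ ∫ ω, |t| * ‖f ω - g ω‖ ∂P := by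
        refine norm_integral_le_of_norm_le (hi.norm.const_mul _) (ae_of_all _ fun ω => ?_)
        refine (norm_exp_mul_I_sub_le _ _).trans_eq ?_
        rw [← mul_sub, abs_mul, Real.norm_eq_abs]
    _ = |t| * (eLpNorm (fun ω => f ω - g ω) 1 P).toReal := by
        rw [integral_const_mul, integral_norm_eq_lintegral_enorm hi.1, eLpNorm_one_eq_lintegral_enorm]
    _ ≤ |t| * (eLpNorm (fun ω => f ω - g ω) 2 P).toReal := by
        refine mul_le_mul_of_nonneg_left ?_ (abs_nonneg t)
        exact ENNReal.toReal_mono hfg.2.ne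
          (eLpNorm_le_eLpNorm_of_exponent_le (by norm_num) hi.1)
    _ = _ := by
        congr 2
        exact eLpNorm_congr_ae (Lp.coeFn_sub f g).symm

/-- An isonormal Gaussian process over a Hilbert space. -/
theorem exists_isonormal (H : Type) [NormedAddCommGroup H] [InnerProductSpace ℝ H]
    [CompleteSpace H] :
    ∃ (Ω : Type) (_ : MeasurableSpace Ω) (P : Measure Ω) (_ : IsProbabilityMeasure P)
      (U : H →ₗᵢ[ℝ] Lp ℝ 2 P), ∀ h, P.map (U h) = gaussianReal 0 (‖h‖ ^ 2).toNNReal := by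
  -- Independent standard normals indexed by a Hilbert basis are orthonormal in `L²`; sending the
  -- basis to them extends to an isometry.
  obtain ⟨w, b, -⟩ := exists_hilbertBasis ℝ H
  obtain ⟨Ω, mΩ, P, Z, hZm, hZ, hind, hP⟩ := exists_iid w (gaussianReal 0 1)
  have hG : ∀ i, HasGaussianLaw (Z i) P := fun i => (hZ i).hasGaussianLaw
  have hL2 : ∀ i, MemLp (Z i) 2 P := fun i => (hG i).memLp_two
  have hmean : ∀ i, ∫ ω, Z i ω ∂P = 0 := fun i => by
    rw [(hZ i).integral_eq]
    simp
  have hvar : ∀ i, Var[Z i; P] = 1 := fun i => by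
    rw [(hZ i).variance_eq]
    simp
  have horth : Orthonormal ℝ fun i => (hL2 i).toLp (Z i) := by
    classical
    rw [orthonormal_iff_ite]
    intro i j
    have e : inner ℝ ((hL2 i).toLp (Z i)) ((hL2 j).toLp (Z j)) = cov[Z i, Z j; P] := by
      rw [covariance_eq_sub (hL2 i) (hL2 j), hmean, zero_mul, sub_zero, L2.inner_def]
      refine integral_congr_ae ?_
      filter_upwards [(hL2 i).coeFn_toLp, (hL2 j).coeFn_toLp] with ω h1 h2
      rw [h1, h2]
      simp [mul_comm]
    rw [e]
    split_ifs with h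
    · subst h
      rw [covariance_self (hZm i).aemeasurable, hvar]
    · exact (hind.indepFun h).covariance_eq_zero (hL2 i) (hL2 j)
  set U : H →ₗᵢ[ℝ] Lp ℝ 2 P :=
    horth.orthogonalFamily.linearIsometry.comp b.repr.toLinearIsometry with hU
  have hUb : ∀ i, U (b i) = (hL2 i).toLp (Z i) := fun i => by
    classical
    have : U (b i) = horth.orthogonalFamily.linearIsometry (b.repr (b i)) := rfl
    rw [this, b.repr_self]
    simp
  refine ⟨Ω, mΩ, P, hP, U, fun h => ?_⟩
  have key : ∀ t : ℝ, ∀ h : H, ∫ ω, Complex.exp ((t * U h ω : ℝ) * Complex.I) ∂P =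
      Complex.exp ((-(t ^ 2 * ‖h‖ ^ 2 / 2) : ℝ)) := fun t => by
    -- On finite combinations of basis vectors the image is a finite sum of independent Gaussians;
    -- density and continuity do the rest.
    have hd : Dense (Submodule.span ℝ (Set.range b) : Set H) := by
      rw [Submodule.dense_iff_topologicalClosure_eq_top]
      exact b.dense_span
    have hc : Continuous fun h : H => ∫ ω, Complex.exp ((t * U h ω : ℝ) * Complex.I) ∂P :=
      (lipschitzWith_integral_exp t).continuous.comp U.continuous
    have hc' : Continuous fun h : H => Complex.exp ((-(t ^ 2 * ‖h‖ ^ 2 / 2) : ℝ)) := by fun_prop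
    refine fun h => congrFun (Continuous.ext_on hd hc hc' fun h hh => ?_) h
    obtain ⟨c, rfl⟩ := (Finsupp.mem_span_range_iff_exists_finsupp).1 hh
    set h := c.sum fun i a => a • b i with hh'
    have hUc : U h =ᵐ[P] fun ω => ∑ i : c.support, c i * Z i ω := by
      have e : U h = ∑ i : c.support, (((hL2 i).const_mul (c i)).toLp fun ω => c i * Z i ω) := by
        rw [hh', Finsupp.sum, map_sum, ← Finset.sum_coe_sort]
        refine Finset.sum_congr rfl fun i _ => ?_
        rw [map_smul, hUb]
        rfl
      rw [e]
      refine (Lp.coeFn_fun_finsetSum _ _).trans ?_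
      have : ∀ᵐ ω ∂P, ∀ i : c.support,
          (((hL2 i).const_mul (c i)).toLp fun ω => c i * Z i ω) ω = c i * Z i ω :=
        ae_all_iff.2 fun i => MemLp.coeFn_toLp _
      filter_upwards [this] with ω hω
      exact Finset.sum_congr rfl fun i _ => hω i
    have hlaw : HasGaussianLaw (U h) P := by
      refine HasGaussianLaw.congr ?_ hUc.symm
      refine iIndepFun.hasGaussianLaw_fun_sum (X := fun (i : c.support) ω => c i * Z i ω)
        (fun i => (hG i).fun_smul (c i)) ?_
      exact (hind.precomp Subtype.val_injective).comp (fun (i : c.support) x => c i * x)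
        fun i => measurable_const_mul _
    have hm : ∫ ω, U h ω ∂P = 0 := by
      rw [integral_congr_ae hUc, integral_finsetSum]
      · exact Finset.sum_eq_zero fun i _ => by rw [integral_const_mul, hmean, mul_zero]
      · exact fun i _ => ((hL2 i).integrable (by norm_num)).const_mul _
    have hv : Var[U h; P] = ‖h‖ ^ 2 := by
      rw [variance_of_integral_eq_zero hlaw.aemeasurable hm, ← U.norm_map h,
        ← real_inner_self_eq_norm_sq, L2.inner_def]
      refine integral_congr_ae (ae_of_all _ fun ω => ?_)
      simp [sq]
    have := charFun_gaussianReal (μ := 0) (v := (‖h‖ ^ 2).toNNReal) t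
    rw [← hv, ← hm, ← hlaw.map_eq_gaussianReal, hm, charFun_apply_real, hv,
      integral_map hlaw.aemeasurable (by fun_prop), Real.coe_toNNReal _ (sq_nonneg _)] at this
    calc _ = _ := ?_
      _ = _ := this
      _ = _ := ?_
    · refine integral_congr_ae (ae_of_all _ fun ω => ?_)
      push_cast
      rfl
    · push_cast
      congr 1
      ring
  refine Measure.ext_of_charFun (funext fun t => ?_)
  have hm : AEMeasurable (U h) P := (Lp.aestronglyMeasurable (U h)).aemeasurable
  rw [charFun_apply_real, integral_map hm (by fun_prop), charFun_gaussianReal,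
    Real.coe_toNNReal _ (sq_nonneg _)]
  calc _ = _ := ?_
    _ = _ := key t h
    _ = _ := ?_
  · refine integral_congr_ae (ae_of_all _ fun ω => ?_)
    push_cast
    rfl
  · push_cast
    congr 1
    ring

/-- A centred Gaussian process with a prescribed covariance kernel. -/
theorem exists_gaussian_process {T : Type} (r : T → T → ℝ) (hsymm : ∀ s t, r s t = r t s)
    (hpsd : ∀ (s : Finset T) (c : T → ℝ), 0 ≤ ∑ x ∈ s, ∑ y ∈ s, c x * c y * r x y) :
    ∃ (Ω : Type) (_ : MeasurableSpace Ω) (P : Measure Ω) (_ : IsProbabilityMeasure P)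
      (X : T → Ω → ℝ), IsGaussianProcess X P ∧ (∀ t, ∫ ω, X t ω ∂P = 0) ∧
        ∀ s t, cov[X s, X t; P] = r s t := by
  -- The kernel is realized by feature vectors `φ t` in its reproducing kernel Hilbert space, and
  -- the process is the isonormal process evaluated at them.
  let K : Matrix T T (ℝ →L[ℝ] ℝ) := fun x y => r x y • ContinuousLinearMap.id ℝ ℝ
  have hK : K.PosSemidef := by
    have h := (RKHS.posSemidef_tfae (K := K)).out 0 2
    refine h.2 ⟨?_, fun c => ?_⟩
    · refine Matrix.IsHermitian.ext fun x y => ?_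
      simp only [K, star_smul, star_trivial, hsymm x y]
      congr 1
      exact star_one (ℝ →L[ℝ] ℝ)
    · refine (hpsd c.support c).trans_eq ?_
      simp only [Finsupp.sum, RCLike.re_to_real]
      refine Finset.sum_congr rfl fun x _ => Finset.sum_congr rfl fun y _ => ?_
      simp [K, hsymm x y]
      ring
  have : Fact K.PosSemidef := ⟨hK⟩
  let φ : T → RKHS.OfKernel K := fun t => RKHS.kerFun (RKHS.OfKernel K) t 1
  have hφ : ∀ s t, inner ℝ (φ s) (φ t) = r s t := fun s t => by
    rw [← RKHS.kernel_inner, RKHS.OfKernel.kernel_ofKernel]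
    simp [K, hsymm s t]
  obtain ⟨Ω, mΩ, P, hP, U, hU⟩ := exists_isonormal (RKHS.OfKernel K)
  have hUm : ∀ h, AEMeasurable (U h) P := fun h => (Lp.aestronglyMeasurable (U h)).aemeasurable
  have hmean : ∀ h, ∫ ω, U h ω ∂P = 0 := fun h => by
    have := integral_id_gaussianReal (μ := 0) (v := (‖h‖ ^ 2).toNNReal)
    rwa [← hU h, integral_map (hUm h) (by fun_prop)] at this
  refine ⟨Ω, mΩ, P, hP, fun t => U (φ t), ⟨fun I => ⟨?_⟩⟩, fun t => hmean _, fun s t => ?_⟩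
  · classical
    have hY : AEMeasurable (fun ω => I.restrict fun t => U (φ t) ω) P :=
      aemeasurable_pi_lambda _ fun i => hUm _
    -- A linear functional of the finite vector is, almost surely, the isonormal process at one
    -- combination of feature vectors.
    refine isGaussian_of_map_eq_gaussianReal fun L =>
      ⟨0, _, (Eq.trans ?_ (hU (∑ i : I, L (Pi.single i 1) • φ i)))⟩
    rw [AEMeasurable.map_map_of_aemeasurable (by fun_prop) hY]
    refine Measure.map_congr ?_
    rw [map_sum]
    refine EventuallyEq.trans ?_ (Lp.coeFn_fun_finsetSum _ _).symm
    have : ∀ᵐ ω ∂P, ∀ i : I, U (L (Pi.single i 1) • φ i) ω = L (Pi.single i 1) * U (φ i) ω := by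
      refine ae_all_iff.2 fun i => ?_
      rw [map_smul]
      exact Lp.coeFn_smul _ _
    filter_upwards [this] with ω hω
    simp_rw [hω]
    simp only [Function.comp_apply]
    rw [← Finset.univ_sum_single (I.restrict fun t => U (φ t) ω), map_sum]
    refine Finset.sum_congr rfl fun i _ => ?_
    rw [mul_comm, ← smul_eq_mul, ← map_smul, ← Pi.single_smul, smul_eq_mul, mul_one,
      Finset.restrict_def]
  · rw [covariance_eq_sub (Lp.memLp _) (Lp.memLp _), hmean, zero_mul, sub_zero, ← hφ,
      ← U.inner_map_map, L2.inner_def]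
    refine integral_congr_ae (ae_of_all _ fun ω => ?_)
    simp [mul_comm]

/-- The characteristic function of a linear combination of the values of a centred Gaussian
process. -/
theorem integral_exp_gaussian_process {T Ω : Type*} [MeasurableSpace Ω] {P : Measure Ω}
    {X : T → Ω → ℝ} (hX : IsGaussianProcess X P) (h0 : ∀ t, ∫ ω, X t ω ∂P = 0) {N : ℕ}
    (z : Fin N → T) (t : Fin N → ℝ) :
    ∫ ω, Complex.exp ((∑ i, t i * X (z i) ω : ℝ) * Complex.I) ∂P =
      Complex.exp (-(∑ i, ∑ j, t i * t j * cov[X (z i), X (z j); P] : ℝ) / 2) := by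
  have hP := hX.isProbabilityMeasure
  classical
  have hL : HasGaussianLaw (fun ω => ∑ i, t i * X (z i) ω) P := by
    let L : ((Finset.univ.image z) → ℝ) →L[ℝ] ℝ :=
      ∑ i, t i • ContinuousLinearMap.proj ⟨z i, Finset.mem_image_of_mem _ (Finset.mem_univ i)⟩
    have := (hX.hasGaussianLaw (Finset.univ.image z)).map L
    convert! this using 2 with ω
    simp [L, Finset.restrict_def]
  have hm : ∀ i, MemLp (fun ω => t i * X (z i) ω) 2 P := fun i =>
    (hX.hasGaussianLaw_eval (z i)).memLp_two.const_mul (t i)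
  have hmean : ∫ ω, ∑ i, t i * X (z i) ω ∂P = 0 := by
    rw [integral_finsetSum _ fun i _ => (hm i).integrable (by norm_num)]
    exact Finset.sum_eq_zero fun i _ => by rw [integral_const_mul, h0, mul_zero]
  have hv : Var[fun ω => ∑ i, t i * X (z i) ω; P] =
      ∑ i, ∑ j, t i * t j * cov[X (z i), X (z j); P] := by
    rw [variance_fun_sum hm]
    refine Finset.sum_congr rfl fun i _ => Finset.sum_congr rfl fun j _ => ?_
    rw [covariance_const_mul_left, covariance_const_mul_right, mul_assoc]
  have := charFun_gaussianReal (μ := 0)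
    (v := (Var[fun ω => ∑ i, t i * X (z i) ω; P]).toNNReal) 1
  nth_rw 1 [← hmean] at this
  rw [← hL.map_eq_gaussianReal, charFun_apply_real, integral_map hL.aemeasurable (by fun_prop),
    Real.coe_toNNReal _ (variance_nonneg _ _), hv] at this
  convert! this using 1
  · simp
  · congr 1
    push_cast
    ring

end Isonormal

/-! ### Laws of random vectors and their linear combinations -/

section Laws

variable {Ω Ω' : Type*} [MeasurableSpace Ω] [MeasurableSpace Ω'] {P : Measure Ω} {P' : Measure Ω'}
  {N : ℕ}

theorem charFun_map_toLp {X : Ω → Fin N → ℝ} (hX : AEMeasurable X P)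
    (t : EuclideanSpace ℝ (Fin N)) :
    charFun (P.map fun ω => WithLp.toLp 2 (X ω)) t =
      ∫ ω, Complex.exp ((∑ i, t i * X ω i : ℝ) * Complex.I) ∂P := by
  have hm : AEMeasurable (fun ω => WithLp.toLp 2 (X ω)) P :=
    (WithLp.measurable_toLp 2 _).comp_aemeasurable hX
  rw [charFun_apply, integral_map hm (by fun_prop)]
  refine integral_congr_ae (ae_of_all _ fun ω => ?_)
  simp [PiLp.inner_apply]

theorem map_eq_of_integral_exp [IsProbabilityMeasure P] [IsProbabilityMeasure P']
    {X : Ω → Fin N → ℝ} {Y : Ω' → Fin N → ℝ} (hX : AEMeasurable X P) (hY : AEMeasurable Y P')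
    (h : ∀ t : Fin N → ℝ, ∫ ω, Complex.exp ((∑ i, t i * X ω i : ℝ) * Complex.I) ∂P =
      ∫ ω, Complex.exp ((∑ i, t i * Y ω i : ℝ) * Complex.I) ∂P') :
    P.map X = P'.map Y := by
  have e : P.map (fun ω => WithLp.toLp 2 (X ω)) = P'.map fun ω => WithLp.toLp 2 (Y ω) := by
    refine Measure.ext_of_charFun (funext fun t => ?_)
    rw [charFun_map_toLp hX, charFun_map_toLp hY, h]
  have hm := WithLp.measurable_toLp 2 (Fin N → ℝ)
  have hm' := WithLp.measurable_ofLp 2 (Fin N → ℝ)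
  have := congrArg (Measure.map WithLp.ofLp) e
  have hXm : AEMeasurable (fun ω => WithLp.toLp 2 (X ω)) P := hm.comp_aemeasurable hX
  have hYm : AEMeasurable (fun ω => WithLp.toLp 2 (Y ω)) P' := hm.comp_aemeasurable hY
  rwa [AEMeasurable.map_map_of_aemeasurable hm'.aemeasurable hXm,
    AEMeasurable.map_map_of_aemeasurable hm'.aemeasurable hYm] at this

/-- The Cramér–Wold device. -/
theorem tendstoInDistribution_of_tendsto_integral_exp [IsProbabilityMeasure P]
    [IsProbabilityMeasure P'] {X : ℝ → Ω → Fin N → ℝ} {Y : Ω' → Fin N → ℝ}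
    (hX : ∀ n, AEMeasurable (X n) P) (hY : AEMeasurable Y P')
    (h : ∀ t : Fin N → ℝ,
      Tendsto (fun n => ∫ ω, Complex.exp ((∑ i, t i * X n ω i : ℝ) * Complex.I) ∂P) atTop
        (𝓝 (∫ ω, Complex.exp ((∑ i, t i * Y ω i : ℝ) * Complex.I) ∂P'))) :
    TendstoInDistribution X atTop Y (fun _ => P) P' := by
  have hm := WithLp.measurable_toLp 2 (Fin N → ℝ)
  have h1 : TendstoInDistribution (fun n ω => WithLp.toLp 2 (X n ω)) atTop
      (fun ω => WithLp.toLp 2 (Y ω)) (fun _ => P) P' := by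
    refine ⟨fun n => hm.comp_aemeasurable (hX n), hm.comp_aemeasurable hY, ?_⟩
    refine tendsto_of_seq_tendsto fun u hu => ?_
    refine ProbabilityMeasure.tendsto_of_tendsto_charFun fun t => ?_
    have e := charFun_map_toLp hY t
    refine (((h t).comp hu).congr fun n => ?_).trans_eq (congrArg 𝓝 e.symm)
    exact (charFun_map_toLp (hX _) t).symm
  exact h1.continuous_comp (PiLp.continuous_ofLp 2 fun _ : Fin N => ℝ)

end Laws

/-- Finite-dimensional laws of a centred Gaussian process are determined by the covariance, which
here depends on differences only. -/
theorem isCentredStationaryGaussianField_of_covariance {Ω : Type*} [MeasurableSpace Ω]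
    {P : Measure Ω} {d : ℕ} {G : Space d → Ω → ℝ} {K : Space d → ℝ} (hG : IsGaussianProcess G P)
    (h0 : ∀ z, ∫ ω, G z ω ∂P = 0) (hK : ∀ z w, cov[G z, G w; P] = K (z - w)) :
    IsCentredStationaryGaussianField P G K where
  gaussian := hG
  centred := h0
  covariance := hK
  stationary h N z := by
    have hP := hG.isProbabilityMeasure
    have hm : ∀ z : Fin N → Space d, AEMeasurable (fun ω i => G (z i) ω) P := fun z =>
      aemeasurable_pi_lambda _ fun i => hG.aemeasurable _
    refine ⟨hm fun i => z i + h, hm z, ?_⟩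
    refine map_eq_of_integral_exp (hm fun i => z i + h) (hm z) fun t => ?_
    rw [integral_exp_gaussian_process hG h0 (fun i => z i + h),
      integral_exp_gaussian_process hG h0]
    simp_rw [hK, add_sub_add_right_eq_sub]

/-- A kernel that is a limit of normalized covariances is positive semidefinite. -/
theorem sum_mul_nonneg_of_tendsto_covariance {ι Ω T : Type*} [MeasurableSpace Ω] {P : Measure Ω}
    [IsProbabilityMeasure P] {l : Filter ι} [l.NeBot] {X : ι → T → Ω → ℝ} {V : ι → ℝ}
    {r : T → T → ℝ} (s : Finset T) (hX : ∀ n, ∀ x ∈ s, MemLp (X n x) 2 P)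
    (hV : ∀ᶠ n in l, 0 ≤ V n)
    (hr : ∀ x ∈ s, ∀ y ∈ s, Tendsto (fun n => cov[X n x, X n y; P] / V n) l (𝓝 (r x y)))
    (c : T → ℝ) : 0 ≤ ∑ x ∈ s, ∑ y ∈ s, c x * c y * r x y := by
  have h : Tendsto (fun n => ∑ x ∈ s, ∑ y ∈ s, c x * c y * (cov[X n x, X n y; P] / V n)) l
      (𝓝 (∑ x ∈ s, ∑ y ∈ s, c x * c y * r x y)) :=
    tendsto_finsetSum _ fun x hx => tendsto_finsetSum _ fun y hy => (hr x hx y hy).const_mul _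
  refine ge_of_tendsto h ?_
  filter_upwards [hV] with n hn
  have e : Var[fun ω => ∑ x ∈ s, c x * X n x ω; P] =
      ∑ x ∈ s, ∑ y ∈ s, c x * c y * cov[X n x, X n y; P] := by
    rw [variance_fun_sum' fun x hx => (hX n x hx).const_mul (c x)]
    refine Finset.sum_congr rfl fun x _ => Finset.sum_congr rfl fun y _ => ?_
    rw [covariance_const_mul_left, covariance_const_mul_right, mul_assoc]
  simp_rw [← mul_div_assoc, ← Finset.sum_div, ← e]
  exact div_nonneg (variance_nonneg _ _) hn

/-! ### The central limit theorem for box counts -/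

section

variable {Ω : Type*} [MeasurableSpace Ω] {P : Measure Ω} [IsProbabilityMeasure P] {d : ℕ}
  {η : Ω → Measure (Space d)} {β : SignedMeasure (Space d)} {K : Space d → ℝ}

theorem volume_box (z : Space d) {n : ℝ} (hn : 0 ≤ n) : (volume (box z n)).toReal = n ^ d := by
  have := volume_box_inter z z 0 n
  simpa [tent, hn] using this

theorem boxCov_zero_nonneg (hη : IsStationaryHyperuniform P η)
    (hβ : IsTruncatedPairCorrelation P η β) (hB : IsBrillingerMixing P η) (n : ℝ) :
    0 ≤ boxCov β n 0 := by
  rw [← variance_box hη hβ hB n 0]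
  exact variance_nonneg _ _

theorem HasBoxCovLimit.tendsto_covariance (hK : HasBoxCovLimit β K)
    (hη : IsStationaryHyperuniform P η) (hβ : IsTruncatedPairCorrelation P η β)
    (hB : IsBrillingerMixing P η) (z w : Space d) :
    Tendsto (fun n : ℝ => cov[pointCount η (box (n • z) n), pointCount η (box (n • w) n); P] /
      boxCov β n 0) atTop (𝓝 (K (z - w))) := by
  refine (hK.tendsto (z - w)).congr fun n => ?_
  rw [covariance_box hη hβ hB, smul_sub]

theorem HasBoxCovLimit.isLimitCovariance (hK : HasBoxCovLimit β K)
    (hη : IsStationaryHyperuniform P η) (hβ : IsTruncatedPairCorrelation P η β)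
    (hB : IsBrillingerMixing P η) : IsLimitCovariance P η K := fun z => by
  refine (hK.tendsto z).congr fun n => ?_
  rw [covariance_box hη hβ hB, variance_box hη hβ hB, zero_sub, boxCov_neg hη hβ hB]

theorem HasBoxCovLimit.neg (hK : HasBoxCovLimit β K)
    (hη : IsStationaryHyperuniform P η) (hβ : IsTruncatedPairCorrelation P η β)
    (hB : IsBrillingerMixing P η) (z : Space d) : K (-z) = K z := by
  refine tendsto_nhds_unique (hK.tendsto (-z)) ((hK.tendsto z).congr fun n => ?_)
  rw [smul_neg, boxCov_neg hη hβ hB]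

/-- The quotient is `O(n^(d - kδ/2))`: the volume bound on a cumulant against the normalization of
order `k`. -/
theorem tendsto_pow_div_pow_of_growth {V : ℝ → ℝ} {c δ : ℝ} (hc : 0 < c) {k : ℕ}
    (hV : ∀ᶠ n : ℝ in atTop, c * n ^ δ ≤ V n) (hk : d < k * (δ / 2)) :
    Tendsto (fun n : ℝ => n ^ d / √(V n) ^ k) atTop (𝓝 0) := by
  have h : Tendsto (fun n : ℝ => (√c ^ k)⁻¹ * n ^ (-(k * (δ / 2) - d))) atTop (𝓝 0) := by
    simpa using (tendsto_rpow_neg_atTop (sub_pos.2 hk)).const_mul (√c ^ k)⁻¹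
  refine squeeze_zero' ?_ ?_ h
  · filter_upwards [eventually_gt_atTop 0] with n hn
    positivity
  · filter_upwards [eventually_gt_atTop 0, hV] with n hn hVn
    have h1 : √c * n ^ (δ / 2) ≤ √(V n) := by
      refine Real.le_sqrt_of_sq_le ?_
      rw [mul_pow, Real.sq_sqrt hc.le, ← Real.rpow_natCast, ← Real.rpow_mul hn.le]
      simpa using hVn
    have h2 : 0 < √c * n ^ (δ / 2) := by positivity
    calc n ^ d / √(V n) ^ k ≤ n ^ d / (√c * n ^ (δ / 2)) ^ k := by gcongr
      _ = _ := by
        rw [mul_pow, ← Real.rpow_natCast (n ^ (δ / 2)), ← Real.rpow_mul hn.le, neg_sub,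
          Real.rpow_sub hn, Real.rpow_natCast, mul_comm (δ / 2)]
        field_simp

/-- The second cumulant converges by convergence of covariances. The higher ones are bounded by the
volume of the union of the boxes, of order `n^d`, divided by a power of the standard deviation, and
vanish for large order. Normal convergence by higher cumulants concludes. -/
theorem HasBoxCovLimit.tendsto_integral_exp (hK : HasBoxCovLimit β K)
    (hη : IsStationaryHyperuniform P η) (hβ : IsTruncatedPairCorrelation P η β)
    (hB : IsBrillingerMixing P η) {N : ℕ} (z : Fin N → Space d) (t : Fin N → ℝ) :
    Tendsto (fun n : ℝ =>
        ∫ ω, Complex.exp ((∑ i, t i * normalizedCount P η n (z i) ω : ℝ) * Complex.I) ∂P) atTop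
      (𝓝 (Complex.exp (-(∑ i, ∑ j, t i * t j * K (z i - z j) : ℝ) / 2))) := by
  obtain ⟨C, hC⟩ := exists_cumulant_bound hη.pointProcess hB hη.unitIntensity t
  set U : ℝ → Set (Space d) := fun n => ⋃ j, box (n • z j) n
  have hU : ∀ n, 0 ≤ n → (volume (U n)).toReal ≤ N * n ^ d := fun n hn => by
    have h1 : (volume (U n)).toReal ≤ ∑ j, (volume (box (n • z j) n)).toReal := by
      rw [← ENNReal.toReal_sum fun j _ => (isBounded_box _ _).measure_lt_top.ne]
      refine ENNReal.toReal_mono ?_ (measure_iUnion_fintype_le _ _)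
      exact (ENNReal.sum_lt_top.2 fun j _ => (isBounded_box _ _).measure_lt_top).ne
    simpa [volume_box _ hn] using h1
  set S : ℝ → Ω → ℝ := fun n ω => ∑ j, t j * (pointCount η (box (n • z j) n) ω -
    (volume (box (n • z j) n)).toReal) with hS
  have hC' := fun n : ℝ => hC (U n) (fun j => box (n • z j) n)
    (MeasurableSet.iUnion fun j => measurableSet_box _ _)
    ((Bornology.isBounded_iUnion).2 fun j => isBounded_box _ _)
    (fun j => measurableSet_box _ _) (fun j => Set.subset_iUnion (fun j => box (n • z j) n) j)
  choose hint κ hκ hκ1 hκC using hC'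
  set V : ℝ → ℝ := fun n => boxCov β n 0 with hV
  have hV0 : ∀ n, 0 ≤ V n := boxCov_zero_nonneg hη hβ hB
  have hL2 : ∀ n j, MemLp (pointCount η (box (n • z j) n)) 2 P := fun n j =>
    hB.memLp_pointCount hη.pointProcess (measurableSet_box _ _) (isBounded_box _ _)
  -- The factor `1/2` is the `2!` by which the moments, and thus the `κ`, are divided.
  have hκ2 : ∀ n, κ n 2 = (∑ i, ∑ j, t i * t j *
      cov[pointCount η (box (n • z i) n), pointCount η (box (n • z j) n); P]) / 2 := fun n => by
    have h0 := (hκ n).zero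
    have h1 := (hκ n).succ 0
    have h2 := (hκ n).succ 1
    simp only [zero_add, Finset.sum_range_succ, Finset.sum_range_zero, tsub_zero, hκ1 n,
      Nat.cast_zero, one_mul, mul_zero, zero_mul, Nat.cast_one, tsub_self, h0, mul_one] at h1 h2
    have hT : ∀ j, MemLp (fun ω => t j * (pointCount η (box (n • z j) n) ω -
        (volume (box (n • z j) n)).toReal)) 2 P := fun j =>
      ((hL2 n j).sub (memLp_const _)).const_mul (t j)
    have hSm : MemLp (S n) 2 P := memLp_finsetSum _ fun j _ => hT j
    have hmean : ∫ ω, S n ω ∂P = 0 := by simpa using h1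
    have hvar : Var[S n; P] = ∑ i, ∑ j, t i * t j *
        cov[pointCount η (box (n • z i) n), pointCount η (box (n • z j) n); P] := by
      rw [hS, variance_fun_sum hT]
      refine Finset.sum_congr rfl fun i _ => Finset.sum_congr rfl fun j _ => ?_
      rw [covariance_const_mul_left, covariance_const_mul_right, mul_assoc,
        covariance_sub_const_left ((hL2 n i).integrable (by norm_num)),
        covariance_sub_const_right ((hL2 n j).integrable (by norm_num))]
    rw [variance_of_integral_eq_zero hSm.aemeasurable hmean] at hvar
    rw [← hvar]
    simp only [hS, Nat.factorial_two, Nat.cast_ofNat, Nat.reduceAdd] at h2 ⊢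
    linarith
  obtain ⟨c, δ, hc, hδ, hgrowth⟩ := hK.growth
  -- Orders `k > 2d/δ` are those where the volume bound beats the normalization; hence the threshold
  -- `⌈2d/δ⌉ + 2`.
  have key := tendsto_charFun_of_tendsto_cumulants (P := P) (l := atTop)
    (X := fun n ω => (√(V n))⁻¹ * S n ω) (κ := fun n k => (√(V n))⁻¹ ^ k * κ n k)
    (v := (∑ i, ∑ j, t i * t j * K (z i - z j)) / 2) (K := ⌈d / (δ / 2)⌉₊ + 2)
    (fun n k => by simp_rw [mul_pow]; exact (hint n k).const_mul _)
    (fun n => by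
      convert! (hκ n).rescale (√(V n))⁻¹ using 2 with k
      simp_rw [mul_pow, integral_const_mul, mul_div_assoc]
      rfl)
    (by simp [hκ1]) ?_ ?_
  · refine (key.congr' ?_).trans_eq ?_
    · filter_upwards [eventually_ge_atTop 0] with n hn
      refine integral_congr_ae (ae_of_all _ fun ω => ?_)
      simp only [hS, normalizedCount, variance_box hη hβ hB, volume_box _ hn, Finset.mul_sum, hV]
      congr 3
      refine Finset.sum_congr rfl fun i _ => ?_
      ring
    · push_cast
      rw [neg_div]
  · have h : Tendsto (fun n => (∑ i, ∑ j, t i * t j *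
        (cov[pointCount η (box (n • z i) n), pointCount η (box (n • z j) n); P] / V n)) / 2) atTop
        (𝓝 ((∑ i, ∑ j, t i * t j * K (z i - z j)) / 2)) :=
      (tendsto_finsetSum _ fun i _ => tendsto_finsetSum _ fun j _ =>
        (hK.tendsto_covariance hη hβ hB (z i) (z j)).const_mul _).div_const 2
    refine h.congr fun n => ?_
    rw [hκ2, inv_pow, Real.sq_sqrt (hV0 n)]
    simp_rw [← mul_div_assoc, ← Finset.sum_div]
    ring
  · intro k hk
    have hk' : d < k * (δ / 2) := by
      rw [← div_lt_iff₀ (by positivity)]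
      refine (Nat.le_ceil _).trans_lt ?_
      exact_mod_cast (by omega : ⌈d / (δ / 2)⌉₊ < k)
    have h := (tendsto_pow_div_pow_of_growth hc hgrowth hk').const_mul (|C k| * N)
    rw [mul_zero] at h
    refine squeeze_zero_norm' ?_ h
    filter_upwards [eventually_ge_atTop 0] with n hn
    rw [Real.norm_eq_abs, abs_mul, abs_of_nonneg (by positivity), inv_pow, inv_mul_eq_div,
      ← mul_div_assoc]
    refine div_le_div_of_nonneg_right ?_ (by positivity)
    calc |κ n k| ≤ C k * (volume (U n)).toReal := hκC n k (by omega)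
      _ ≤ |C k| * (N * n ^ d) :=
        mul_le_mul (le_abs_self _) (hU n hn) ENNReal.toReal_nonneg (abs_nonneg _)
      _ = _ := by ring

theorem HasBoxCovLimit.tendstoFDD (hK : HasBoxCovLimit β K)
    (hη : IsStationaryHyperuniform P η) (hβ : IsTruncatedPairCorrelation P η β)
    (hB : IsBrillingerMixing P η) {Ω' : Type*} [MeasurableSpace Ω'] {P' : Measure Ω'}
    [IsProbabilityMeasure P'] {G : Space d → Ω' → ℝ}
    (hG : IsCentredStationaryGaussianField P' G K) :
    TendstoFDD (normalizedCount P η) P G P' := fun N z => by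
  refine tendstoInDistribution_of_tendsto_integral_exp (fun n => ?_)
    (aemeasurable_pi_lambda _ fun i => hG.gaussian.aemeasurable _) fun t => ?_
  · refine (measurable_pi_lambda _ fun i => ?_).aemeasurable
    exact ((hη.pointProcess.measurable_pointCount (measurableSet_box _ _)).sub_const _).div_const _
  · rw [integral_exp_gaussian_process hG.gaussian hG.centred]
    simp_rw [hG.covariance]
    exact hK.tendsto_integral_exp hη hβ hB z t

/-- The limit kernel inherits positive semidefiniteness from the covariances of the counts, so a
Gaussian field with this covariance exists. -/
theorem HasBoxCovLimit.boxCountCLT (hK : HasBoxCovLimit β K)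
    (hη : IsStationaryHyperuniform P η) (hβ : IsTruncatedPairCorrelation P η β)
    (hB : IsBrillingerMixing P η) : BoxCountCLT P η := by
  obtain ⟨Ω', mΩ', P', hP', G, hG, h0, hcov⟩ := exists_gaussian_process
    (fun z w : Space d => K (z - w))
    (fun z w => by rw [← neg_sub, hK.neg hη hβ hB])
    (fun s c => sum_mul_nonneg_of_tendsto_covariance (P := P) (l := atTop)
      (X := fun (n : ℝ) z => pointCount η (box (n • z) n)) s
      (fun n z _ => hB.memLp_pointCount hη.pointProcess (measurableSet_box _ _)
        (isBounded_box _ _))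
      (Eventually.of_forall (boxCov_zero_nonneg hη hβ hB))
      (fun z _ w _ => hK.tendsto_covariance hη hβ hB z w) c)
  have hF := isCentredStationaryGaussianField_of_covariance hG h0 hcov
  exact ⟨K, hK.isLimitCovariance hη hβ hB, Ω', mΩ', P', hP', G, hF, hK.tendstoFDD hη hβ hB hF⟩

end

/-! ### Fractional Brownian motion -/

section

variable {Ω : Type*} [MeasurableSpace Ω] {P : Measure Ω} [IsProbabilityMeasure P]
  {η : Ω → Measure (Space 1)} {β : SignedMeasure (Space 1)}

-- The closed intervals `[0, r]` and `[r, s]` share an endpoint, which almost surely carries no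
-- point of the process.
omit [IsProbabilityMeasure P] in
theorem pointCount_box_sub_ae (hη : IsPointProcess η) (hI : HasUnitIntensity P η) {r s : ℝ}
    (hr : 0 ≤ r) (hrs : r ≤ s) :
    (fun ω => pointCount η (box 0 s) ω - pointCount η (box 0 r) ω) =ᵐ[P]
      pointCount η (box (!₂[r] : Space 1) (s - r)) := by
  have hunion : box (0 : Space 1) r ∪ box (!₂[r] : Space 1) (s - r) = box 0 s := by
    ext x
    simp only [box, Fin.forall_fin_one, Set.mem_union, Set.mem_ofPred_eq, PiLp.zero_apply]
    simp
    grind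
  have hinter : volume (box (0 : Space 1) r ∩ box (!₂[r] : Space 1) (s - r)) = 0 := by
    have h : box (0 : Space 1) r ∩ box (!₂[r] : Space 1) (s - r) ⊆ box (!₂[r] : Space 1) 0 := fun x hx => by
      simp only [box, Fin.forall_fin_one, Set.mem_inter_iff, Set.mem_ofPred_eq,
        PiLp.zero_apply] at hx ⊢
      simp at hx ⊢
      grind
    refine measure_mono_null h ?_
    have := volume_box (!₂[r] : Space 1) le_rfl
    rw [pow_one, ENNReal.toReal_eq_zero_iff] at this
    exact this.resolve_right (isBounded_box _ _).measure_lt_top.ne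
  have hm := (measurableSet_box (0 : Space 1) r).inter (measurableSet_box (!₂[r] : Space 1) (s - r))
  have h0 : ∀ᵐ ω ∂P, η ω (box (0 : Space 1) r ∩ box (!₂[r] : Space 1) (s - r)) = 0 := by
    rw [← hI _ hm] at hinter
    exact (lintegral_eq_zero_iff ((Measure.measurable_coe hm).comp hη.measurable)).1 hinter
  filter_upwards [h0] with ω hω
  have h := measure_union_add_inter (μ := η ω) (box (0 : Space 1) r)
    (measurableSet_box (!₂[r] : Space 1) (s - r))
  rw [hunion, hω, add_zero] at h
  have hf : ∀ (z : Space 1) n, η ω (box z n) ≠ ∞ := fun z n =>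
    ((hη.simple ω).measure_lt_top (isBounded_box z n)).ne
  simp only [pointCount]
  rw [h, ENNReal.toReal_add (hf _ _) (hf _ _)]
  ring

theorem variance_pointCount_box_sub (hη : IsStationaryHyperuniform P η)
    (hβ : IsTruncatedPairCorrelation P η β) (hB : IsBrillingerMixing P η) {r s : ℝ} (hr : 0 ≤ r)
    (hs : 0 ≤ s) :
    Var[fun ω => pointCount η (box 0 s) ω - pointCount η (box 0 r) ω; P] =
      boxCov β |s - r| 0 := by
  wlog h : r ≤ s generalizing r s
  · rw [abs_sub_comm, ← this hs hr (le_of_not_ge h), ← variance_neg]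
    congr 1
    ext ω
    simp
  rw [variance_congr (pointCount_box_sub_ae hη.pointProcess hη.unitIntensity hr h),
    variance_box hη hβ hB, abs_of_nonneg (sub_nonneg.2 h)]

/-- The covariance of the counts on the increments `[τ, τ + s]` and `[τ, τ + t]`, where `s` and `t`
may be negative. -/
theorem covariance_pointCount_box_sub (hη : IsStationaryHyperuniform P η)
    (hβ : IsTruncatedPairCorrelation P η β) (hB : IsBrillingerMixing P η) {r s t : ℝ} (hr : 0 ≤ r)
    (hs : 0 ≤ s) (ht : 0 ≤ t) :
    cov[fun ω => pointCount η (box 0 s) ω - pointCount η (box 0 r) ω,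
      fun ω => pointCount η (box 0 t) ω - pointCount η (box 0 r) ω; P] =
      (boxCov β |s - r| 0 + boxCov β |t - r| 0 - boxCov β |t - s| 0) / 2 := by
  have hm : ∀ n : ℝ, MemLp (pointCount η (box (0 : Space 1) n)) 2 P := fun n =>
    hB.memLp_pointCount hη.pointProcess (measurableSet_box _ _) (isBounded_box _ _)
  -- Polarization: the difference of two increments from `r` is the increment between `s` and `t`.
  have h := variance_fun_sub ((hm t).sub (hm r)) ((hm s).sub (hm r))
  simp only [Pi.sub_apply, sub_sub_sub_cancel_right] at h
  rw [variance_pointCount_box_sub hη hβ hB hs ht] at h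
  have h1 := variance_pointCount_box_sub hη hβ hB hr ht
  have h2 := variance_pointCount_box_sub hη hβ hB hr hs
  rw [covariance_comm]
  change _ = Var[fun ω => pointCount η (box 0 t) ω - pointCount η (box 0 r) ω; P] - 2 *
    cov[fun ω => pointCount η (box 0 t) ω - pointCount η (box 0 r) ω,
      fun ω => pointCount η (box 0 s) ω - pointCount η (box 0 r) ω; P] +
    Var[fun ω => pointCount η (box 0 s) ω - pointCount η (box 0 r) ω; P] at h
  linarith

/-- The limit variance of the box counts makes the covariance kernel of fractional Brownian motion
positive semidefinite. -/
theorem fractional_kernel_nonneg (hη : IsStationaryHyperuniform P η)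
    (hβ : IsTruncatedPairCorrelation P η β) (hB : IsBrillingerMixing P η) {a : ℝ} (ha : 0 < a)
    (hG : IsRegularlyVarying (integratedTail β) a) (s : Finset ℝ) (c : ℝ → ℝ) :
    0 ≤ ∑ x ∈ s, ∑ y ∈ s, c x * c y * ((|x| ^ a + |y| ^ a - |y - x| ^ a) / 2) := by
  -- Times may be negative while boxes need nonnegative side lengths, so everything is translated by
  -- `τ`; including `0` ensures `τ ≥ 0`.
  obtain ⟨τ, hτ⟩ : ∃ τ : ℝ, ∀ x ∈ insert 0 s, 0 ≤ τ + x := by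
    obtain ⟨m, hm⟩ := (insert 0 s).bddBelow
    exact ⟨-m, fun x hx => by linarith [hm hx]⟩
  have hτ0 : 0 ≤ τ := by simpa using hτ 0 (Finset.mem_insert_self _ _)
  refine sum_mul_nonneg_of_tendsto_covariance (P := P) (l := atTop) (V := fun n => boxCov β n 0)
    (X := fun (n : ℝ) x ω => pointCount η (box 0 (n * (τ + x))) ω - pointCount η (box 0 (n * τ)) ω)
    s (fun n x _ => ?_) (Eventually.of_forall (boxCov_zero_nonneg hη hβ hB))
    (fun x hx y hy => ?_) c
  · exact (hB.memLp_pointCount hη.pointProcess (measurableSet_box _ _) (isBounded_box _ _)).sub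
      (hB.memLp_pointCount hη.pointProcess (measurableSet_box _ _) (isBounded_box _ _))
  · have h := fun u : ℝ => tendsto_boxCov_ratio hη hβ hB ha hG (abs_nonneg u)
    refine ((((h x).add (h y)).sub (h (y - x))).div_const 2).congr' ?_
    filter_upwards [eventually_ge_atTop 0] with n hn
    have e : ∀ u, |n * u| = n * |u| := fun u => by rw [abs_mul, abs_of_nonneg hn]
    rw [covariance_pointCount_box_sub hη hβ hB (mul_nonneg hn hτ0)
      (mul_nonneg hn (hτ x (Finset.mem_insert_of_mem hx)))
      (mul_nonneg hn (hτ y (Finset.mem_insert_of_mem hy))), ← mul_sub, ← mul_sub, ← mul_sub, e, e,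
      e, add_sub_cancel_left, add_sub_cancel_left, add_sub_add_left_eq_sub]
    ring

/-- The increments of a fractional Brownian motion over unit intervals. -/
theorem IsFractionalBrownianMotion.isCentredStationaryGaussianField {Ω' : Type*}
    [MeasurableSpace Ω'] {P' : Measure Ω'} {B : ℝ → Ω' → ℝ} {H : ℝ}
    (hB : IsFractionalBrownianMotion P' B H) :
    IsCentredStationaryGaussianField P' (fun (z : Space 1) ω => B (z 0 + 1) ω - B (z 0) ω)
      fun u => (|u 0 + 1| ^ (2 * H) + |u 0 - 1| ^ (2 * H) - 2 * |u 0| ^ (2 * H)) / 2 := by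
  have hm : ∀ s, MemLp (B s) 2 P' := fun s => (hB.gaussian.hasGaussianLaw_eval s).memLp_two
  have hP := hB.gaussian.isProbabilityMeasure
  refine isCentredStationaryGaussianField_of_covariance ?_ (fun z => ?_) fun z w => ?_
  · classical
    exact hB.gaussian.of_isGaussianProcess fun z => ⟨{z 0 + 1, z 0},
      ContinuousLinearMap.proj ⟨z 0 + 1, by simp⟩ - ContinuousLinearMap.proj ⟨z 0, by simp⟩,
      fun ω => rfl⟩
  · rw [integral_sub ((hm _).integrable (by norm_num)) ((hm _).integrable (by norm_num)),
      hB.centred, hB.centred, sub_zero]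
  · change cov[B (z 0 + 1) - B (z 0), B (w 0 + 1) - B (w 0); P'] = _
    rw [covariance_sub_left (hm _) (hm _) ((hm _).sub (hm _)),
      covariance_sub_right (hm _) (hm _) (hm _), covariance_sub_right (hm _) (hm _) (hm _)]
    simp only [hB.covariance, PiLp.sub_apply]
    rw [show w 0 + 1 - (z 0 + 1) = -(z 0 - w 0) by ring,
      show w 0 - (z 0 + 1) = -(z 0 - w 0 + 1) by ring,
      show w 0 + 1 - z 0 = -(z 0 - w 0 - 1) by ring, show w 0 - z 0 = -(z 0 - w 0) by ring]
    simp only [abs_neg]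
    ring

/-- The covariance kernel of fractional Brownian motion is positive semidefinite because it is the
limit of normalized covariances of increments of the counting function. The unit increments of the
resulting motion then have the limit covariance. -/
theorem boxCountCLTFractional (hη : IsStationaryHyperuniform P η)
    (hβ : IsTruncatedPairCorrelation P η β) (hB : IsBrillingerMixing P η) {a : ℝ} (ha : 0 < a)
    (hG : IsRegularlyVarying (integratedTail β) a) : BoxCountCLTFractional P η (a / 2) := by
  have hK := hasBoxCovLimit_of_isRegularlyVarying hη hβ hB ha hG
  obtain ⟨Ω', mΩ', P', hP', B, hBG, h0, hcov⟩ := exists_gaussian_process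
    (fun s t : ℝ => (|s| ^ a + |t| ^ a - |t - s| ^ a) / 2)
    (fun s t => by rw [abs_sub_comm, add_comm])
    (fractional_kernel_nonneg hη hβ hB ha hG)
  have e : 2 * (a / 2) = a := by ring
  have hBm : IsFractionalBrownianMotion P' B (a / 2) := ⟨hBG, h0, by rwa [e]⟩
  have hF := hBm.isCentredStationaryGaussianField
  rw [e] at hF
  exact ⟨_, hK.isLimitCovariance hη hβ hB, Ω', mΩ', P', hP', B, hBm, hF,
    hK.tendstoFDD hη hβ hB hF⟩

end

/-! ### The three cases of the theorem -/

theorem theorem1p3 {Ω : Type*} [MeasurableSpace Ω] (P : Measure Ω) [IsProbabilityMeasure P] :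
    -- the integrable case, in dimension `d ≥ 2`
    (∀ (d : ℕ), 2 ≤ d → ∀ (η : Ω → Measure (Space d)) (β : SignedMeasure (Space d)),
      IsStationaryHyperuniform P η → IsTruncatedPairCorrelation P η β → IsBrillingerMixing P η →
      IsSymmetricMeasure β → Integrable (fun y : Space d => ‖y‖) β.totalVariation →
      BoxCountCLT P η) ∧
    -- the regularly varying case in dimension one, with index `a ∈ (0, 1]`
    (∀ (η : Ω → Measure (Space 1)) (β : SignedMeasure (Space 1)) (a : ℝ),
      IsStationaryHyperuniform P η → IsTruncatedPairCorrelation P η β → IsBrillingerMixing P η →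
      0 < a → a ≤ 1 → IsRegularlyVarying (integratedTail β) a →
      BoxCountCLTFractional P η (a / 2)) ∧
    -- the regularly varying case in dimension two
    (∀ (η : Ω → Measure (Space 2)) (β : SignedMeasure (Space 2)) (a₁ a₂ K₁ : ℝ)
      (g₁ g₂ : Space 2 → ℝ),
      IsStationaryHyperuniform P η → IsTruncatedPairCorrelation P η β → IsBrillingerMixing P η →
      IsSymmetricMeasure β →
      IsRegularlyVarying₂ (integratedTail₂ β 1) a₁ g₁ →
      IsRegularlyVarying₂ (integratedTail₂ β (-1)) a₂ g₂ →
      Tendsto (fun n : ℝ => integratedTail₂ β 1 n n / integratedTail₂ β (-1) n n) atTop (𝓝 K₁) →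
      BoxCountCLT P η) := by
  refine ⟨fun d hd η β hη hβ hB _ hint => ?_, fun η β a hη hβ hB ha _ hG => ?_,
    fun η β a₁ a₂ K₁ g₁ g₂ hη hβ hB hs _ hG _ => ?_⟩
  · obtain ⟨K, hK⟩ := exists_hasBoxCovLimit_of_integrable hd hη hβ hB hint
    exact hK.boxCountCLT hη hβ hB
  · exact boxCountCLTFractional hη hβ hB ha hG
  · obtain ⟨K, hK⟩ := exists_hasBoxCovLimit_of_isRegularlyVarying₂ hη hβ hB hs hG
    exact hK.boxCountCLT hη hβ hB
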